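/- Let $\varepsilon>0$ and $\beta>1/2$ be constants. Let $(\Gamma_i)_{i\in\mathbb N}$ be a sequence of finite simple graphs, where $\Gamma_i$ has $n=n_i$ vertices and $n_i\to\infty$ as $i\to\infty$. Suppose that $\Gamma_i$ has minimum degree $d_i$, where $d_i=\beta n_i$ up to rounding, i.e. $|d_i-\beta n_i|\le 1$, and that at least $\varepsilon n_i$ vertices of $\Gamma_i$ have degree exactly $d_i$. Let $(c_i)$ be a sequence of reals and let $p_i\in[0,1]$ satisfy, for all large $i$, $$p_i=\frac{\log n_i+\log\log n_i+c_i}{\beta n_i}.$$ Let $\Gamma_{i,p_i}$ be the random subgraph of $\Gamma_i$, on the same vertex set, in which each edge of $\Gamma_i$ is retained independently with probability $p_i$. Then $$\lim_{i\to\infty}\Pr[\Gamma_{i,p_i}\text{ contains a Hamilton cycle}]=\begin{cases}0,& c_i\to-\infty,\\ 1,& c_i\to\infty.\end{cases}$$ Furthermore, if every $\Gamma_i$ is $d_i$-regular and $c_i\to c$ for some constant $c\in\mathbb R$, then $$\lim_{i\to\infty}\Pr[\Gamma_{i,p_i}\text{ contains a Hamilton cycle}]=e^{-e^{-c}}.$$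 -/

import Mathlib

open MeasureTheory ProbabilityTheory Filter Topology

/-- The law of the random subgraph of `Γ` (on the same vertex set) in which every edge of `Γ` is
retained independently with probability `p`: the edge set is a `p`-Bernoulli subset of the edge
set of `Γ`. -/
noncomputable def randomSubgraph {V : Type*} (Γ : SimpleGraph V) (p : unitInterval) :
    Measure (SimpleGraph V) :=
  (setBernoulli Γ.edgeSet p).map SimpleGraph.fromEdgeSet

/-- The probability that the random subgraph of `Γ` with retention probability `p` contains a
Hamilton cycle. -/
noncomputable def probHamiltonian {V : Type*} [Fintype V] [DecidableEq V]
    (Γ : SimpleGraph V) (p : unitInterval) : ℝ :=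
  (randomSubgraph Γ p).real {G | G.IsHamiltonian}

/-!
The only obstruction to Hamiltonicity is a vertex of degree at most one. Such vertices are nearly
independent, so Bonferroni's inequalities, applied to the binomial moments of their number, show
that the number is asymptotically Poisson; its mean tends to `exp (-c₀)` for a regular graph at
expected degree `log n + log log n + c₀`.

Given minimum degree two, the random graph is Hamiltonian with high probability. It is sampled in
independent rounds. The first one, with the edges at its few vertices of small degree, makes small
vertex sets expand, so that in every graph `H` between it and the random graph longest paths have,
under Pósa rotations, many possible first vertices and, for each of them, many possible last
vertices. If such a path runs from `x` to `y`, then edges `s(x, w')` and `s(y, w)`, where `w` and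
`w'` are consecutive on it, close it to a cycle, and by connectivity `H` becomes Hamiltonian or gets
a longer path. As degrees exceed `n / 2`, the `Γ`-neighbours of `x` and the shifted `Γ`-neighbours
of `y` overlap in linearly many vertices, so the last two rounds provide such a pair of edges for
every sparse `H` simultaneously, by a union bound. Adding at most two edges per unit of length
gained keeps `H` sparse.
-/

lemma one_le_inv_pow_mul_pow {x : ℝ} (hx0 : 0 < x) (hx1 : x ≤ 1) {k K : ℕ} (hk : k ≤ K) :
    1 ≤ x⁻¹ ^ K * x ^ k := by
  rw [inv_pow, ← div_eq_inv_mul, one_le_div (by positivity)]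
  exact pow_le_pow_of_le_one hx0.le hx1 hk

section Bernoulli

variable {ι κ : Type*} [DecidableEq ι] {E A B : Finset ι} {p q : ℝ}

/-- The expectation of `f S`, where `S` is a `p`-Bernoulli random subset of the finite set `E`.
It is written as a finite sum with a real parameter `p`, so that no measurability or integrability
has to be tracked; `setBernoulli_real_eq_bprob` is the link with `setBernoulli`. -/
noncomputable def bexp (E : Finset ι) (p : ℝ) (f : Finset ι → ℝ) : ℝ :=
  ∑ S ∈ E.powerset, p ^ S.card * (1 - p) ^ (E \ S).card * f S

open Classical in
/-- The probability of `Q S`, where `S` is a `p`-Bernoulli random subset of the finite set `E`. -/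
noncomputable def bprob (E : Finset ι) (p : ℝ) (Q : Finset ι → Prop) : ℝ :=
  bexp E p fun S => if Q S then 1 else 0

/-- The probability of `Q S T`, where `S` and `T` are independent Bernoulli random subsets of `E`
with parameters `p` and `q`. -/
noncomputable def bprob₂ (E : Finset ι) (p q : ℝ) (Q : Finset ι → Finset ι → Prop) : ℝ :=
  bexp E p fun S => bprob E q (Q S)

lemma setBernoulli_real_eq_bprob [Finite ι] (E : Finset ι) (p : unitInterval)
    (𝒜 : Set (Set ι)) :
    (setBernoulli (E : Set ι) p).real 𝒜 = bprob E p fun S => (S : Set ι) ∈ 𝒜 := by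
  classical
  have h_subsets : {s | s ∈ 𝒜 ∧ s ⊆ (E : Set ι)} =
      ⋃ S ∈ E.powerset.filter fun S : Finset ι => (S : Set ι) ∈ 𝒜, {(S : Set ι)} := by
    ext s
    simp only [Set.mem_ofPred_eq, Set.mem_iUnion, Set.mem_singleton_iff, Finset.mem_filter,
      Finset.mem_powerset, exists_prop]
    constructor
    · rintro ⟨hs, hsE⟩
      lift s to Finset ι using E.finite_toSet.subset hsE
      exact ⟨s, ⟨Finset.coe_subset.1 hsE, hs⟩, rfl⟩
    · rintro ⟨S, ⟨hSE, hS⟩, rfl⟩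
      exact ⟨hS, Finset.coe_subset.2 hSE⟩
  rw [Measure.real, setBernoulli_apply_eq_apply_subsets, ← Measure.real, h_subsets,
    measureReal_biUnion_finset
      (fun S _ T _ hST => by simpa only [Function.onFun, Set.disjoint_singleton, ne_eq,
        Finset.coe_inj] using hST) (fun _ _ => (Set.toFinite _).measurableSet),
    Finset.sum_filter, bprob, bexp]
  refine Finset.sum_congr rfl fun S hS => ?_
  have hSE : (S : Set ι) ⊆ E := Finset.coe_subset.2 (Finset.mem_powerset.1 hS)
  rw [setBernoulli_real_singleton p hSE E.finite_toSet, Set.ncard_coe_finset, ← Finset.coe_sdiff,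
    Set.ncard_coe_finset, mul_ite, mul_one, mul_zero]

lemma bexp_congr {f g : Finset ι → ℝ} (h : ∀ S ⊆ E, f S = g S) : bexp E p f = bexp E p g :=
  Finset.sum_congr rfl fun S hS => by rw [h S (Finset.mem_powerset.1 hS)]

lemma bexp_mono (hp0 : 0 ≤ p) (hp1 : p ≤ 1) {f g : Finset ι → ℝ} (h : ∀ S ⊆ E, f S ≤ g S) :
    bexp E p f ≤ bexp E p g := by
  refine Finset.sum_le_sum fun S hS => ?_
  have : 0 ≤ 1 - p := sub_nonneg.2 hp1
  exact mul_le_mul_of_nonneg_left (h S (Finset.mem_powerset.1 hS)) (by positivity)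

@[simp] lemma bexp_empty (p : ℝ) (f : Finset ι → ℝ) : bexp ∅ p f = f ∅ := by simp [bexp]

lemma bexp_insert {e : ι} (he : e ∉ E) (p : ℝ) (f : Finset ι → ℝ) :
    bexp (insert e E) p f = p * bexp E p (fun S => f (insert e S)) + (1 - p) * bexp E p f := by
  unfold bexp
  rw [Finset.sum_powerset_insert he, add_comm, Finset.mul_sum, Finset.mul_sum]
  congr 1
  all_goals
    refine Finset.sum_congr rfl fun S hS => ?_
    have heS : e ∉ S := fun h => he (Finset.mem_powerset.1 hS h)
  · rw [Finset.card_insert_of_notMem heS, Finset.insert_sdiff_insert,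
      Finset.sdiff_insert_of_notMem he]
    ring
  · rw [Finset.insert_sdiff_of_notMem _ heS, Finset.card_insert_of_notMem (by simp [he])]
    ring

lemma bexp_const (E : Finset ι) (p c : ℝ) : bexp E p (fun _ => c) = c := by
  induction E using Finset.induction_on with
  | empty => simp
  | insert e E he ih => rw [bexp_insert he, ih]; ring

lemma bexp_add (E : Finset ι) (p : ℝ) (f g : Finset ι → ℝ) :
    bexp E p (fun S => f S + g S) = bexp E p f + bexp E p g := by
  simp only [bexp, mul_add, Finset.sum_add_distrib]

lemma bexp_sum (E : Finset ι) (p : ℝ) (s : Finset κ) (f : κ → Finset ι → ℝ) :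
    bexp E p (fun S => ∑ k ∈ s, f k S) = ∑ k ∈ s, bexp E p (f k) := by
  simp only [bexp, Finset.mul_sum]
  exact Finset.sum_comm

lemma bexp_const_mul (E : Finset ι) (p c : ℝ) (f : Finset ι → ℝ) :
    bexp E p (fun S => c * f S) = c * bexp E p f := by
  simp only [bexp, Finset.mul_sum]
  exact Finset.sum_congr rfl fun S _ => by ring

lemma bexp_mul_const (E : Finset ι) (p c : ℝ) (f : Finset ι → ℝ) :
    bexp E p (fun S => f S * c) = bexp E p f * c := by
  simp only [mul_comm _ c, bexp_const_mul]

lemma bexp_nonneg (hp0 : 0 ≤ p) (hp1 : p ≤ 1) {f : Finset ι → ℝ} (h : ∀ S ⊆ E, 0 ≤ f S) :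
    0 ≤ bexp E p f := by
  simpa only [bexp_const] using bexp_mono hp0 hp1 (f := fun _ => 0) h

lemma bexp_bexp_union (E : Finset ι) (p q : ℝ) (f : Finset ι → ℝ) :
    bexp E p (fun S => bexp E q fun T => f (S ∪ T)) = bexp E (p + q - p * q) f := by
  induction E using Finset.induction_on generalizing f with
  | empty => simp
  | insert e E he ih =>
    have h_mem (S : Finset ι) : bexp (insert e E) q (fun T => f (insert e S ∪ T)) =
        bexp E q fun T => f (insert e (S ∪ T)) := by
      rw [bexp_insert he]
      simp only [Finset.insert_union, Finset.union_insert, Finset.insert_idem]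
      ring
    have h_notMem (S : Finset ι) : bexp (insert e E) q (fun T => f (S ∪ T)) =
        q * bexp E q (fun T => f (insert e (S ∪ T))) + (1 - q) * bexp E q fun T => f (S ∪ T) := by
      rw [bexp_insert he]
      simp only [Finset.union_insert]
    rw [bexp_insert he]
    simp only [h_mem, h_notMem, bexp_add, bexp_const_mul]
    rw [ih (fun T => f (insert e T)), ih f, bexp_insert he]
    ring

lemma bexp_mono_param (hp0 : 0 ≤ p) (hpq : p ≤ q) (hq1 : q ≤ 1) {f : Finset ι → ℝ}
    (hf : ∀ S T, S ⊆ T → T ⊆ E → f S ≤ f T) : bexp E p f ≤ bexp E q f := by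
  rcases eq_or_lt_of_le (hpq.trans hq1) with rfl | hp1
  · rw [le_antisymm hpq hq1]
  have h1 : 0 < 1 - p := sub_pos.2 hp1
  set r := (q - p) / (1 - p)
  have hr0 : 0 ≤ r := div_nonneg (sub_nonneg.2 hpq) h1.le
  have hr1 : r ≤ 1 := (div_le_one h1).2 (by linarith)
  have hq : p + r - p * r = q := by simp only [r]; field_simp; ring
  rw [← hq, ← bexp_bexp_union]
  refine bexp_mono hp0 hp1.le fun S hS => ?_
  calc f S = bexp E r fun _ => f S := (bexp_const _ _ _).symm
    _ ≤ bexp E r fun T => f (S ∪ T) := bexp_mono hr0 hr1 fun T hT =>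
        hf _ _ Finset.subset_union_left (Finset.union_subset hS hT)

lemma bexp_union_mul (hAB : Disjoint A B) (p : ℝ) (f g : Finset ι → ℝ) :
    bexp (A ∪ B) p (fun S => f (S ∩ A) * g (S ∩ B)) = bexp A p f * bexp B p g := by
  induction A using Finset.induction_on generalizing f with
  | empty =>
    simp only [Finset.empty_union, Finset.inter_empty, bexp_empty]
    rw [← bexp_const_mul]
    exact bexp_congr fun S hS => by rw [Finset.inter_eq_left.2 hS]
  | insert e A he ih =>
    rw [Finset.disjoint_insert_left] at hAB
    have heAB : e ∉ A ∪ B := by simp [he, hAB.1]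
    rw [Finset.insert_union, bexp_insert heAB, bexp_insert he, add_mul, mul_assoc, mul_assoc,
      ← ih hAB.2, ← ih hAB.2]
    congr 2
    · refine bexp_congr fun S _ => ?_
      rw [← Finset.insert_inter_distrib, Finset.insert_inter_of_notMem hAB.1]
    · refine bexp_congr fun S hS => ?_
      rw [Finset.inter_insert_of_notMem fun h => heAB (hS h)]

lemma bexp_inter (hA : A ⊆ E) (p : ℝ) (f : Finset ι → ℝ) :
    bexp E p (fun S => f (S ∩ A)) = bexp A p f := by
  have h := bexp_union_mul (Finset.disjoint_sdiff (s := A) (t := E)) p f (fun _ => 1)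
  rwa [Finset.union_sdiff_of_subset hA, bexp_const, mul_one, funext fun S => mul_one _] at h

lemma bexp_inter_mul_inter (hA : A ⊆ E) (hB : B ⊆ E) (hAB : Disjoint A B) (p : ℝ)
    (f g : Finset ι → ℝ) :
    bexp E p (fun S => f (S ∩ A) * g (S ∩ B)) = bexp A p f * bexp B p g := by
  rw [← bexp_union_mul hAB, ← bexp_inter (Finset.union_subset hA hB)]
  refine bexp_congr fun S _ => ?_
  rw [Finset.inter_assoc, Finset.inter_assoc, Finset.inter_eq_right.2 Finset.subset_union_left,
    Finset.inter_eq_right.2 Finset.subset_union_right]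

lemma bexp_prod_inter (K : Finset κ) (A : κ → Finset ι)
    (hA : ∀ k ∈ K, A k ⊆ E) (hdis : (K : Set κ).PairwiseDisjoint A) (p : ℝ)
    (f : κ → Finset ι → ℝ) :
    bexp E p (fun S => ∏ k ∈ K, f k (S ∩ A k)) = ∏ k ∈ K, bexp (A k) p (f k) := by
  classical
  induction K using Finset.induction_on generalizing E with
  | empty => simp [bexp_const]
  | insert k K hk ih =>
    have hsub : ∀ j ∈ K, A j ⊆ E \ A k := fun j hj => Finset.subset_sdiff.2
      ⟨hA j (Finset.mem_insert_of_mem hj),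
        hdis (by simp [hj]) (by simp) (by rintro rfl; exact hk hj)⟩
    rw [Finset.prod_insert hk, ← ih hsub (hdis.subset (by simp)),
      ← bexp_inter_mul_inter (hA k (Finset.mem_insert_self k K)) Finset.sdiff_subset
        Finset.disjoint_sdiff]
    refine bexp_congr fun S _ => ?_
    rw [Finset.prod_insert hk]
    congr 1
    refine Finset.prod_congr rfl fun j hj => ?_
    rw [Finset.inter_assoc, Finset.inter_eq_right.2 (hsub j hj)]

lemma bexp_pow_card_mul_pow_card_sdiff (A : Finset ι) (p x y : ℝ) :
    bexp A p (fun S => x ^ S.card * y ^ (A \ S).card) = (p * x + (1 - p) * y) ^ A.card := by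
  rw [← Finset.prod_const, Finset.prod_add, bexp]
  refine Finset.sum_congr rfl fun S _ => ?_
  rw [Finset.prod_const, Finset.prod_const, mul_pow, mul_pow]
  ring

lemma bexp_pow_card_inter (hA : A ⊆ E) (p x : ℝ) :
    bexp E p (fun S => x ^ (S ∩ A).card) = (1 - p + p * x) ^ A.card := by
  rw [bexp_inter hA p fun S => x ^ S.card]
  simpa only [one_pow, mul_one, add_comm] using bexp_pow_card_mul_pow_card_sdiff A p x 1

lemma bexp_pow_card_sdiff (A : Finset ι) (p x : ℝ) :
    bexp A p (fun S => x ^ (A \ S).card) = (p + (1 - p) * x) ^ A.card := by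
  simpa only [one_pow, one_mul, mul_one] using bexp_pow_card_mul_pow_card_sdiff A p 1 x

lemma bprob_mono (hp0 : 0 ≤ p) (hp1 : p ≤ 1) {Q Q' : Finset ι → Prop}
    (h : ∀ S ⊆ E, Q S → Q' S) : bprob E p Q ≤ bprob E p Q' := by
  refine bexp_mono hp0 hp1 fun S hS => ?_
  by_cases hQ : Q S
  · simp [hQ, h S hS hQ]
  · simp only [hQ, if_false]; split_ifs <;> norm_num

lemma bprob_congr {Q Q' : Finset ι → Prop} (h : ∀ S ⊆ E, (Q S ↔ Q' S)) :
    bprob E p Q = bprob E p Q' :=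
  bexp_congr fun S hS => by classical exact if_congr (h S hS) rfl rfl

lemma bprob_nonneg (hp0 : 0 ≤ p) (hp1 : p ≤ 1) (Q : Finset ι → Prop) : 0 ≤ bprob E p Q :=
  bexp_nonneg hp0 hp1 fun S _ => by split_ifs <;> norm_num

lemma bprob_le_one (hp0 : 0 ≤ p) (hp1 : p ≤ 1) (Q : Finset ι → Prop) : bprob E p Q ≤ 1 := by
  rw [← bexp_const E p 1]
  exact bexp_mono hp0 hp1 fun S _ => by split_ifs <;> norm_num

lemma bprob_eq_zero {Q : Finset ι → Prop} (h : ∀ S ⊆ E, ¬ Q S) : bprob E p Q = 0 :=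
  (bexp_congr fun S hS => by simp [h S hS]).trans (bexp_const E p 0)

lemma bprob_not (E : Finset ι) (p : ℝ) (Q : Finset ι → Prop) :
    bprob E p (fun S => ¬ Q S) = 1 - bprob E p Q := by
  rw [eq_sub_iff_add_eq, bprob, bprob, ← bexp_add]
  refine Eq.trans (bexp_congr fun S _ => ?_) (bexp_const E p 1)
  by_cases h : Q S <;> simp [h]

lemma bprob_le_bexp (hp0 : 0 ≤ p) (hp1 : p ≤ 1) {Q : Finset ι → Prop}
    {f : Finset ι → ℝ} (h0 : ∀ S ⊆ E, 0 ≤ f S) (h1 : ∀ S ⊆ E, Q S → 1 ≤ f S) :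
    bprob E p Q ≤ bexp E p f := by
  refine bexp_mono hp0 hp1 fun S hS => ?_
  split_ifs with h
  · exact h1 S hS h
  · exact h0 S hS

lemma bprob_lt_le (hp0 : 0 ≤ p) (hp1 : p ≤ 1) {f : Finset ι → ℝ} (hf : ∀ S ⊆ E, 0 ≤ f S) {c : ℝ}
    (hc : 0 < c) : bprob E p (fun S => c < f S) ≤ c⁻¹ * bexp E p f := by
  rw [← bexp_const_mul]
  exact bprob_le_bexp hp0 hp1 (fun S hS => mul_nonneg (inv_nonneg.2 hc.le) (hf S hS))
    fun S _ h => (le_inv_mul_iff₀ hc).2 (by linarith)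

lemma bprob_or_le (hp0 : 0 ≤ p) (hp1 : p ≤ 1) (Q Q' : Finset ι → Prop) :
    bprob E p (fun S => Q S ∨ Q' S) ≤ bprob E p Q + bprob E p Q' := by
  rw [bprob, bprob, bprob, ← bexp_add]
  refine bexp_mono hp0 hp1 fun S _ => ?_
  by_cases h : Q S <;> by_cases h' : Q' S <;> simp [h, h']

lemma bprob_exists_le (hp0 : 0 ≤ p) (hp1 : p ≤ 1) (s : Finset κ) (Q : κ → Finset ι → Prop) :
    bprob E p (fun S => ∃ k ∈ s, Q k S) ≤ ∑ k ∈ s, bprob E p (Q k) := by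
  classical
  simp only [bprob]
  rw [← bexp_sum]
  have h_nonneg (S : Finset ι) (k : κ) : (0 : ℝ) ≤ if Q k S then 1 else 0 := by
    split_ifs <;> norm_num
  refine bexp_mono hp0 hp1 fun S _ => ?_
  split_ifs with h
  · obtain ⟨k, hk, hQ⟩ := h
    calc (1 : ℝ) = if Q k S then 1 else 0 := (if_pos hQ).symm
      _ ≤ _ := Finset.single_le_sum (f := fun k => if Q k S then (1 : ℝ) else 0)
        (fun k _ => h_nonneg S k) hk
  · exact Finset.sum_nonneg fun k _ => h_nonneg S k

lemma bprob_inter (hA : A ⊆ E) (p : ℝ) (Q : Finset ι → Prop) :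
    bprob E p (fun S => Q (S ∩ A)) = bprob A p Q := by
  classical
  exact bexp_inter hA p fun S => if Q S then 1 else 0

lemma bprob_inter_and_inter (hA : A ⊆ E) (hB : B ⊆ E) (hAB : Disjoint A B) (p : ℝ)
    (Q Q' : Finset ι → Prop) :
    bprob E p (fun S => Q (S ∩ A) ∧ Q' (S ∩ B)) = bprob A p Q * bprob B p Q' := by
  classical
  unfold bprob
  rw [← bexp_inter_mul_inter hA hB hAB]
  refine bexp_congr fun S _ => ?_
  by_cases h : Q (S ∩ A) <;> by_cases h' : Q' (S ∩ B) <;> simp [h, h']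

lemma bprob_forall_inter (K : Finset κ) (A : κ → Finset ι) (hA : ∀ k ∈ K, A k ⊆ E)
    (hdis : (K : Set κ).PairwiseDisjoint A) (p : ℝ) (Q : Finset ι → Prop) :
    bprob E p (fun S => ∀ k ∈ K, Q (S ∩ A k)) = ∏ k ∈ K, bprob (A k) p Q := by
  classical
  unfold bprob
  rw [← bexp_prod_inter K A hA hdis p]
  refine bexp_congr fun S _ => ?_
  rw [Finset.prod_ite_zero]
  simp

lemma bprob_subset (hA : A ⊆ E) (p : ℝ) : bprob E p (fun S => A ⊆ S) = p ^ A.card := by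
  have h := bexp_pow_card_sdiff A p 0
  rw [mul_zero, add_zero, ← bexp_inter hA] at h
  rw [← h, bprob]
  refine bexp_congr fun S _ => ?_
  simp only [zero_pow_eq, Finset.card_eq_zero, Finset.sdiff_eq_empty_iff_subset,
    Finset.subset_inter_iff, subset_refl, and_true]
  congr

lemma bprob_subset_le (hp0 : 0 ≤ p) (E A : Finset ι) :
    bprob E p (fun S => A ⊆ S) ≤ p ^ A.card := by
  by_cases hA : A ⊆ E
  · exact (bprob_subset hA p).le
  · rw [bprob_eq_zero fun S hS h => hA (h.trans hS)]
    positivity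

lemma bexp_card_filter (E : Finset ι) (p : ℝ) (Q : ι → Prop) [DecidablePred Q] :
    bexp E p (fun S => ((S.filter Q).card : ℝ)) = (E.filter Q).card * p := by
  induction E using Finset.induction_on with
  | empty => simp
  | insert e E he ih =>
    have h_insert : bexp E p (fun S => (((insert e S).filter Q).card : ℝ)) =
        bexp E p (fun S => ((S.filter Q).card : ℝ)) + if Q e then 1 else 0 := by
      rw [← bexp_const E p (if Q e then 1 else 0), ← bexp_add]
      refine bexp_congr fun S hS => ?_
      rw [Finset.filter_insert]
      split_ifs
      · rw [Finset.card_insert_of_notMem fun h => he (hS (Finset.mem_of_mem_filter e h))]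
        push_cast
        ring
      · rw [add_zero]
    rw [bexp_insert he, h_insert, ih, Finset.filter_insert]
    split_ifs
    · rw [Finset.card_insert_of_notMem fun h => he (Finset.mem_of_mem_filter e h)]
      push_cast
      ring
    · ring

lemma bprob_disjoint (hA : A ⊆ E) (p : ℝ) :
    bprob E p (fun S => Disjoint A S) = (1 - p) ^ A.card := by
  have h := bexp_pow_card_inter hA p 0
  rw [mul_zero, add_zero] at h
  rw [← h, bprob]
  refine bexp_congr fun S _ => ?_
  simp only [zero_pow_eq, Finset.card_eq_zero, ← Finset.disjoint_iff_inter_eq_empty, disjoint_comm]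
  congr

lemma bprob_subset_and_disjoint (hA : A ⊆ E) (hB : B ⊆ E) (hAB : Disjoint A B) (p : ℝ) :
    bprob E p (fun S => A ⊆ S ∧ Disjoint B S) = p ^ A.card * (1 - p) ^ B.card := by
  rw [← bprob_subset subset_rfl, ← bprob_disjoint subset_rfl, ← bprob_inter_and_inter hA hB hAB]
  refine bprob_congr fun S _ => and_congr ?_ ?_
  · simp only [Finset.subset_inter_iff, subset_refl, and_true]
  · simp only [Finset.disjoint_iff_inter_eq_empty, Finset.inter_left_comm B, Finset.inter_self,
      Finset.inter_comm B]

lemma bprob_card_inter_le (hA : A ⊆ E) (hp0 : 0 ≤ p) (hp1 : p ≤ 1) {x : ℝ} (hx0 : 0 < x)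
    (hx1 : x ≤ 1) (k : ℕ) :
    bprob E p (fun S => (S ∩ A).card ≤ k) ≤ x⁻¹ ^ k * (1 - p + p * x) ^ A.card := by
  rw [← bexp_pow_card_inter hA, ← bexp_const_mul]
  exact bprob_le_bexp hp0 hp1 (fun S _ => by positivity) fun S _ hS =>
    one_le_inv_pow_mul_pow hx0 hx1 hS

lemma bprob_le_card_inter (hA : A ⊆ E) (hp0 : 0 ≤ p) (hp1 : p ≤ 1) {x : ℝ} (hx : 1 ≤ x) (k : ℕ) :
    bprob E p (fun S => k ≤ (S ∩ A).card) ≤ x⁻¹ ^ k * (1 - p + p * x) ^ A.card := by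
  have hx0 : 0 < x := zero_lt_one.trans_le hx
  rw [← bexp_pow_card_inter hA, ← bexp_const_mul]
  refine bprob_le_bexp hp0 hp1 (fun S _ => by positivity) fun S _ hS => ?_
  calc (1 : ℝ) = x⁻¹ ^ k * x ^ k := by rw [← mul_pow, inv_mul_cancel₀ hx0.ne', one_pow]
    _ ≤ _ := mul_le_mul_of_nonneg_left (pow_le_pow_right₀ hx hS) (by positivity)

lemma bprob_insert_card_le_one {e : ι} (he : e ∉ E) (p : ℝ) :
    bprob E p (fun S => (insert e S).card ≤ 1) = (1 - p) ^ E.card := by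
  rw [← bprob_disjoint subset_rfl p]
  refine bprob_congr fun S hS => ?_
  rw [Finset.card_insert_of_notMem fun h => he (hS h), add_le_iff_nonpos_left,
    Nat.le_zero, Finset.card_eq_zero, Finset.disjoint_iff_inter_eq_empty,
    Finset.inter_eq_right.2 hS]

lemma bprob_card_le_one (A : Finset ι) (p : ℝ) :
    bprob A p (fun S => S.card ≤ 1) = (1 - p) ^ A.card + A.card * p * (1 - p) ^ (A.card - 1) := by
  induction A using Finset.induction_on with
  | empty => simp [bprob]
  | insert e A he ih =>
    have h_insert : bprob (insert e A) p (fun S => S.card ≤ 1) =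
        p * bprob A p (fun S => (insert e S).card ≤ 1) + (1 - p) * bprob A p fun S => S.card ≤ 1 :=
      bexp_insert he _ _
    rw [h_insert, bprob_insert_card_le_one he, ih, Finset.card_insert_of_notMem he]
    rcases Nat.eq_zero_or_pos A.card with h | h
    · simp [h]
    · rw [Nat.add_sub_cancel, ← Nat.sub_add_cancel h, Nat.add_sub_cancel]
      push_cast
      ring

lemma bprob_card_le_one_le {a b : ℕ} (hp0 : 0 ≤ p) (hp1 : p ≤ 1) (ha : a ≤ A.card)
    (hb : A.card ≤ b) : bprob A p (fun S => S.card ≤ 1) ≤ (1 - p) ^ (a - 1) * (1 + b * p) := by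
  have h0 : 0 ≤ 1 - p := by linarith
  have h1 : 1 - p ≤ 1 := by linarith
  calc bprob A p (fun S => S.card ≤ 1)
      = (1 - p) ^ A.card + A.card * p * (1 - p) ^ (A.card - 1) := bprob_card_le_one A p
    _ ≤ (1 - p) ^ (a - 1) + b * p * (1 - p) ^ (a - 1) :=
        add_le_add (pow_le_pow_of_le_one h0 h1 (by omega))
          (mul_le_mul (by gcongr) (pow_le_pow_of_le_one h0 h1 (by omega)) (by positivity)
            (by positivity))
    _ = _ := by ring

lemma le_bprob_card_le_one {a b : ℕ} (hp0 : 0 ≤ p) (hp1 : p ≤ 1) (ha : a ≤ A.card)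
    (hb : A.card ≤ b) : (1 - p) ^ b * (1 + a * p) ≤ bprob A p (fun S => S.card ≤ 1) := by
  have h0 : 0 ≤ 1 - p := by linarith
  have h1 : 1 - p ≤ 1 := by linarith
  calc (1 - p) ^ b * (1 + a * p) = (1 - p) ^ b + a * p * (1 - p) ^ b := by ring
    _ ≤ (1 - p) ^ A.card + A.card * p * (1 - p) ^ (A.card - 1) :=
        add_le_add (pow_le_pow_of_le_one h0 h1 hb)
          (mul_le_mul (by gcongr) (pow_le_pow_of_le_one h0 h1 (by omega)) (by positivity)
            (by positivity))
    _ = _ := (bprob_card_le_one A p).symm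

lemma bprob₂_union (E : Finset ι) (p q : ℝ) (Q : Finset ι → Prop) :
    bprob₂ E p q (fun S T => Q (S ∪ T)) = bprob E (p + q - p * q) Q :=
  bexp_bexp_union E p q fun S => @ite ℝ (Q S) (Classical.propDecidable _) 1 0

lemma bprob₂_fst (E : Finset ι) (p q : ℝ) (Q : Finset ι → Prop) :
    bprob₂ E p q (fun S _ => Q S) = bprob E p Q :=
  bexp_congr fun _ _ => bexp_const E q _

lemma bprob₂_mono (hp0 : 0 ≤ p) (hp1 : p ≤ 1) (hq0 : 0 ≤ q) (hq1 : q ≤ 1)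
    {Q Q' : Finset ι → Finset ι → Prop} (h : ∀ S ⊆ E, ∀ T ⊆ E, Q S T → Q' S T) :
    bprob₂ E p q Q ≤ bprob₂ E p q Q' :=
  bexp_mono hp0 hp1 fun S hS => bprob_mono hq0 hq1 (h S hS)

lemma bprob₂_eq_zero {Q : Finset ι → Finset ι → Prop} (h : ∀ S ⊆ E, ∀ T ⊆ E, ¬ Q S T) :
    bprob₂ E p q Q = 0 :=
  (bexp_congr fun S hS => bprob_eq_zero (h S hS)).trans (bexp_const E p 0)

lemma bprob₂_or_le (hp0 : 0 ≤ p) (hp1 : p ≤ 1) (hq0 : 0 ≤ q) (hq1 : q ≤ 1)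
    (Q Q' : Finset ι → Finset ι → Prop) :
    bprob₂ E p q (fun S T => Q S T ∨ Q' S T) ≤ bprob₂ E p q Q + bprob₂ E p q Q' := by
  rw [bprob₂, bprob₂, bprob₂, ← bexp_add]
  exact bexp_mono hp0 hp1 fun S _ => bprob_or_le hq0 hq1 _ _

lemma bprob₂_exists_le (hp0 : 0 ≤ p) (hp1 : p ≤ 1) (hq0 : 0 ≤ q) (hq1 : q ≤ 1) (s : Finset κ)
    (Q : κ → Finset ι → Finset ι → Prop) :
    bprob₂ E p q (fun S T => ∃ k ∈ s, Q k S T) ≤ ∑ k ∈ s, bprob₂ E p q (Q k) := by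
  simp only [bprob₂]
  rw [← bexp_sum]
  exact bexp_mono hp0 hp1 fun S _ => bprob_exists_le hq0 hq1 s fun k => Q k S

lemma bprob_subset_union (hA : A ⊆ E) (S : Finset ι) (q : ℝ) :
    bprob E q (fun T => A ⊆ S ∪ T) = q ^ (A \ S).card := by
  rw [← bprob_subset (Finset.sdiff_subset.trans hA)]
  exact bprob_congr fun T _ => sdiff_le_iff.symm

lemma bprob₂_subset_union_and_inter (hA : A ⊆ E) (hB : B ⊆ E) (hAB : Disjoint A B) (p q : ℝ)
    (Q : Finset ι → Prop) :
    bprob₂ E p q (fun S T => A ⊆ S ∪ T ∧ Q (S ∩ B)) =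
      (p + q - p * q) ^ A.card * bprob E p fun S => Q (S ∩ B) := by
  classical
  rw [show p + q - p * q = p + (1 - p) * q by ring, ← bexp_pow_card_sdiff,
    bprob_inter hB, bprob, ← bexp_inter_mul_inter hA hB hAB]
  refine bexp_congr fun S _ => ?_
  rw [Finset.sdiff_inter_self_right, ← bprob_subset_union hA]
  by_cases hQ : Q (S ∩ B)
  · simp only [hQ, and_true, if_true, mul_one]
  · simp only [hQ, and_false, if_false, mul_zero]
    exact bprob_eq_zero fun _ _ => not_false

lemma bprob₂_subset_union_and_disjoint (hA : A ⊆ E) (hB : B ⊆ E) (hAB : Disjoint A B) (p q : ℝ) :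
    bprob₂ E p q (fun S T => A ⊆ S ∪ T ∧ Disjoint B S) =
      (p + q - p * q) ^ A.card * (1 - p) ^ B.card := by
  rw [← bprob_disjoint hB]
  simpa only [Finset.disjoint_iff_inter_eq_empty, Finset.inter_comm B] using
    bprob₂_subset_union_and_inter hA hB hAB p q (· = ∅)

lemma bprob₂_subset_union_and_card_inter_le (hA : A ⊆ E) (hB : B ⊆ E) (hAB : Disjoint A B)
    (hp0 : 0 ≤ p) (hp1 : p ≤ 1) (hq0 : 0 ≤ q) {x : ℝ} (hx0 : 0 < x) (hx1 : x ≤ 1) (k : ℕ) :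
    bprob₂ E p q (fun S T => A ⊆ S ∪ T ∧ (S ∩ B).card ≤ k) ≤
      (p + q - p * q) ^ A.card * (x⁻¹ ^ k * (1 - p + p * x) ^ B.card) := by
  have hr : 0 ≤ p + q - p * q := by nlinarith
  rw [bprob₂_subset_union_and_inter hA hB hAB p q (·.card ≤ k)]
  exact mul_le_mul_of_nonneg_left (bprob_card_inter_le hB hp0 hp1 hx0 hx1 k) (by positivity)

lemma bprob_subset_union_and_disjoint_le (hA : A ⊆ E) (hB : B ⊆ E) (hq0 : 0 ≤ q) (hq1 : q ≤ 1)
    (S : Finset ι) :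
    bprob E q (fun T => A ⊆ S ∪ T ∧ Disjoint B T) ≤
      q ^ (A \ S).card * (1 - q) ^ (B \ A).card := by
  have hAB : Disjoint (A \ S) (B \ A) :=
    Finset.disjoint_of_subset_left Finset.sdiff_subset Finset.disjoint_sdiff
  rw [← bprob_subset_and_disjoint (Finset.sdiff_subset.trans hA) (Finset.sdiff_subset.trans hB) hAB]
  exact bprob_mono hq0 hq1 fun T _ h =>
    ⟨sdiff_le_iff.2 h.1, Finset.disjoint_of_subset_left Finset.sdiff_subset h.2⟩

/-- The set `W S` to be avoided by `T` may depend on `S`: it is exposed in the first round. -/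
lemma bprob₂_subset_union_and_disjoint_le (hA : A ⊆ E) (hp0 : 0 ≤ p) (hp1 : p ≤ 1)
    (hq0 : 0 ≤ q) (hq1 : q ≤ 1) (W : Finset ι → Finset ι) (hW : ∀ S ⊆ E, W S ⊆ E)
    (Q : Finset ι → Prop) {k : ℕ} (hk : ∀ S ⊆ E, Q S → k ≤ (W S \ A).card) :
    bprob₂ E p q (fun S T => A ⊆ S ∪ T ∧ Q S ∧ Disjoint (W S) T) ≤
      (p + q - p * q) ^ A.card * (1 - q) ^ k := by
  have h0 : 0 ≤ 1 - q := by linarith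
  have h_subset : bexp E p (fun S => q ^ (A \ S).card) = (p + q - p * q) ^ A.card := by
    rw [show p + q - p * q = p + (1 - p) * q by ring, ← bexp_pow_card_sdiff, ← bexp_inter hA]
    simp only [Finset.sdiff_inter_self_right]
  rw [← h_subset, ← bexp_mul_const]
  refine bexp_mono hp0 hp1 fun S hS => ?_
  by_cases hQ : Q S
  · simp only [hQ, true_and]
    exact (bprob_subset_union_and_disjoint_le hA (hW S hS) hq0 hq1 S).trans
      (mul_le_mul_of_nonneg_left (pow_le_pow_of_le_one h0 (by linarith) (hk S hS hQ))
        (by positivity))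
  · refine (bprob_eq_zero fun T _ h => hQ h.2.1).trans_le ?_
    positivity

end Bernoulli

/-- The graph with edge set `F`. Diagonal elements of `F` are ignored, so `edgeGraph_adj` needs
`F` to be loopless. -/
abbrev edgeGraph {V : Type*} (F : Finset (Sym2 V)) : SimpleGraph V :=
  SimpleGraph.fromEdgeSet (F : Set (Sym2 V))

lemma edgeGraph_adj {V : Type*} {F : Finset (Sym2 V)} (hF : ∀ e ∈ F, ¬ e.IsDiag) {u v : V} :
    (edgeGraph F).Adj u v ↔ s(u, v) ∈ F := by
  rw [SimpleGraph.fromEdgeSet_adj, Finset.mem_coe, and_iff_left_iff_imp]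
  rintro h rfl
  exact hF _ h (by simp)

lemma edgeGraph_mono {V : Type*} {F F' : Finset (Sym2 V)} (h : F ⊆ F') :
    edgeGraph F ≤ edgeGraph F' :=
  SimpleGraph.fromEdgeSet_mono (Finset.coe_subset.2 h)

lemma probHamiltonian_eq_bprob {V : Type*} [Fintype V] [DecidableEq V] (Γ : SimpleGraph V)
    [DecidableRel Γ.Adj] (p : unitInterval) :
    probHamiltonian Γ p = bprob Γ.edgeFinset p
      fun S => (edgeGraph S).IsHamiltonian := by
  have h_meas : Measurable (SimpleGraph.fromEdgeSet : Set (Sym2 V) → SimpleGraph V) := by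
    fun_prop
  have h_measSet : MeasurableSet {G : SimpleGraph V | G.IsHamiltonian} := by
    rw [← Set.preimage_image_eq {G : SimpleGraph V | G.IsHamiltonian}
      SimpleGraph.edgeSet_injective]
    exact SimpleGraph.measurable_edgeSet (Set.toFinite _).measurableSet
  rw [probHamiltonian, randomSubgraph, Measure.real, Measure.map_apply h_meas h_measSet,
    ← Measure.real, ← SimpleGraph.coe_edgeFinset, setBernoulli_real_eq_bprob]
  rfl

section Rotation

variable {V : Type*} {G H : SimpleGraph V} {l l₀ A B : List V} {a b u v w x y : V}

lemma getLast?_cons_concat (a b : V) (l : List V) : (a :: (l ++ [b])).getLast? = some b := by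
  rw [← List.cons_append, List.getLast?_concat]

lemma formPerm_of_infix [DecidableEq V] (hl : l.Nodup) (h : [a, b] <:+: l) :
    l.formPerm a = b := by
  obtain ⟨s, t, rfl⟩ := h
  simpa using List.formPerm_apply_lt_getElem (s ++ [a, b] ++ t) hl s.length (by simp)

lemma not_infix_of_head? (hl : l.Nodup) (hb : l.head? = some b) : ¬ [a, b] <:+: l := by
  rintro ⟨s, t, rfl⟩
  cases s <;> simp_all

lemma not_infix_of_getLast? (hl : l.Nodup) (ha : l.getLast? = some a) : ¬ [a, b] <:+: l := by
  intro h
  refine not_infix_of_head? (List.nodup_reverse.2 hl) (a := b) (b := a) (by simpa using ha) ?_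
  simpa using List.reverse_infix.2 h

lemma idxOf_of_infix [DecidableEq V] (hl : l.Nodup) (h : [a, b] <:+: l) :
    l.idxOf b = l.idxOf a + 1 := by
  obtain ⟨s, t, rfl⟩ := h
  have ha : a ∉ s := by grind
  have hb : b ∉ s := by grind
  have hab : a ≠ b := by grind
  simp [List.idxOf_append, ha, hb, hab, add_comm]

lemma not_infix_swap (hl : l.Nodup) (h : [a, b] <:+: l) : ¬ [b, a] <:+: l := by
  classical
  intro h'
  have := idxOf_of_infix hl h
  have := idxOf_of_infix hl h'
  omega

lemma exists_infix_of_getLast?_ne (hu : u ∈ l) (h : l.getLast? ≠ some u) :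
    ∃ b, [u, b] <:+: l := by
  obtain ⟨A, B, rfl⟩ := List.append_of_mem hu
  rcases B with _ | ⟨b, B⟩
  · simp at h
  · exact ⟨b, A, B, by simp⟩

lemma exists_infix_of_head?_ne (hu : u ∈ l) (h : l.head? ≠ some u) : ∃ a, [a, u] <:+: l := by
  obtain ⟨a, ha⟩ := exists_infix_of_getLast?_ne (List.mem_reverse.2 hu) (by simpa using h)
  exact ⟨a, by simpa using List.reverse_infix.2 ha⟩

lemma infix_or_infix_append_cons_reverse (h : [a, b] <:+: A ++ u :: B)
    (hb : (A ++ u :: B.reverse).getLast? ≠ some b) :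
    [a, b] <:+: A ++ u :: B.reverse ∨ [b, a] <:+: A ++ u :: B.reverse := by
  obtain ⟨s, t, hst⟩ := h
  have hsplit : (s ++ [a, b]) ++ t = (A ++ [u]) ++ B := by simpa using hst
  rcases List.append_eq_append_iff.1 hsplit with ⟨r, hr, -⟩ | ⟨r, hr, rfl⟩
  · exact Or.inl ⟨s, r ++ B.reverse, by rw [← List.append_assoc, ← hr]; simp⟩
  rcases r.eq_nil_or_concat with rfl | ⟨r, b', rfl⟩
  · exact Or.inl ⟨s, t.reverse, by rw [hr]; simp⟩
  have hrb : (s ++ [a]) ++ [b] = ((A ++ [u]) ++ r) ++ [b'] := by simpa using hr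
  obtain ⟨hsa, hb'⟩ := List.append_inj' hrb rfl
  obtain rfl := List.singleton_injective hb'
  rcases r.eq_nil_or_concat with rfl | ⟨r, a', rfl⟩
  · simp [getLast?_cons_concat] at hb
  have hra : s ++ [a] = ((A ++ [u]) ++ r) ++ [a'] := by simpa using hsa
  obtain rfl := List.singleton_injective (List.append_inj' hra rfl).2
  exact Or.inr ⟨A ++ u :: t.reverse, r.reverse, by simp⟩

lemma isChain_adj_reverse (h : l.IsChain G.Adj) : l.reverse.IsChain G.Adj :=
  List.isChain_reverse.2 (h.imp fun _ _ hab => hab.symm)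

/-- A path of `G`, given as the list of its vertices. -/
structure IsPathList (G : SimpleGraph V) (l : List V) : Prop where
  chain : l.IsChain G.Adj
  nodup : l.Nodup

namespace IsPathList

lemma mono (h : G ≤ H) (hl : IsPathList G l) : IsPathList H l :=
  ⟨hl.chain.imp fun _ _ hab => h hab, hl.nodup⟩

lemma reverse (hl : IsPathList G l) : IsPathList G l.reverse :=
  ⟨isChain_adj_reverse hl.chain, List.nodup_reverse.2 hl.nodup⟩

lemma append (hA : IsPathList G A) (hB : IsPathList G B)
    (hAB : ∀ a ∈ A.getLast?, ∀ b ∈ B.head?, G.Adj a b) (hd : A.Disjoint B) :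
    IsPathList G (A ++ B) :=
  ⟨hA.chain.append hB.chain hAB, hA.nodup.append hB.nodup hd⟩

lemma concat (hl : IsPathList G l) (hv : l.getLast? = some v) (huv : G.Adj v u) (hu : u ∉ l) :
    IsPathList G (l ++ [u]) :=
  hl.append ⟨by simp, by simp⟩ (by simpa [hv]) (by simpa using hu)

lemma rotate (hl : IsPathList G (A ++ u :: B)) (hv : B.getLast? = some v) (huv : G.Adj u v) :
    IsPathList G (A ++ u :: B.reverse) := by
  obtain ⟨hA, hB⟩ := List.isChain_split.1 hl.chain
  refine ⟨List.isChain_split.2 ⟨hA, ?_⟩, ?_⟩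
  · refine List.isChain_cons.2 ⟨fun w hw => ?_, isChain_adj_reverse hB.tail⟩
    simp_all
  · exact ((((List.reverse_perm B).cons u).append_left A).nodup_iff).2 hl.nodup

lemma open_cycle (hl : IsPathList G (A ++ a :: B))
    (hx : (A ++ a :: B).head? = some x) (hy : (A ++ a :: B).getLast? = some y)
    (hyx : G.Adj y x) : IsPathList G (B ++ (A ++ [a])) := by
  obtain ⟨hA, hB⟩ := List.isChain_split.1 hl.chain
  refine ⟨hB.tail.append hA fun b hb c hc => ?_, ?_⟩
  · obtain rfl : y = b := by
      have hne : B ≠ [] := by rintro rfl; simp at hb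
      obtain ⟨b', B', rfl⟩ := List.exists_cons_of_ne_nil hne
      simp_all
    obtain rfl : x = c := by cases A <;> simp_all
    exact hyx
  · exact (List.Perm.nodup_iff (List.perm_append_comm.trans (by simp))).2 hl.nodup

end IsPathList

/-- A path of `G` of maximal length. -/
structure IsLongestPath (G : SimpleGraph V) (l : List V) : Prop where
  isPathList : IsPathList G l
  length_le : ∀ l', IsPathList G l' → l'.length ≤ l.length

lemma IsLongestPath.mem_of_adj_getLast? (hl : IsLongestPath G l) (hv : l.getLast? = some v)
    (huv : G.Adj v u) : u ∈ l := by
  by_contra hu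
  simpa using hl.length_le _ (hl.isPathList.concat hv huv hu)

lemma exists_isLongestPath [Finite V] [Nonempty V] (G : SimpleGraph V) :
    ∃ l, IsLongestPath G l ∧ l ≠ [] := by
  have := Fintype.ofFinite V
  obtain ⟨v⟩ := ‹Nonempty V›
  have hfin : {l | IsPathList G l}.Finite :=
    (List.finite_length_le V (Fintype.card V)).subset fun l hl => hl.nodup.length_le_card
  have hv : IsPathList G [v] := ⟨by simp, by simp⟩
  obtain ⟨l, hl, hmax⟩ := hfin.exists_maximalFor List.length _ ⟨[v], hv⟩
  have hle : ∀ l', IsPathList G l' → l'.length ≤ l.length := fun l' hl' =>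
    (le_total l'.length l.length).elim id (hmax hl')
  refine ⟨l, ⟨hl, hle⟩, ?_⟩
  rintro rfl
  simpa using hle _ hv

/-- The paths obtained from `l₀` by Pósa rotations that keep the first vertex fixed. -/
inductive Rotated (G : SimpleGraph V) (l₀ : List V) : List V → Prop
  | refl : Rotated G l₀ l₀
  | step {A B : List V} {u v : V} : Rotated G l₀ (A ++ u :: B) → B.getLast? = some v →
      G.Adj u v → Rotated G l₀ (A ++ u :: B.reverse)

namespace Rotated

lemma perm (h : Rotated G l₀ l) : l.Perm l₀ := by
  induction h with
  | refl => rfl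
  | step _ _ _ ih => exact (((List.reverse_perm _).cons _).append_left _).trans ih

lemma head? (h : Rotated G l₀ l) : l.head? = l₀.head? := by
  induction h with
  | refl => rfl
  | @step A _ _ _ _ _ _ ih => rw [← ih]; cases A <;> simp

lemma isPathList (h : Rotated G l₀ l) (hl₀ : IsPathList G l₀) : IsPathList G l := by
  induction h with
  | refl => exact hl₀
  | step _ hv huv ih => exact ih.rotate hv huv

lemma isLongestPath (h : Rotated G l₀ l) (hl₀ : IsLongestPath G l₀) : IsLongestPath G l :=
  ⟨h.isPathList hl₀.isPathList, fun l' hl' => h.perm.length_eq ▸ hl₀.length_le l' hl'⟩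

end Rotated

variable [Fintype V]

open Classical in
/-- The last vertices of the rotations of the path `l₀`. -/
noncomputable def rotationEnds (G : SimpleGraph V) (l₀ : List V) : Finset V :=
  Finset.univ.filter fun y => ∃ l, Rotated G l₀ l ∧ l.getLast? = some y

lemma mem_rotationEnds : y ∈ rotationEnds G l₀ ↔ ∃ l, Rotated G l₀ l ∧ l.getLast? = some y := by
  simp [rotationEnds]

namespace Rotated

lemma mem_rotationEnds (h : Rotated G l₀ l) (hy : l.getLast? = some y) : y ∈ rotationEnds G l₀ :=
  _root_.mem_rotationEnds.2 ⟨l, h, hy⟩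

lemma mem_rotationEnds_of_infix (h : Rotated G l₀ l) (hv : l.getLast? = some v)
    (hvu : G.Adj v u) (hub : [u, b] <:+: l) : b ∈ rotationEnds G l₀ := by
  obtain ⟨A, B, rfl⟩ := hub
  have hl : A ++ [u, b] ++ B = A ++ u :: b :: B := by simp
  rw [hl] at h hv
  have hv' : (b :: B).getLast? = some v := by simpa using hv
  exact (h.step hv' hvu.symm).mem_rotationEnds (by simp [getLast?_cons_concat])

lemma infix_or_infix (h : Rotated G l₀ l) (hab : [a, b] <:+: l₀) (ha : a ∉ rotationEnds G l₀)
    (hb : b ∉ rotationEnds G l₀) : [a, b] <:+: l ∨ [b, a] <:+: l := by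
  induction h with
  | refl => exact Or.inl hab
  | step hr hv huv ih =>
    have hr' := hr.step hv huv
    rcases ih with ih | ih
    · exact infix_or_infix_append_cons_reverse ih fun h => hb (hr'.mem_rotationEnds h)
    · exact (infix_or_infix_append_cons_reverse ih fun h => ha (hr'.mem_rotationEnds h)).symm

end Rotated

open Classical in
/-- The external neighbourhood of a set of vertices. -/
noncomputable def extNbr (G : SimpleGraph V) (S : Finset V) : Finset V :=
  Finset.univ.filter fun v => v ∉ S ∧ ∃ u ∈ S, G.Adj u v

lemma mem_extNbr {S : Finset V} : v ∈ extNbr G S ↔ v ∉ S ∧ ∃ u ∈ S, G.Adj u v := by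
  simp [extNbr]

-- Rotating at `u` makes its successor `b` on the current path an end. If neither neighbour of `u`
-- on `l₀` were an end, both would still be next to `u` on the current path, and so would `b`.
lemma exists_mem_rotationEnds_infix (hl₀ : IsLongestPath G l₀)
    (hu : u ∈ extNbr G (rotationEnds G l₀)) :
    ∃ a ∈ rotationEnds G l₀, [a, u] <:+: l₀ ∨ [u, a] <:+: l₀ := by
  classical
  obtain ⟨huS, v, hv, hvu⟩ := mem_extNbr.1 hu
  obtain ⟨l, hl, hvl⟩ := mem_rotationEnds.1 hv
  have hnd := (hl.isPathList hl₀.isPathList).nodup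
  have hul : u ∈ l := (hl.isLongestPath hl₀).mem_of_adj_getLast? hvl hvu
  obtain ⟨b, hub⟩ := exists_infix_of_getLast?_ne hul fun h => huS (hl.mem_rotationEnds h)
  have hb : b ∈ rotationEnds G l₀ := hl.mem_rotationEnds_of_infix hvl hvu hub
  by_contra! hno
  have hul₀ : u ∈ l₀ := hl.perm.subset hul
  obtain ⟨c, huc⟩ := exists_infix_of_getLast?_ne hul₀ fun h => huS (Rotated.refl.mem_rotationEnds h)
  have hc : c ∉ rotationEnds G l₀ := fun h => (hno c h).2 huc
  have hcu : [c, u] <:+: l := by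
    refine (hl.infix_or_infix huc huS hc).resolve_left fun h => hc ?_
    rwa [← formPerm_of_infix hnd h, formPerm_of_infix hnd hub]
  obtain ⟨d, hdu⟩ := exists_infix_of_head?_ne hul₀ fun h =>
    not_infix_of_head? hnd (hl.head?.trans h) hcu
  have hd : d ∉ rotationEnds G l₀ := fun h => (hno d h).1 hdu
  have hdc : d ≠ c := by
    rintro rfl
    exact not_infix_swap hl₀.isPathList.nodup huc hdu
  rcases hl.infix_or_infix hdu hd huS with h | h
  · exact hdc (l.formPerm.injective
      ((formPerm_of_infix hnd h).trans (formPerm_of_infix hnd hcu).symm))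
  · exact hd (by rwa [← formPerm_of_infix hnd h, formPerm_of_infix hnd hub])

/-- Pósa's lemma. -/
lemma card_extNbr_rotationEnds_lt (hl₀ : IsLongestPath G l₀) (hy : l₀.getLast? = some y) :
    (extNbr G (rotationEnds G l₀)).card < 2 * (rotationEnds G l₀).card := by
  classical
  set S := rotationEnds G l₀
  have hnd := hl₀.isPathList.nodup
  have hyS : y ∈ S := Rotated.refl.mem_rotationEnds hy
  have hsub : extNbr G S ⊆
      (S.erase y).image l₀.formPerm ∪ S.image (l₀.formPerm⁻¹ : Equiv.Perm V) := by
    intro u hu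
    obtain ⟨a, haS, h | h⟩ := exists_mem_rotationEnds_infix hl₀ hu
    · have hay : a ≠ y := fun hay => not_infix_of_getLast? hnd (hay ▸ hy) h
      exact Finset.mem_union_left _ (Finset.mem_image.2
        ⟨a, Finset.mem_erase.2 ⟨hay, haS⟩, formPerm_of_infix hnd h⟩)
    · exact Finset.mem_union_right _ (Finset.mem_image.2
        ⟨a, haS, Equiv.Perm.inv_eq_iff_eq.2 (formPerm_of_infix hnd h).symm⟩)
  calc (extNbr G S).card
      ≤ ((S.erase y).image l₀.formPerm).card + (S.image (l₀.formPerm⁻¹ : Equiv.Perm V)).card :=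
        (Finset.card_le_card hsub).trans (Finset.card_union_le _ _)
    _ ≤ (S.erase y).card + S.card := add_le_add Finset.card_image_le Finset.card_image_le
    _ < 2 * S.card := by linarith [Finset.card_erase_lt_of_mem hyS]

open Classical in
/-- The last vertices of the longest paths that start at `x`. -/
noncomputable def longestEnds (G : SimpleGraph V) (x : V) : Finset V :=
  Finset.univ.filter fun y => ∃ l, IsLongestPath G l ∧ l.head? = some x ∧ l.getLast? = some y

lemma mem_longestEnds :
    y ∈ longestEnds G x ↔ ∃ l, IsLongestPath G l ∧ l.head? = some x ∧ l.getLast? = some y := by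
  simp [longestEnds]

lemma rotationEnds_subset_longestEnds (hl₀ : IsLongestPath G l₀) (hx : l₀.head? = some x) :
    rotationEnds G l₀ ⊆ longestEnds G x := fun _ hy =>
  have ⟨l, hl, hyl⟩ := mem_rotationEnds.1 hy
  mem_longestEnds.2 ⟨l, hl.isLongestPath hl₀, hl.head?.trans hx, hyl⟩

lemma lt_card_longestEnds {m : ℕ}
    (hG : ∀ S : Finset V, S.card ≤ m → 2 * S.card ≤ (extNbr G S).card)
    (hl : IsLongestPath G l) (hx : l.head? = some x) : m < (longestEnds G x).card := by
  have hne : l ≠ [] := by rintro rfl; simp at hx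
  by_contra! h
  have hle := Finset.card_le_card (rotationEnds_subset_longestEnds hl hx)
  have hlt := card_extNbr_rotationEnds_lt hl (List.getLast?_eq_some_getLast hne)
  exact hlt.not_ge (hG _ (hle.trans h))

lemma IsPathList.isHamiltonian [DecidableEq V] (hl : IsPathList G l)
    (hcard : l.length = Fintype.card V) (h3 : 3 ≤ Fintype.card V) (hx : l.head? = some x)
    (hy : l.getLast? = some y) (hyx : G.Adj y x) : G.IsHamiltonian := by
  intro _
  have hne : l ≠ [] := by rintro rfl; simp at hx
  obtain rfl : l.head hne = x := by simpa [List.head?_eq_some_head hne] using hx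
  obtain rfl : l.getLast hne = y := by simpa [List.getLast?_eq_some_getLast hne] using hy
  set p := SimpleGraph.Walk.ofSupport l hne hl.chain with hp
  have hpath : p.IsPath := by
    rw [SimpleGraph.Walk.isPath_def, hp, SimpleGraph.Walk.support_ofSupport]; exact hl.nodup
  have hlen : p.length = l.length - 1 := by rw [hp, SimpleGraph.Walk.length_ofSupport]
  refine ⟨_, SimpleGraph.Walk.cons hyx p, ?_⟩
  rw [SimpleGraph.Walk.isHamiltonianCycle_iff_isCycle_and_length_eq,
    SimpleGraph.Walk.cons_isCycle_iff]
  refine ⟨⟨hpath, fun h => ?_⟩, ?_⟩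
  · rw [Sym2.eq_swap] at h
    have := hpath.length_eq_one_of_mem_edges h
    omega
  · rw [SimpleGraph.Walk.length_cons]; omega

lemma isHamiltonian_or_exists_longer_of_cycle [DecidableEq V] (hG : G.Connected)
    (h3 : 3 ≤ Fintype.card V) (hl : IsPathList G l) (hx : l.head? = some x)
    (hy : l.getLast? = some y) (hyx : G.Adj y x) :
    G.IsHamiltonian ∨ ∃ l', IsPathList G l' ∧ l.length < l'.length := by
  by_cases hall : ∀ v, v ∈ l
  · refine Or.inl (hl.isHamiltonian ?_ h3 hx hy hyx)
    rw [← List.toFinset_card_of_nodup hl.nodup, ← Finset.card_univ]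
    congr 1
    ext v; simp [hall v]
  right
  push Not at hall
  obtain ⟨v, hv⟩ := hall
  obtain ⟨w⟩ := hG.preconnected x v
  obtain ⟨⟨⟨c, d⟩, hcd⟩, -, hc, hd⟩ :=
    w.exists_boundary_dart {u | u ∈ l} (List.mem_of_mem_head? hx) hv
  simp only [Set.mem_ofPred_eq] at hc hd
  obtain ⟨A, B, rfl⟩ := List.append_of_mem hc
  refine ⟨B ++ (A ++ [c]) ++ [d],
    (hl.open_cycle hx hy hyx).concat (v := c) (by simp) hcd (by simp_all), by simp; omega⟩

lemma isHamiltonian_or_exists_longer [DecidableEq V] (hGH : G ≤ H) (hG : G.Connected)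
    (h3 : 3 ≤ Fintype.card V) (hl : IsPathList G l) (hx : l.head? = some x)
    (hy : l.getLast? = some y) (hyw : H.Adj y w) (hxw : H.Adj x (l.formPerm w)) :
    H.IsHamiltonian ∨ ∃ l', IsPathList H l' ∧ l.length < l'.length := by
  have hlH := hl.mono hGH
  by_cases hw : w ∈ l
  · obtain ⟨z, A, B, rfl⟩ := exists_infix_of_getLast?_ne hw fun h => hyw.ne (by simp_all)
    have hassoc : A ++ [w, z] ++ B = A ++ w :: z :: B := by simp
    rw [formPerm_of_infix hl.nodup ⟨A, B, rfl⟩] at hxw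
    rw [hassoc] at hx hy hlH
    have hcycle := isHamiltonian_or_exists_longer_of_cycle (hG.mono hGH) h3
      (hlH.rotate (by simpa using hy) hyw.symm) (x := x) (y := z)
      (by rw [← hx]; cases A <;> simp) (by simp [getLast?_cons_concat]) hxw.symm
    simpa using hcycle
  · exact Or.inr ⟨l ++ [w], hlH.concat hy hyw hw, by simp⟩

end Rotation

section Expansion

variable {V : Type*} {G H R : SimpleGraph V} {S U : Finset V} {v : V}

/-- Distinct vertices of `U` are at distance greater than `r`; the distance is expressed through
walks because `SimpleGraph.dist` is `0` between different components. -/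
def IsSeparated (G : SimpleGraph V) (U : Finset V) (r : ℕ) : Prop :=
  ∀ u ∈ U, ∀ v ∈ U, u ≠ v → ∀ w : G.Walk u v, r < w.length

lemma IsSeparated.mono {U' : Finset V} {r r' : ℕ} (hU : IsSeparated G U r) (h : U' ⊆ U)
    (hr : r' ≤ r) : IsSeparated G U' r' :=
  fun u hu v hv huv w => hr.trans_lt (hU u (h hu) v (h hv) huv w)

variable [Fintype V]

open Classical in
/-- The neighbourhood of a vertex, as a finite set. -/
noncomputable def nbr (G : SimpleGraph V) (v : V) : Finset V := Finset.univ.filter (G.Adj v)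

lemma mem_nbr {w : V} : w ∈ nbr G v ↔ G.Adj v w := by simp [nbr]

lemma extNbr_mono (h : G ≤ H) (S : Finset V) : extNbr G S ⊆ extNbr H S := fun _ hv =>
  have ⟨h1, u, hu, huv⟩ := mem_extNbr.1 hv
  mem_extNbr.2 ⟨h1, u, hu, h huv⟩

lemma connected_of_expansion [Nonempty V] {m : ℕ}
    (hexp : ∀ S : Finset V, S.card ≤ m → 2 * S.card ≤ (extNbr H S).card)
    (hcut : ∀ C : Finset V, m < C.card → 2 * C.card ≤ Fintype.card V →
      ∃ u ∈ C, ∃ v, v ∉ C ∧ H.Adj u v) : H.Connected := by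
  classical
  have h_leave : ∀ C : Finset V, C.Nonempty → 2 * C.card ≤ Fintype.card V →
      ∃ u ∈ C, ∃ v, v ∉ C ∧ H.Adj u v := by
    intro C hC h2
    rcases le_or_gt C.card m with h | h
    · have h1 := hexp C h
      have h0 := Finset.card_pos.2 hC
      obtain ⟨v, hv⟩ := Finset.card_pos.1 (show 0 < (extNbr H C).card by omega)
      obtain ⟨hvC, u, hu, huv⟩ := mem_extNbr.1 hv
      exact ⟨u, hu, v, hvC, huv⟩
    · exact hcut C h h2
  refine ⟨fun x y => ?_⟩
  by_contra hxy
  set C : Finset V := Finset.univ.filter (H.Reachable x) with hC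
  have hxC : x ∈ C := by simp [hC]
  have hyC : y ∈ Cᶜ := by simpa [hC] using hxy
  have hclosed : ∀ u v, u ∈ C → H.Adj u v → v ∈ C := by
    intro u v hu huv
    simp only [hC, Finset.mem_filter, Finset.mem_univ, true_and] at hu ⊢
    exact hu.trans huv.reachable
  rcases le_total (2 * C.card) (Fintype.card V) with h | h
  · obtain ⟨u, hu, v, hv, huv⟩ := h_leave C ⟨x, hxC⟩ h
    exact hv (hclosed u v hu huv)
  · obtain ⟨u, hu, v, hv, huv⟩ := h_leave Cᶜ ⟨y, hyC⟩ (by rw [Finset.card_compl]; omega)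
    rw [Finset.mem_compl] at hu
    exact hu (hclosed v u (not_not.1 fun h => hv (Finset.mem_compl.2 h)) huv.symm)

variable [DecidableEq V]

lemma IsSeparated.mul_card_le_card_biUnion_nbr {k : ℕ} (hU : IsSeparated G U 2)
    (hdeg : ∀ u ∈ U, k ≤ (nbr G u).card) : k * U.card ≤ (U.biUnion (nbr G)).card := by
  rw [Finset.card_biUnion, mul_comm, ← smul_eq_mul]
  · exact Finset.card_nsmul_le_sum _ _ _ hdeg
  · intro u hu u' hu' hne
    refine Finset.disjoint_left.2 fun a ha ha' => ?_
    exact (hU u hu u' hu' hne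
      (.cons (mem_nbr.1 ha) (.cons (mem_nbr.1 ha').symm .nil))).ne rfl

lemma IsSeparated.disjoint_biUnion_nbr (hU : IsSeparated G U 1) :
    Disjoint (U.biUnion (nbr G)) U := by
  refine Finset.disjoint_left.2 fun v hv hvU => ?_
  obtain ⟨u, hu, hv⟩ := Finset.mem_biUnion.1 hv
  have hadj := mem_nbr.1 hv
  exact (hU u hu v hvU hadj.ne (.cons hadj .nil)).ne rfl

-- A vertex with neighbours near two different elements of `U` would join them by a short walk.
lemma IsSeparated.card_nbr_inter_le {k : ℕ} (hU : IsSeparated G U 4)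
    (hcod : ∀ u ∈ U, (nbr G v ∩ nbr G u).card ≤ k) :
    (nbr G v ∩ (U ∪ U.biUnion (nbr G))).card ≤ k + 1 := by
  have near : ∀ w ∈ nbr G v ∩ (U ∪ U.biUnion (nbr G)),
      G.Adj v w ∧ ∃ u ∈ U, (w = u ∨ G.Adj u w) ∧ ∃ W : G.Walk u w, W.length ≤ 1 := by
    intro w hw
    obtain ⟨hvw, hw⟩ := Finset.mem_inter.1 hw
    refine ⟨mem_nbr.1 hvw, ?_⟩
    rcases Finset.mem_union.1 hw with hw | hw
    · exact ⟨w, hw, .inl rfl, .nil, zero_le_one⟩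
    · obtain ⟨u, hu, huw⟩ := Finset.mem_biUnion.1 hw
      exact ⟨u, hu, .inr (mem_nbr.1 huw), .cons (mem_nbr.1 huw) .nil, le_rfl⟩
  rcases Finset.eq_empty_or_nonempty (nbr G v ∩ (U ∪ U.biUnion (nbr G))) with he | ⟨w₀, hw₀⟩
  · simp [he]
  obtain ⟨hvw₀, u₀, hu₀, -, W₀, hW₀⟩ := near w₀ hw₀
  have hsub : nbr G v ∩ (U ∪ U.biUnion (nbr G)) ⊆ insert u₀ (nbr G v ∩ nbr G u₀) := by
    intro w hw
    obtain ⟨hvw, u, hu, hwu, W, hW⟩ := near w hw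
    obtain rfl : u₀ = u := by
      by_contra hne
      have hlt := hU u₀ hu₀ u hu hne (W₀.append (.cons hvw₀.symm (.cons hvw W.reverse)))
      simp only [SimpleGraph.Walk.length_append, SimpleGraph.Walk.length_cons,
        SimpleGraph.Walk.length_reverse] at hlt
      omega
    rcases hwu with rfl | hwu
    · exact Finset.mem_insert_self _ _
    · exact Finset.mem_insert_of_mem (Finset.mem_inter.2 ⟨mem_nbr.2 hvw, mem_nbr.2 hwu⟩)
  exact (Finset.card_le_card hsub).trans ((Finset.card_insert_le _ _).trans
    (Nat.succ_le_succ (hcod u₀ hu₀)))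

lemma IsSeparated.card_extNbr_inter_le {k : ℕ} (hU : IsSeparated G U 4) (hRG : R ≤ G)
    (hcod : ∀ v ∈ S, ∀ u ∈ U, (nbr G v ∩ nbr G u).card ≤ k) :
    (extNbr R S ∩ (U ∪ U.biUnion (nbr G))).card ≤ S.card * (k + 1) := by
  refine (Finset.card_le_card
    (t := S.biUnion fun v => nbr G v ∩ (U ∪ U.biUnion (nbr G))) fun w hw => ?_).trans
    (Finset.card_biUnion_le_card_mul _ _ _ fun v hv => hU.card_nbr_inter_le (hcod v hv))
  obtain ⟨hw, hwU⟩ := Finset.mem_inter.1 hw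
  obtain ⟨-, v, hv, hvw⟩ := mem_extNbr.1 hw
  exact Finset.mem_biUnion.2 ⟨v, hv, Finset.mem_inter.2 ⟨mem_nbr.2 (hRG hvw), hwU⟩⟩

lemma biUnion_nbr_sdiff_union_subset_extNbr (hRH : R ≤ H)
    (hU : ∀ u ∈ U, ∀ v, G.Adj u v → H.Adj u v) (hSU : Disjoint ((S ∩ U).biUnion (nbr G)) U) :
    (S ∩ U).biUnion (nbr G) \ (S \ U) ∪
      extNbr R (S \ U) \ (S ∩ U ∪ (S ∩ U).biUnion (nbr G)) ⊆ extNbr H S := by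
  refine Finset.union_subset (fun v hv => ?_) fun v hv => ?_
  · obtain ⟨hvN, hvS⟩ := Finset.mem_sdiff.1 hv
    obtain ⟨u, hu, hvu⟩ := Finset.mem_biUnion.1 hvN
    obtain ⟨huS, huU⟩ := Finset.mem_inter.1 hu
    exact mem_extNbr.2
      ⟨fun h => hvS (Finset.mem_sdiff.2 ⟨h, Finset.disjoint_left.1 hSU hvN⟩), u, huS,
        hU u huU v (mem_nbr.1 hvu)⟩
  · obtain ⟨hv, hvN⟩ := Finset.mem_sdiff.1 hv
    obtain ⟨hvS, u, hu, huv⟩ := mem_extNbr.1 hv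
    refine mem_extNbr.2 ⟨fun h => ?_, u, (Finset.mem_sdiff.1 hu).1, hRH huv⟩
    rcases Finset.mem_union.1 ((Finset.sdiff_union_inter S U).symm ▸ h) with h | h
    · exact hvS h
    · exact hvN (Finset.mem_union_left _ h)

-- A set is split into `S₁ ⊆ U` and `S₂` outside `U`. The neighbourhoods in `S₁` are disjoint, and
-- at most half of the `6 * S₂.card` neighbours of `S₂` fall into `S₁` or its neighbourhood `N`.
lemma two_mul_card_le_card_extNbr (hRH : R ≤ H) (hHG : H ≤ G) {m : ℕ}
    (hsep : IsSeparated G U 4) (hU : ∀ u ∈ U, ∀ v, G.Adj u v → H.Adj u v)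
    (hdeg : ∀ u ∈ U, 2 ≤ (nbr G u).card)
    (hcod : ∀ u v, u ≠ v → (nbr G u ∩ nbr G v).card ≤ 2)
    (hR : ∀ S : Finset V, Disjoint S U → S.card ≤ m → 6 * S.card ≤ (extNbr R S).card)
    (hS : S.card ≤ m) : 2 * S.card ≤ (extNbr H S).card := by
  set S₁ := S ∩ U
  set S₂ := S \ U
  set N := S₁.biUnion (nbr G)
  set M := extNbr R S₂ \ (S₁ ∪ N)
  have hS₁ : IsSeparated G S₁ 4 := hsep.mono Finset.inter_subset_right le_rfl
  have hcard : S₁.card + S₂.card = S.card := Finset.card_inter_add_card_sdiff S U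
  have hN_card : 2 * S₁.card ≤ N.card :=
    (hS₁.mono subset_rfl (by norm_num)).mul_card_le_card_biUnion_nbr
      fun u hu => hdeg u (Finset.mem_inter.1 hu).2
  have hNU : Disjoint N U := (hsep.mono subset_rfl (by norm_num)).disjoint_biUnion_nbr.mono_left
    (Finset.biUnion_subset_biUnion_of_subset_left _ Finset.inter_subset_right)
  have hdisj : Disjoint (N \ S₂) M := Finset.disjoint_left.2 fun v hv hvM =>
    (Finset.mem_sdiff.1 hvM).2 (Finset.mem_union_right _ (Finset.mem_sdiff.1 hv).1)
  have h_inter : (extNbr R S₂ ∩ (S₁ ∪ N)).card ≤ S₂.card * 3 :=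
    hS₁.card_extNbr_inter_le (hRH.trans hHG) fun v hv u hu =>
      hcod v u fun h => (Finset.mem_sdiff.1 hv).2 (h ▸ (Finset.mem_inter.1 hu).2)
  have hS₂_exp : 6 * S₂.card ≤ (extNbr R S₂).card := hR S₂ Finset.sdiff_disjoint
    ((Finset.card_le_card Finset.sdiff_subset).trans hS)
  have hM_card : M.card + _ = _ := Finset.card_sdiff_add_card_inter (extNbr R S₂) (S₁ ∪ N)
  have hN_sdiff := Finset.le_card_sdiff S₂ N
  have h_total := Finset.card_le_card (biUnion_nbr_sdiff_union_subset_extNbr hRH hU hNU)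
  rw [Finset.card_union_of_disjoint hdisj] at h_total
  omega

end Expansion

section TypicalGraph

variable {V : Type*} [DecidableEq V] {F R T : Finset (Sym2 V)} {S : Finset V}

/-- The vertex `v` meets fewer than `28` edges of `R`. Sets of vertices that are not small have
enough edges to expand by a factor six in a graph without dense sets of vertices. -/
def IsSmall (R : Finset (Sym2 V)) (v : V) : Prop := (R.filter (v ∈ ·)).card < 28

/-- Some set `S` of more than `s` and at most `m` vertices has all its `F`-neighbours in `S ∪ T`,
where `T` is at most six times as large as `S`. -/
def HasTrappedSet (F : Finset (Sym2 V)) (s m : ℕ) : Prop :=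
  ∃ S T : Finset V, (s < S.card ∧ S.card ≤ m ∧ T.card ≤ 6 * S.card) ∧
    ∀ u ∈ S, ∀ v, v ∉ S → v ∉ T → s(u, v) ∉ F

/-- The edges `s(f 0, f 1)`, `s(f 1, f 2)`, … of the path through the vertices `f 0`, …, `f j`. -/
def pathEdges {j : ℕ} (f : Fin (j + 1) → V) : Finset (Sym2 V) :=
  Finset.univ.image fun i : Fin j => s(f i.castSucc, f i.succ)

/-- Two small vertices of `R` are joined by a path of length at most `r` in `R ∪ T`. -/
def HasCloseSmallPair (R T : Finset (Sym2 V)) (r : ℕ) : Prop :=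
  ∃ j ∈ Finset.Icc 1 r, ∃ f : Fin (j + 1) → V, f.Injective ∧ pathEdges f ⊆ R ∪ T ∧
    IsSmall R (f 0) ∧ IsSmall R (f (Fin.last j))

open Classical in
/-- The edges of `T` that meet a small vertex of `R`. -/
noncomputable def smallEdges (R T : Finset (Sym2 V)) : Finset (Sym2 V) :=
  T.filter fun e => ∃ v ∈ e, IsSmall R v

lemma mem_smallEdges {e : Sym2 V} : e ∈ smallEdges R T ↔ e ∈ T ∧ ∃ v ∈ e, IsSmall R v := by
  simp [smallEdges]

lemma smallEdges_subset : smallEdges R T ⊆ T := fun _ he => (mem_smallEdges.1 he).1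

lemma card_pathEdges {j : ℕ} {f : Fin (j + 1) → V} (hf : f.Injective) :
    (pathEdges f).card = j := by
  rw [pathEdges, Finset.card_image_of_injective, Finset.card_univ, Fintype.card_fin]
  intro a b h
  rcases Sym2.eq_iff.1 h with ⟨h, -⟩ | ⟨h, h'⟩
  · exact Fin.castSucc_injective _ (hf h)
  · have h1 := congrArg Fin.val (hf h)
    have h2 := congrArg Fin.val (hf h')
    simp only [Fin.val_castSucc, Fin.val_succ] at h1 h2
    omega

lemma card_filter_mem_sym2_le (e : Sym2 V) (S : Finset V) : (S.filter (· ∈ e)).card ≤ 2 := by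
  induction e with
  | h a b =>
    refine (Finset.card_le_card fun v hv => ?_).trans (Finset.card_le_two (a := a) (b := b))
    simpa using (Finset.mem_filter.1 hv).2

lemma sum_card_filter_mem_le {I : Finset (Sym2 V)} (hI : ∀ v ∈ S, ∀ e ∈ F, v ∈ e → e ∈ I) :
    ∑ v ∈ S, (F.filter (v ∈ ·)).card ≤ I.card * 2 := by
  have h_double := Finset.sum_card_bipartiteAbove_eq_sum_card_bipartiteBelow (s := S) (t := I)
    fun v e => v ∈ e
  calc ∑ v ∈ S, (F.filter (v ∈ ·)).card ≤ ∑ v ∈ S, (I.filter (v ∈ ·)).card := by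
        refine Finset.sum_le_sum fun v hv => Finset.card_le_card fun e he => ?_
        obtain ⟨heF, hve⟩ := Finset.mem_filter.1 he
        exact Finset.mem_filter.2 ⟨hI v hv e heF hve, hve⟩
    _ = ∑ e ∈ I, (S.filter (· ∈ e)).card := h_double
    _ ≤ I.card * 2 := by
        rw [← smul_eq_mul]
        exact Finset.sum_le_card_nsmul _ _ _ fun e _ => card_filter_mem_sym2_le e S

variable [Fintype V]

lemma card_nbr_edgeGraph (hF : ∀ e ∈ F, ¬ e.IsDiag) (v : V) :
    (nbr (edgeGraph F) v).card = (F.filter (v ∈ ·)).card := by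
  refine Finset.card_bij (fun w _ => s(v, w)) ?_ ?_ ?_
  · intro w hw
    exact Finset.mem_filter.2 ⟨(edgeGraph_adj hF).1 (mem_nbr.1 hw), by simp⟩
  · intro a _ b _ h
    exact Sym2.congr_right.1 h
  · intro e he
    obtain ⟨h1, h2⟩ := Finset.mem_filter.1 he
    obtain ⟨w, rfl⟩ := Sym2.mem_iff_exists.1 h2
    exact ⟨w, mem_nbr.2 ((edgeGraph_adj hF).2 h1), rfl⟩

lemma two_le_card_filter_of_isHamiltonian (hF : ∀ e ∈ F, ¬ e.IsDiag)
    (h2 : 2 ≤ Fintype.card V) (hH : (edgeGraph F).IsHamiltonian) (v : V) :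
    2 ≤ (F.filter (v ∈ ·)).card := by
  have : Nontrivial V := Fintype.one_lt_card_iff_nontrivial.1 h2
  obtain ⟨p, hp⟩ := hH.exists_isHamiltonianCycle v
  rw [← card_nbr_edgeGraph hF]
  calc 2 = ({p.snd, p.penultimate} : Finset V).card := by
        rw [Finset.card_pair hp.isCycle.snd_ne_penultimate]
    _ ≤ _ := by
        refine Finset.card_le_card fun w hw => mem_nbr.2 ?_
        rcases Finset.mem_insert.1 hw with rfl | hw
        · exact p.adj_snd hp.isCycle.not_nil
        · obtain rfl := Finset.mem_singleton.1 hw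
          exact (p.adj_penultimate hp.isCycle.not_nil).symm

/-- Some nonempty set `S` of at most `k` vertices spans at least `2 * S.card` edges of `F`. -/
def HasDenseSet (F : Finset (Sym2 V)) (k : ℕ) : Prop :=
  ∃ S : Finset V, S.Nonempty ∧ S.card ≤ k ∧ 2 * S.card ≤ (F ∩ S.sym2).card

/-- No edge of `F` leaves some set of more than `m` and at most half of the vertices. -/
def HasEmptyCut (F : Finset (Sym2 V)) (m : ℕ) : Prop :=
  ∃ C : Finset V, (m < C.card ∧ 2 * C.card ≤ Fintype.card V) ∧ ∀ u ∈ C, ∀ v, v ∉ C → s(u, v) ∉ F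

/-- Two vertices have more than two common neighbours in the graph with edge set `F`. -/
def HasLargeCodegree (F : Finset (Sym2 V)) : Prop :=
  ∃ u v, u ≠ v ∧ 2 < (nbr (edgeGraph F) u ∩ nbr (edgeGraph F) v).card

open Classical in
lemma isSeparated_of_not_hasCloseSmallPair {r : ℕ} (h : ¬ HasCloseSmallPair R T r) :
    IsSeparated (edgeGraph (R ∪ T)) (Finset.univ.filter (IsSmall R)) r := by
  intro u hu v hv huv w
  by_contra! hw
  have hp := w.bypass_isPath
  have h_length : w.bypass.length ∈ Finset.Icc 1 r := Finset.mem_Icc.2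
    ⟨Nat.one_le_iff_ne_zero.2 fun h0 => huv (SimpleGraph.Walk.eq_of_length_eq_zero h0),
      w.length_bypass_le_length.trans hw⟩
  refine h ⟨_, h_length, fun i => w.bypass.getVert i, ?_, ?_, ?_, ?_⟩
  · exact fun a b hab => Fin.ext
      (hp.getVert_injOn (Nat.lt_succ_iff.1 a.2) (Nat.lt_succ_iff.1 b.2) hab)
  · refine Finset.image_subset_iff.2 fun i _ => Finset.mem_coe.1 ?_
    exact ((SimpleGraph.fromEdgeSet_adj _).1 (w.bypass.adj_getVert_succ i.2)).1
  · simpa using (Finset.mem_filter.1 hu).2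
  · simpa using (Finset.mem_filter.1 hv).2

lemma six_mul_card_le_card_extNbr (hF : ∀ e ∈ F, ¬ e.IsDiag) {s m : ℕ}
    (hdense : ¬ HasDenseSet F (7 * s)) (htrapped : ¬ HasTrappedSet F s m)
    (hS : S.card ≤ m) (hdeg : ∀ v ∈ S, ¬ IsSmall F v) :
    6 * S.card ≤ (extNbr (edgeGraph F) S).card := by
  by_contra! hlt
  set X := extNbr (edgeGraph F) S
  have hX : ∀ u ∈ S, ∀ v, s(u, v) ∈ F → v ∉ S → v ∈ X := fun u hu v huv hv =>
    mem_extNbr.2 ⟨hv, u, hu, (edgeGraph_adj hF).2 huv⟩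
  rcases lt_or_ge s S.card with hs | hs
  · exact htrapped ⟨S, X, ⟨hs, hS, hlt.le⟩, fun u hu v hvS hvX huv => hvX (hX u hu v huv hvS)⟩
  have hT : (S ∪ X).card ≤ 7 * S.card := (Finset.card_union_le _ _).trans (by omega)
  refine hdense ⟨S ∪ X, ?_, by omega, ?_⟩
  · exact (Finset.card_pos.1 (by omega : 0 < S.card)).mono Finset.subset_union_left
  have h_upper := sum_card_filter_mem_le (S := S) (F := F)
    (I := F ∩ (S ∪ X).sym2) fun v hv e he hve => by
      refine Finset.mem_inter.2 ⟨he, Finset.mem_sym2_iff.2 fun x hx => ?_⟩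
      obtain ⟨w, rfl⟩ := Sym2.mem_iff_exists.1 hve
      rcases Sym2.mem_iff.1 hx with rfl | rfl
      · exact Finset.mem_union_left _ hv
      · by_cases hxS : x ∈ S
        · exact Finset.mem_union_left _ hxS
        · exact Finset.mem_union_right _ (hX v hv x he hxS)
  have h_lower : S.card • 28 ≤ ∑ v ∈ S, (F.filter (v ∈ ·)).card :=
    Finset.card_nsmul_le_sum _ _ _ fun v hv => not_lt.1 (hdeg v hv)
  rw [smul_eq_mul] at h_lower
  omega

lemma two_mul_card_le_card_extNbr_union_smallEdges (hd : ∀ e ∈ R ∪ T, ¬ e.IsDiag) {m s : ℕ}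
    (hdeg : ∀ v, 2 ≤ ((R ∪ T).filter (v ∈ ·)).card) (hclose : ¬ HasCloseSmallPair R T 4)
    (hcod : ¬ HasLargeCodegree (R ∪ T)) (hdense : ¬ HasDenseSet R (7 * s))
    (htrapped : ¬ HasTrappedSet R s m) (hS : S.card ≤ m) :
    2 * S.card ≤ (extNbr (edgeGraph (R ∪ smallEdges R T)) S).card := by
  classical
  refine two_mul_card_le_card_extNbr (edgeGraph_mono Finset.subset_union_left)
    (edgeGraph_mono (Finset.union_subset_union_right smallEdges_subset))
    (isSeparated_of_not_hasCloseSmallPair hclose) (fun u hu v huv => ?_)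
    (fun u _ => (hdeg u).trans_eq (card_nbr_edgeGraph hd u).symm)
    (fun u v huv => not_lt.1 fun h => hcod ⟨u, v, huv, h⟩) (fun S' hS' hS'm => ?_) hS
  · rw [SimpleGraph.fromEdgeSet_adj, Finset.mem_coe]
    refine ⟨?_, huv.ne⟩
    rcases Finset.mem_union.1 ((edgeGraph_adj hd).1 huv) with h | h
    · exact Finset.mem_union_left _ h
    · exact Finset.mem_union_right _
        (mem_smallEdges.2 ⟨h, u, by simp, (Finset.mem_filter.1 hu).2⟩)
  · exact six_mul_card_le_card_extNbr (fun e he => hd e (Finset.mem_union_left _ he)) hdense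
      htrapped hS'm fun v hv h => Finset.disjoint_left.1 hS' hv (by simpa using h)

end TypicalGraph

section PairEdges

variable {V : Type*} [DecidableEq V]

/-- The unordered pairs `s(x, y)` with `x ∈ X` and `y ∈ Y x`. -/
def pairEdges (X : Finset V) (Y : V → Finset V) : Finset (Sym2 V) :=
  X.biUnion fun x => (Y x).image fun y => s(x, y)

lemma mem_pairEdges {X : Finset V} {Y : V → Finset V} {e : Sym2 V} :
    e ∈ pairEdges X Y ↔ ∃ x ∈ X, ∃ y ∈ Y x, s(x, y) = e := by
  simp [pairEdges]

lemma mul_le_two_mul_card_pairEdges {X : Finset V} {Y : V → Finset V} {m θ : ℕ}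
    (hX : m ≤ X.card) (hY : ∀ x ∈ X, θ ≤ (Y x).card) : m * θ ≤ 2 * (pairEdges X Y).card := by
  have h_image : pairEdges X Y = (X.sigma Y).image fun q => s(q.1, q.2) := by
    ext e
    simp [mem_pairEdges, and_assoc]
  have h_fiber : ∀ e ∈ pairEdges X Y,
      ((X.sigma Y).filter fun q => s(q.1, q.2) = e).card ≤ 2 := by
    intro e _
    induction e with
    | h a b =>
      refine (Finset.card_le_card fun q hq => ?_).trans
        (Finset.card_le_two (a := (⟨a, b⟩ : Σ _ : V, V)) (b := ⟨b, a⟩))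
      rcases Sym2.eq_iff.1 (Finset.mem_filter.1 hq).2 with ⟨h1, h2⟩ | ⟨h1, h2⟩ <;>
        simp [← h1, ← h2]
  calc m * θ ≤ X.card * θ := Nat.mul_le_mul_right _ hX
    _ ≤ ∑ x ∈ X, (Y x).card := by simpa using Finset.card_nsmul_le_sum _ _ _ hY
    _ = (X.sigma Y).card := (Finset.card_sigma _ _).symm
    _ ≤ 2 * (pairEdges X Y).card := by
        rw [h_image] at h_fiber ⊢
        exact Finset.card_le_mul_card_image _ 2 h_fiber

lemma card_pairEdges_of_disjoint {X Y : Finset V} (hXY : Disjoint X Y) :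
    (pairEdges X fun _ => Y).card = X.card * Y.card := by
  have h_image : pairEdges X (fun _ => Y) = (X ×ˢ Y).image fun q => s(q.1, q.2) := by
    ext e
    simp [mem_pairEdges, and_assoc]
  rw [h_image, Finset.card_image_of_injOn, Finset.card_product]
  intro a ha b hb hab
  have ha := Finset.mem_product.1 ha
  have hb := Finset.mem_product.1 hb
  rcases Sym2.eq_iff.1 hab with ⟨h1, h2⟩ | ⟨h1, -⟩
  · exact Prod.ext h1 h2
  · exact absurd (h1 ▸ hb.2) (Finset.disjoint_left.1 hXY ha.1)

end PairEdges

section Booster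

variable {V : Type*} [Fintype V]

open Classical in
/-- The first vertices of longest paths. -/
noncomputable def longestStarts (G : SimpleGraph V) : Finset V :=
  Finset.univ.filter fun x => ∃ l, IsLongestPath G l ∧ l.head? = some x

lemma mem_longestStarts {G : SimpleGraph V} {x : V} :
    x ∈ longestStarts G ↔ ∃ l, IsLongestPath G l ∧ l.head? = some x := by
  simp [longestStarts]

lemma lt_card_longestStarts [Nonempty V] {G : SimpleGraph V} {m : ℕ}
    (hG : ∀ S : Finset V, S.card ≤ m → 2 * S.card ≤ (extNbr G S).card) :
    m < (longestStarts G).card := by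
  obtain ⟨l, hl, hne⟩ := exists_isLongestPath G
  refine (lt_card_longestEnds hG hl (List.head?_eq_some_head hne)).trans_le
    (Finset.card_le_card fun _ hy => ?_)
  obtain ⟨l', hl', -, hy'⟩ := mem_longestEnds.1 hy
  refine mem_longestStarts.2 ⟨l'.reverse, ⟨hl'.isPathList.reverse, ?_⟩, ?_⟩
  · simpa using hl'.length_le
  · simpa using hy'

/-- The number of vertices on a longest path. -/
noncomputable def pathNumber [Nonempty V] (G : SimpleGraph V) : ℕ :=
  (exists_isLongestPath G).choose.length

section PathNumber

variable [Nonempty V] {G : SimpleGraph V} {l : List V}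

lemma IsPathList.length_le_pathNumber (hl : IsPathList G l) : l.length ≤ pathNumber G :=
  (exists_isLongestPath G).choose_spec.1.length_le l hl

lemma pathNumber_le_card (G : SimpleGraph V) : pathNumber G ≤ Fintype.card V :=
  (exists_isLongestPath G).choose_spec.1.isPathList.nodup.length_le_card

lemma IsLongestPath.length_eq (hl : IsLongestPath G l) : l.length = pathNumber G :=
  le_antisymm hl.isPathList.length_le_pathNumber
    (hl.length_le _ (exists_isLongestPath G).choose_spec.1.isPathList)

end PathNumber

variable [DecidableEq V]

open Classical in
/-- The cyclic shift along a chosen longest path from `x` to `y`; the identity if there is none. -/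
noncomputable def shiftPerm (G : SimpleGraph V) (x y : V) : Equiv.Perm V :=
  if h : ∃ l, IsLongestPath G l ∧ l.head? = some x ∧ l.getLast? = some y then h.choose.formPerm
  else 1

lemma isHamiltonian_or_pathNumber_lt [Nonempty V] {G H : SimpleGraph V} (hGH : G ≤ H)
    (hG : G.Connected) (h3 : 3 ≤ Fintype.card V) {x y w : V} (hy : y ∈ longestEnds G x)
    (hyw : H.Adj y w) (hxw : H.Adj x (shiftPerm G x y w)) :
    H.IsHamiltonian ∨ pathNumber G < pathNumber H := by
  have hex := mem_longestEnds.1 hy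
  obtain ⟨hl, hx, hy'⟩ := hex.choose_spec
  rw [shiftPerm, dif_pos hex] at hxw
  refine (isHamiltonian_or_exists_longer hGH hG h3 hl.isPathList hx hy' hyw hxw).imp_right ?_
  rintro ⟨l', hl', hlt⟩
  exact hl.length_eq ▸ hlt.trans_le hl'.length_le_pathNumber

/-- No pair of edges from `A` and `B` extends a longest path of `G` via the chosen shift. An edge
of `A` and an edge of `B` are used because these are the edges of two independent random graphs. -/
def NoBooster (G : SimpleGraph V) (A B : Finset (Sym2 V)) : Prop :=
  ∀ x ∈ longestStarts G, ∀ y ∈ longestEnds G x, ∀ w, s(y, w) ∈ A →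
    s(x, shiftPerm G x y w) ∉ B

-- A maximiser of the path number among the extensions spending at most two edges per gained vertex.
lemma exists_noBooster [Nonempty V] (h3 : 3 ≤ Fintype.card V) {R A B F₀ : Finset (Sym2 V)}
    (hF₀ : F₀ ⊆ A ∪ B) (hd : ∀ e ∈ R ∪ (A ∪ B), ¬ e.IsDiag)
    (hcon : (edgeGraph (R ∪ F₀)).Connected) (hnot : ¬ (edgeGraph (R ∪ (A ∪ B))).IsHamiltonian) :
    ∃ F, F₀ ⊆ F ∧ F ⊆ A ∪ B ∧ F.card ≤ F₀.card + 2 * Fintype.card V ∧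
      NoBooster (edgeGraph (R ∪ F)) A B := by
  have h_mono {F F' : Finset (Sym2 V)} (h : F ⊆ F') : edgeGraph (R ∪ F) ≤ edgeGraph (R ∪ F') :=
    edgeGraph_mono (Finset.union_subset_union_right h)
  obtain ⟨F, hF, hmax⟩ := Finset.exists_max_image
    ((A ∪ B).powerset.filter fun F =>
      F₀ ⊆ F ∧ F.card ≤ F₀.card + 2 * pathNumber (edgeGraph (R ∪ F)))
    (fun F => pathNumber (edgeGraph (R ∪ F)))
    ⟨F₀, Finset.mem_filter.2 ⟨Finset.mem_powerset.2 hF₀, Finset.Subset.refl _, by omega⟩⟩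
  obtain ⟨hFs, hF0, hFc⟩ := Finset.mem_filter.1 hF
  rw [Finset.mem_powerset] at hFs
  have h_pathNumber := pathNumber_le_card (edgeGraph (R ∪ F))
  refine ⟨F, hF0, hFs, by omega, fun x _ y hy w hA hB => ?_⟩
  set z := shiftPerm (edgeGraph (R ∪ F)) x y w
  set F' := insert s(y, w) (insert s(x, z) F)
  have hFF' : F ⊆ F' := (Finset.subset_insert _ _).trans (Finset.subset_insert _ _)
  have hF's : F' ⊆ A ∪ B := Finset.insert_subset (Finset.mem_union_left _ hA)
    (Finset.insert_subset (Finset.mem_union_right _ hB) hFs)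
  have h_card : F'.card ≤ F.card + 2 :=
    (Finset.card_insert_le _ _).trans (Nat.succ_le_succ (Finset.card_insert_le _ _))
  have h_adj {u v : V} (h : s(u, v) ∈ F') : (edgeGraph (R ∪ F')).Adj u v :=
    (edgeGraph_adj fun e he => hd e (Finset.union_subset_union_right hF's he)).2
      (Finset.mem_union_right _ h)
  rcases isHamiltonian_or_pathNumber_lt (h_mono hFF') (hcon.mono (h_mono hF0)) h3 hy
    (h_adj (Finset.mem_insert_self _ _))
    (h_adj (Finset.mem_insert_of_mem (Finset.mem_insert_self _ _))) with h_ham | h_lt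
  · exact hnot (h_ham.mono (h_mono hF's))
  · have := hmax F' (Finset.mem_filter.2
      ⟨Finset.mem_powerset.2 hF's, hF0.trans hFF', by omega⟩)
    omega

section BoosterEdges

variable (Γ : SimpleGraph V) [DecidableRel Γ.Adj] (H : SimpleGraph V) {A B F : Finset (Sym2 V)}

lemma pairEdges_subset_edgeFinset {X : Finset V} {Y : V → Finset V}
    (hY : ∀ x ∈ X, Y x ⊆ Γ.neighborFinset x) : pairEdges X Y ⊆ Γ.edgeFinset := by
  intro e he
  obtain ⟨x, hx, y, hy, rfl⟩ := mem_pairEdges.1 he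
  simpa using hY x hx hy

open Classical in
/-- The vertices `z` such that `s(x, z)` is an edge of `Γ` that, together with some edge of `A`,
extends a longest path of `H` starting at `x` via the chosen shift. -/
noncomputable def closingNbrs (A : Finset (Sym2 V)) (x : V) : Finset V :=
  (Γ.neighborFinset x).filter fun z => ∃ y ∈ longestEnds H x, s(y, (shiftPerm H x y)⁻¹ z) ∈ A

lemma mem_closingNbrs {x z : V} : z ∈ closingNbrs Γ H A x ↔
    z ∈ Γ.neighborFinset x ∧ ∃ y ∈ longestEnds H x, s(y, (shiftPerm H x y)⁻¹ z) ∈ A := by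
  simp [closingNbrs]

/-- The edges that `B` has to avoid for `NoBooster H A B`. -/
noncomputable def closingEdges (A : Finset (Sym2 V)) : Finset (Sym2 V) :=
  pairEdges (longestStarts H) (closingNbrs Γ H A)

/-- The edges of `Γ` that leave the other end of a longest path of `H` starting at `x` and whose
shift lies in `M`. If `A` avoids them, then `closingNbrs Γ H A x` avoids `M`. -/
noncomputable def openingEdges (x : V) (M : Finset V) : Finset (Sym2 V) :=
  pairEdges (longestEnds H x) fun y =>
    (Γ.neighborFinset y).filter fun w => shiftPerm H x y w ∈ M

lemma closingEdges_subset (A : Finset (Sym2 V)) : closingEdges Γ H A ⊆ Γ.edgeFinset :=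
  pairEdges_subset_edgeFinset Γ fun _ _ _ hz => ((mem_closingNbrs Γ H).1 hz).1

lemma openingEdges_subset (x : V) (M : Finset V) : openingEdges Γ H x M ⊆ Γ.edgeFinset :=
  pairEdges_subset_edgeFinset Γ fun _ _ => Finset.filter_subset _ _

variable {H}

lemma NoBooster.disjoint_closingEdges (h : NoBooster H A B) : Disjoint (closingEdges Γ H A) B := by
  refine Finset.disjoint_left.2 fun e he heB => ?_
  obtain ⟨x, hx, z, hz, rfl⟩ := mem_pairEdges.1 he
  obtain ⟨-, y, hy, hyA⟩ := (mem_closingNbrs Γ H).1 hz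
  exact h x hx y hy _ hyA (by simpa using heB)

variable (H)

lemma disjoint_openingEdges (A : Finset (Sym2 V)) (x : V) :
    Disjoint (openingEdges Γ H x (Γ.neighborFinset x \ closingNbrs Γ H A x)) A := by
  refine Finset.disjoint_left.2 fun e he heA => ?_
  obtain ⟨y, hy, w, hw, rfl⟩ := mem_pairEdges.1 he
  obtain ⟨hwx, hw_not⟩ := Finset.mem_sdiff.1 (Finset.mem_filter.1 hw).2
  exact hw_not ((mem_closingNbrs Γ H).2 ⟨hwx, y, hy, by simpa using heA⟩)

variable {Γ H}

-- Two sets of size more than `|V| / 2` intersect: the neighbours of `y`, and the shift preimage of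
-- the neighbours of `x` outside `Z`.
lemma mul_le_two_mul_card_openingEdges {m θ : ℕ}
    (hΓ : ∀ v, Fintype.card V + 2 * θ ≤ 2 * Γ.degree v) {x : V} {Z : Finset V}
    (hm : m ≤ (longestEnds H x).card) (hZ : Z.card < θ) :
    m * θ ≤ 2 * (openingEdges Γ H x (Γ.neighborFinset x \ Z)).card := by
  refine mul_le_two_mul_card_pairEdges hm fun y _ => ?_
  set M := (Γ.neighborFinset x \ Z).map ((shiftPerm H x y)⁻¹ : Equiv.Perm V).toEmbedding with hM
  have h_filter : (Γ.neighborFinset y).filter (fun w => shiftPerm H x y w ∈ Γ.neighborFinset x \ Z)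
      = Γ.neighborFinset y ∩ M := by
    ext w
    simp only [Finset.mem_filter, Finset.mem_inter, hM, Finset.mem_map_equiv]
    rfl
  have h_card : M.card = (Γ.neighborFinset x \ Z).card := Finset.card_map _
  have h_sdiff := Finset.le_card_sdiff Z (Γ.neighborFinset x)
  have h_union := Finset.card_union_add_card_inter (Γ.neighborFinset y) M
  have h_le : (Γ.neighborFinset y ∪ M).card ≤ Fintype.card V := Finset.card_le_univ _
  have hx := hΓ x
  have hy := hΓ y
  simp only [Γ.card_neighborFinset_eq_degree] at h_sdiff h_union
  rw [h_filter]
  omega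

lemma NoBooster.exists_openingEdges_or {m θ k : ℕ}
    (hΓ : ∀ v, Fintype.card V + 2 * θ ≤ 2 * Γ.degree v)
    (hends : ∀ x ∈ longestStarts H, m ≤ (longestEnds H x).card)
    (hk : 2 * (k + F.card) ≤ m * θ) (h : NoBooster H A B) :
    (∃ q : V × Finset V, k ≤ (openingEdges Γ H q.1 q.2 \ F).card ∧
        Disjoint (openingEdges Γ H q.1 q.2 \ F) A) ∨
      (∀ x ∈ longestStarts H, θ ≤ (closingNbrs Γ H A x).card) ∧
        Disjoint (closingEdges Γ H A) B := by
  by_cases hgood : ∀ x ∈ longestStarts H, θ ≤ (closingNbrs Γ H A x).card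
  · exact Or.inr ⟨hgood, h.disjoint_closingEdges Γ⟩
  · push Not at hgood
    obtain ⟨x, hx, hlt⟩ := hgood
    refine Or.inl ⟨(x, Γ.neighborFinset x \ closingNbrs Γ H A x), ?_,
      (disjoint_openingEdges Γ H A x).mono_left Finset.sdiff_subset⟩
    have h_card := mul_le_two_mul_card_openingEdges hΓ (hends x hx) hlt
    have h_sdiff := Finset.le_card_sdiff F
      (openingEdges Γ H x (Γ.neighborFinset x \ closingNbrs Γ H A x))
    dsimp only
    omega

variable {a b : ℝ}

lemma bprob₂_openingEdges_le (ha0 : 0 ≤ a) (ha1 : a ≤ 1) (hb0 : 0 ≤ b) (hb1 : b ≤ 1)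
    (hF : F ⊆ Γ.edgeFinset) (k : ℕ) (q : V × Finset V) :
    bprob₂ Γ.edgeFinset a b (fun A B => F ⊆ A ∪ B ∧ k ≤ (openingEdges Γ H q.1 q.2 \ F).card ∧
        Disjoint (openingEdges Γ H q.1 q.2 \ F) A) ≤ (a + b - a * b) ^ F.card * (1 - a) ^ k := by
  have hab : 0 ≤ a + b - a * b := by nlinarith
  have h1a : 0 ≤ 1 - a := by linarith
  by_cases hc : k ≤ (openingEdges Γ H q.1 q.2 \ F).card
  · calc _ ≤ bprob₂ Γ.edgeFinset a b
          (fun A B => F ⊆ A ∪ B ∧ Disjoint (openingEdges Γ H q.1 q.2 \ F) A) :=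
          bprob₂_mono ha0 ha1 hb0 hb1 fun A _ B _ h => ⟨h.1, h.2.2⟩
      _ = _ := bprob₂_subset_union_and_disjoint hF
          (Finset.sdiff_subset.trans (openingEdges_subset Γ H _ _)) Finset.disjoint_sdiff a b
      _ ≤ _ := mul_le_mul_of_nonneg_left (pow_le_pow_of_le_one h1a (by linarith) hc) (by positivity)
  · rw [bprob₂_eq_zero fun A _ B _ h => hc h.2.1]
    positivity

lemma bprob₂_closingEdges_le (ha0 : 0 ≤ a) (ha1 : a ≤ 1) (hb0 : 0 ≤ b) (hb1 : b ≤ 1) {m θ k : ℕ}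
    (hF : F ⊆ Γ.edgeFinset) (hm : m ≤ (longestStarts H).card) (hk : 2 * (k + F.card) ≤ m * θ) :
    bprob₂ Γ.edgeFinset a b (fun A B => F ⊆ A ∪ B ∧
        (∀ x ∈ longestStarts H, θ ≤ (closingNbrs Γ H A x).card) ∧ Disjoint (closingEdges Γ H A) B) ≤
      (a + b - a * b) ^ F.card * (1 - b) ^ k := by
  refine bprob₂_subset_union_and_disjoint_le hF ha0 ha1 hb0 hb1 _
    (fun A _ => closingEdges_subset Γ H A) _ fun A _ hgood => ?_
  have h_card : m * θ ≤ 2 * (closingEdges Γ H A).card := mul_le_two_mul_card_pairEdges hm hgood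
  have h_sdiff := Finset.le_card_sdiff F (closingEdges Γ H A)
  omega

lemma bprob₂_noBooster_le (ha0 : 0 ≤ a) (ha1 : a ≤ 1) (hb0 : 0 ≤ b) (hb1 : b ≤ 1) {m θ k : ℕ}
    (hΓ : ∀ v, Fintype.card V + 2 * θ ≤ 2 * Γ.degree v) (hstarts : m ≤ (longestStarts H).card)
    (hends : ∀ x ∈ longestStarts H, m ≤ (longestEnds H x).card)
    (hF : F ⊆ Γ.edgeFinset) (hk : 2 * (k + F.card) ≤ m * θ) :
    bprob₂ Γ.edgeFinset a b (fun A B => F ⊆ A ∪ B ∧ NoBooster H A B) ≤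
      (a + b - a * b) ^ F.card *
        (Fintype.card V * 2 ^ Fintype.card V * (1 - a) ^ k + (1 - b) ^ k) := by
  calc _ ≤ bprob₂ Γ.edgeFinset a b (fun A B => (∃ q ∈ (Finset.univ : Finset (V × Finset V)),
          F ⊆ A ∪ B ∧ k ≤ (openingEdges Γ H q.1 q.2 \ F).card ∧
            Disjoint (openingEdges Γ H q.1 q.2 \ F) A) ∨
          (F ⊆ A ∪ B ∧ (∀ x ∈ longestStarts H, θ ≤ (closingNbrs Γ H A x).card) ∧
            Disjoint (closingEdges Γ H A) B)) := by
        refine bprob₂_mono ha0 ha1 hb0 hb1 fun A _ B _ h => ?_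
        refine (h.2.exists_openingEdges_or hΓ hends hk).imp ?_ fun h' => ⟨h.1, h'⟩
        exact fun ⟨q, hq⟩ => ⟨q, Finset.mem_univ _, h.1, hq⟩
    _ ≤ ∑ q : V × Finset V, (a + b - a * b) ^ F.card * (1 - a) ^ k +
          (a + b - a * b) ^ F.card * (1 - b) ^ k :=
        (bprob₂_or_le ha0 ha1 hb0 hb1 _ _).trans <| add_le_add
          ((bprob₂_exists_le ha0 ha1 hb0 hb1 _ _).trans (Finset.sum_le_sum fun q _ =>
            bprob₂_openingEdges_le ha0 ha1 hb0 hb1 hF k q))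
          (bprob₂_closingEdges_le ha0 ha1 hb0 hb1 hF hstarts hk)
    _ = _ := by
        rw [Finset.sum_const, Finset.card_univ, Fintype.card_prod, Fintype.card_finset,
          nsmul_eq_mul]
        push_cast
        ring

end BoosterEdges

lemma sum_pow_card_powerset {ι : Type*} (E : Finset ι) (x : ℝ) :
    ∑ F ∈ E.powerset, x ^ F.card = (1 + x) ^ E.card := by
  simpa [add_comm] using Finset.sum_pow_mul_eq_add_pow x 1 E

/-- Some set `F` of at most `K` edges of `A ∪ B` is such that `R ∪ F` has at least `m` starts of
longest paths, each with at least `m` ends, but no booster. -/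
def HasSparseNoBooster (R A B : Finset (Sym2 V)) (K m : ℕ) : Prop :=
  ∃ F, F ⊆ A ∪ B ∧ F.card ≤ K ∧ m ≤ (longestStarts (edgeGraph (R ∪ F))).card ∧
    (∀ x ∈ longestStarts (edgeGraph (R ∪ F)), m ≤ (longestEnds (edgeGraph (R ∪ F)) x).card) ∧
      NoBooster (edgeGraph (R ∪ F)) A B

lemma bprob₂_hasSparseNoBooster_le (Γ : SimpleGraph V) [DecidableRel Γ.Adj] {a b : ℝ}
    (ha0 : 0 ≤ a) (ha1 : a ≤ 1) (hb0 : 0 ≤ b) (hb1 : b ≤ 1) {m θ k K : ℕ}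
    (hΓ : ∀ v, Fintype.card V + 2 * θ ≤ 2 * Γ.degree v) (R : Finset (Sym2 V))
    (hk : 2 * (k + K) ≤ m * θ) {lam : ℝ} (hlam0 : 0 < lam) (hlam1 : lam ≤ 1) :
    bprob₂ Γ.edgeFinset a b (fun A B => HasSparseNoBooster R A B K m) ≤
    lam⁻¹ ^ K * (1 + lam * (a + b - a * b)) ^ Γ.edgeFinset.card *
        (Fintype.card V * 2 ^ Fintype.card V * (1 - a) ^ k + (1 - b) ^ k) := by
  have hab : 0 ≤ a + b - a * b := by nlinarith
  set ψ : ℝ := Fintype.card V * 2 ^ Fintype.card V * (1 - a) ^ k + (1 - b) ^ k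
  have hψ0 : 0 ≤ ψ := add_nonneg (mul_nonneg (by positivity) (pow_nonneg (by linarith) k))
    (pow_nonneg (by linarith) k)
  refine (bprob₂_mono (Q' := fun A B => ∃ F ∈ Γ.edgeFinset.powerset, F ⊆ A ∪ B ∧ F.card ≤ K ∧ _)
    ha0 ha1 hb0 hb1 fun A hA B hB ⟨F, hF, h⟩ =>
      ⟨F, Finset.mem_powerset.2 (hF.trans (Finset.union_subset hA hB)), hF, h⟩).trans
      ((bprob₂_exists_le ha0 ha1 hb0 hb1 _ _).trans ?_)
  rw [← sum_pow_card_powerset, Finset.mul_sum, Finset.sum_mul]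
  refine Finset.sum_le_sum fun F hF => ?_
  by_cases hc : F.card ≤ K ∧ m ≤ (longestStarts (edgeGraph (R ∪ F))).card ∧
      ∀ x ∈ longestStarts (edgeGraph (R ∪ F)), m ≤ (longestEnds (edgeGraph (R ∪ F)) x).card
  · obtain ⟨hFK, hstarts, hends⟩ := hc
    calc _ ≤ bprob₂ Γ.edgeFinset a b (fun A B => F ⊆ A ∪ B ∧ NoBooster (edgeGraph (R ∪ F)) A B) :=
          bprob₂_mono ha0 ha1 hb0 hb1 fun A _ B _ h => ⟨h.1, h.2.2.2.2⟩
      _ ≤ (a + b - a * b) ^ F.card * ψ :=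
          bprob₂_noBooster_le ha0 ha1 hb0 hb1 hΓ hstarts hends (Finset.mem_powerset.1 hF) (by omega)
      _ ≤ _ := by
          refine mul_le_mul_of_nonneg_right ?_ hψ0
          rw [mul_pow, ← mul_assoc]
          exact le_mul_of_one_le_left (by positivity) (one_le_inv_pow_mul_pow hlam0 hlam1 hFK)
  · rw [bprob₂_eq_zero fun A _ B _ h => hc ⟨h.2.1, h.2.2.1, h.2.2.2.1⟩]
    positivity

end Booster

section RareEvents

variable {V : Type*} [DecidableEq V]

lemma bprob_hasLargeCodegree_le [Fintype V] {p : ℝ} (hp0 : 0 ≤ p) (hp1 : p ≤ 1)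
    (E : Finset (Sym2 V)) : bprob E p HasLargeCodegree ≤ Fintype.card V ^ 5 * p ^ 6 := by
  set s := ((Finset.univ : Finset V).powersetCard 2 ×ˢ
    (Finset.univ : Finset V).powersetCard 3).filter fun k => Disjoint k.1 k.2 with hs
  have hs_card : s.card ≤ Fintype.card V ^ 5 := calc
    s.card ≤ (Fintype.card V).choose 2 * (Fintype.card V).choose 3 :=
      (Finset.card_filter_le _ _).trans (by simp)
    _ ≤ Fintype.card V ^ 2 * Fintype.card V ^ 3 :=
      Nat.mul_le_mul (Nat.choose_le_pow _ _) (Nat.choose_le_pow _ _)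
    _ = Fintype.card V ^ 5 := by ring
  calc bprob E p HasLargeCodegree
      ≤ bprob E p fun F => ∃ k ∈ s, (pairEdges k.1 fun _ => k.2) ⊆ F := by
        refine bprob_mono hp0 hp1 fun F _ ⟨u, v, huv, h⟩ => ?_
        obtain ⟨Y, hY, hY_card⟩ := Finset.exists_subset_card_eq h
        have h_adj : ∀ y ∈ Y, (edgeGraph F).Adj u y ∧ (edgeGraph F).Adj v y := fun y hy => by
          simpa only [Finset.mem_inter, mem_nbr] using hY hy
        refine ⟨({u, v}, Y), ?_, fun e he => ?_⟩
        · have hu : u ∉ Y := fun hu => (h_adj u hu).1.ne rfl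
          have hv : v ∉ Y := fun hv => (h_adj v hv).2.ne rfl
          simp [hs, Finset.mem_powersetCard, huv, hY_card, hu, hv]
        · obtain ⟨x, hx, y, hy, rfl⟩ := mem_pairEdges.1 he
          rcases Finset.mem_insert.1 hx with rfl | hx
          · exact ((SimpleGraph.fromEdgeSet_adj _).1 (h_adj y hy).1).1
          · rw [Finset.mem_singleton.1 hx]
            exact ((SimpleGraph.fromEdgeSet_adj _).1 (h_adj y hy).2).1
    _ ≤ ∑ k ∈ s, bprob E p fun F => (pairEdges k.1 fun _ => k.2) ⊆ F :=
        bprob_exists_le hp0 hp1 s _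
    _ ≤ s.card • p ^ 6 := by
        refine Finset.sum_le_card_nsmul _ _ _ fun k hk => ?_
        simp only [hs, Finset.mem_filter, Finset.mem_product, Finset.mem_powersetCard] at hk
        have h_card : (pairEdges k.1 fun _ => k.2).card = 6 := by
          rw [card_pairEdges_of_disjoint hk.2, hk.1.1.2, hk.1.2.2]
        exact h_card ▸ bprob_subset_le hp0 E _
    _ ≤ Fintype.card V ^ 5 * p ^ 6 := by
        rw [nsmul_eq_mul]
        gcongr
        exact_mod_cast hs_card

section DenseSet

variable {p P : ℝ}

-- The exponential weight per edge in the Chernoff bound is `(P * |S|)⁻¹`.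
lemma bprob_two_mul_card_le_card_inter_sym2_le (hp0 : 0 ≤ p) (hp1 : p ≤ 1) (hpP : p ≤ P)
    (hP0 : 0 < P) (E : Finset (Sym2 V)) {S : Finset V} (hS : S.Nonempty) (hPS : P * S.card ≤ 1) :
    bprob E p (fun F => 2 * S.card ≤ (F ∩ S.sym2).card) ≤
      (P * S.card) ^ (2 * S.card) * Real.exp S.card := by
  have : (0 : ℝ) < S.card := by exact_mod_cast hS.card_pos
  set I := E ∩ S.sym2 with hI
  set x := (P * S.card)⁻¹ with hx
  have hx1 : 1 ≤ x := (one_le_inv₀ (by positivity)).2 hPS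
  have hI_card : (I.card : ℝ) ≤ (S.card : ℝ) ^ 2 := by
    have h_sym2 : S.sym2.card ≤ S.card ^ 2 := by
      rw [Finset.card_sym2, Nat.choose_two_right, Nat.add_sub_cancel]
      exact Nat.div_le_of_le_mul (by nlinarith [hS.card_pos])
    exact_mod_cast (Finset.card_le_card Finset.inter_subset_right).trans h_sym2
  calc bprob E p (fun F => 2 * S.card ≤ (F ∩ S.sym2).card)
      ≤ bprob E p fun F => 2 * S.card ≤ (F ∩ I).card :=
        bprob_mono hp0 hp1 fun F hF h => by
          rwa [hI, ← Finset.inter_assoc, Finset.inter_eq_left.2 hF]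
    _ ≤ x⁻¹ ^ (2 * S.card) * (1 - p + p * x) ^ I.card :=
        bprob_le_card_inter Finset.inter_subset_left hp0 hp1 hx1 _
    _ ≤ x⁻¹ ^ (2 * S.card) * Real.exp (p * x) ^ I.card := by
        have h_exp := Real.add_one_le_exp (p * x)
        have : 0 ≤ p * x := by positivity
        gcongr
        linarith
    _ ≤ (P * S.card) ^ (2 * S.card) * Real.exp S.card := by
        rw [hx, inv_inv, ← Real.exp_nat_mul]
        gcongr
        calc (I.card : ℝ) * (p * (P * S.card)⁻¹) ≤ (S.card : ℝ) ^ 2 * (P * (P * S.card)⁻¹) := by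
              gcongr
          _ = S.card := by field_simp

lemma choose_le_exp_mul_pow {n t : ℕ} (ht : 0 < t) :
    (n.choose t : ℝ) ≤ (Real.exp 1 * n / t) ^ t := by
  have ht0 : (0 : ℝ) < t := by exact_mod_cast ht
  have : (0 : ℝ) < t.factorial := by exact_mod_cast t.factorial_pos
  calc (n.choose t : ℝ) ≤ (n : ℝ) ^ t / (t.factorial : ℝ) := Nat.choose_le_pow_div t n
    _ = (n / t : ℝ) ^ t * ((t : ℝ) ^ t / t.factorial) := by
        rw [div_pow]
        field_simp
    _ ≤ (n / t : ℝ) ^ t * Real.exp t := by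
        gcongr
        exact Real.pow_div_factorial_le_exp _ ht0.le t
    _ = (Real.exp 1 * n / t) ^ t := by
        rw [← mul_one (t : ℝ), Real.exp_nat_mul, ← mul_pow, mul_one]
        ring

lemma choose_mul_pow_mul_exp_le (hP0 : 0 < P) {n t : ℕ} (ht : 0 < t) :
    n.choose t * ((P * t) ^ (2 * t) * Real.exp t) ≤ (Real.exp 2 * n * t * P ^ 2) ^ t := by
  have : (0 : ℝ) < t := by exact_mod_cast ht
  calc n.choose t * ((P * t) ^ (2 * t) * Real.exp t)
      ≤ (Real.exp 1 * n / t) ^ t * ((P * t) ^ (2 * t) * Real.exp t) := by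
        gcongr
        exact choose_le_exp_mul_pow ht
    _ = (Real.exp 1 * n / t * ((P * t) ^ 2 * Real.exp 1)) ^ t := by
        rw [pow_mul, mul_pow (_ / _), mul_pow (_ ^ 2), ← Real.exp_nat_mul, mul_one]
    _ = (Real.exp 2 * n * t * P ^ 2) ^ t := by
        have h_exp : Real.exp 2 = Real.exp 1 * Real.exp 1 := by rw [← Real.exp_add]; norm_num
        rw [h_exp]
        congr 1
        field_simp

lemma bprob_hasDenseSet_le [Fintype V] (hp0 : 0 ≤ p) (hp1 : p ≤ 1) (hpP : p ≤ P) (hP0 : 0 < P)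
    (E : Finset (Sym2 V)) {k : ℕ} (hPk : P * k ≤ 1) {r : ℝ}
    (hr : Real.exp 2 * Fintype.card V * k * P ^ 2 ≤ r) (hr1 : r ≤ 1 / 2) :
    bprob E p (fun F => HasDenseSet F k) ≤ 2 * r := by
  have hr0 : 0 ≤ r := le_trans (by positivity) hr
  calc bprob E p (fun F => HasDenseSet F k)
      ≤ bprob E p fun F => ∃ t ∈ Finset.Ico 1 (k + 1), ∃ S ∈ Finset.univ.powersetCard t,
          2 * S.card ≤ (F ∩ S.sym2).card :=
        bprob_mono hp0 hp1 fun F _ ⟨S, hS, hSk, h⟩ => ⟨S.card,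
          Finset.mem_Ico.2 ⟨hS.card_pos, Nat.lt_succ_of_le hSk⟩, S, by simp, h⟩
    _ ≤ ∑ t ∈ Finset.Ico 1 (k + 1), ∑ S ∈ Finset.univ.powersetCard t,
          bprob E p fun F => 2 * S.card ≤ (F ∩ S.sym2).card :=
        (bprob_exists_le hp0 hp1 _ _).trans
          (Finset.sum_le_sum fun t _ => bprob_exists_le hp0 hp1 _ _)
    _ ≤ ∑ t ∈ Finset.Ico 1 (k + 1), r ^ t := by
        refine Finset.sum_le_sum fun t ht => ?_
        rw [Finset.mem_Ico, Nat.lt_succ_iff] at ht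
        have htk : (t : ℝ) ≤ k := by exact_mod_cast ht.2
        calc _ ≤ (Finset.univ.powersetCard t : Finset (Finset V)).card •
                ((P * t) ^ (2 * t) * Real.exp t) := by
              refine Finset.sum_le_card_nsmul _ _ _ fun S hS => ?_
              obtain rfl := (Finset.mem_powersetCard.1 hS).2
              exact bprob_two_mul_card_le_card_inter_sym2_le hp0 hp1 hpP hP0 E
                (Finset.card_pos.1 ht.1) (le_trans (by gcongr) hPk)
          _ ≤ (Real.exp 2 * Fintype.card V * t * P ^ 2) ^ t := by
              rw [nsmul_eq_mul, Finset.card_powersetCard, Finset.card_univ]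
              exact choose_mul_pow_mul_exp_le hP0 ht.1
          _ ≤ r ^ t := pow_le_pow_left₀ (by positivity) (le_trans (by gcongr) hr) t
    _ ≤ r ^ 1 / (1 - r) := geom_sum_Ico_le_of_lt_one hr0 (by linarith)
    _ ≤ 2 * r := by
        rw [pow_one, div_le_iff₀ (by linarith)]
        nlinarith

end DenseSet

section LeavingEdges

variable [Fintype V] {Γ : SimpleGraph V} [DecidableRel Γ.Adj] {p : ℝ}

lemma one_sub_pow_le_exp (hp0 : 0 ≤ p) (hp1 : p ≤ 1) {x : ℝ} {k : ℕ} (hx : x ≤ k) :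
    (1 - p) ^ k ≤ Real.exp (-(p * x)) := by
  calc (1 - p) ^ k ≤ Real.exp (-p) ^ k :=
        pow_le_pow_left₀ (by linarith) (Real.one_sub_le_exp_neg p) k
    _ = Real.exp (-(p * k)) := by rw [← Real.exp_nat_mul]; ring_nf
    _ ≤ Real.exp (-(p * x)) := by gcongr

lemma bprob_forall_notMem_le (hp0 : 0 ≤ p) (hp1 : p ≤ 1) {S U : Finset V} {m d : ℕ}
    (hm : m ≤ S.card) (hd : ∀ u ∈ S, d + U.card ≤ Γ.degree u) :
    bprob Γ.edgeFinset p (fun F => ∀ u ∈ S, ∀ v, v ∉ U → s(u, v) ∉ F) ≤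
      Real.exp (-(p * (m * d / 2))) := by
  set W := pairEdges S fun u => Γ.neighborFinset u \ U
  have hW_card : m * d ≤ 2 * W.card := by
    refine mul_le_two_mul_card_pairEdges hm fun u hu => ?_
    have h_sdiff := Finset.le_card_sdiff U (Γ.neighborFinset u)
    rw [Γ.card_neighborFinset_eq_degree] at h_sdiff
    have := hd u hu
    omega
  have hW_cast : (m * d : ℝ) ≤ 2 * W.card := by exact_mod_cast hW_card
  calc bprob Γ.edgeFinset p (fun F => ∀ u ∈ S, ∀ v, v ∉ U → s(u, v) ∉ F)
      ≤ bprob Γ.edgeFinset p fun F => Disjoint W F :=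
        bprob_mono hp0 hp1 fun F _ h => Finset.disjoint_left.2 fun e he heF => by
          obtain ⟨u, hu, v, hv, rfl⟩ := mem_pairEdges.1 he
          exact h u hu v (Finset.mem_sdiff.1 hv).2 heF
    _ = (1 - p) ^ W.card :=
        bprob_disjoint (pairEdges_subset_edgeFinset Γ fun _ _ => Finset.sdiff_subset) p
    _ ≤ Real.exp (-(p * (m * d / 2))) := one_sub_pow_le_exp hp0 hp1 (by linarith)

lemma bprob_hasEmptyCut_le (hp0 : 0 ≤ p) (hp1 : p ≤ 1) {θ : ℕ}
    (hΓ : ∀ v, Fintype.card V + 2 * θ ≤ 2 * Γ.degree v) (m : ℕ) :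
    bprob Γ.edgeFinset p (fun F => HasEmptyCut F m) ≤
      2 ^ Fintype.card V * Real.exp (-(p * (m * θ / 2))) := by
  set s := (Finset.univ : Finset (Finset V)).filter fun C =>
    m < C.card ∧ 2 * C.card ≤ Fintype.card V with hs
  calc bprob Γ.edgeFinset p (fun F => HasEmptyCut F m)
      ≤ bprob Γ.edgeFinset p fun F => ∃ C ∈ s, ∀ u ∈ C, ∀ v, v ∉ C → s(u, v) ∉ F :=
        bprob_mono hp0 hp1 fun F _ ⟨C, hC, h⟩ => ⟨C, by simpa [hs] using hC, h⟩
    _ ≤ ∑ C ∈ s, bprob Γ.edgeFinset p fun F => ∀ u ∈ C, ∀ v, v ∉ C → s(u, v) ∉ F :=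
        bprob_exists_le hp0 hp1 s _
    _ ≤ s.card • Real.exp (-(p * (m * θ / 2))) := by
        refine Finset.sum_le_card_nsmul _ _ _ fun C hC => ?_
        obtain ⟨hm, hC⟩ := (Finset.mem_filter.1 hC).2
        refine bprob_forall_notMem_le hp0 hp1 hm.le fun u _ => ?_
        have := hΓ u
        omega
    _ ≤ 2 ^ Fintype.card V * Real.exp (-(p * (m * θ / 2))) := by
        rw [nsmul_eq_mul]
        gcongr
        exact_mod_cast s.card_le_univ.trans_eq Fintype.card_finset

lemma bprob_forall_notMem_union_le (hp0 : 0 ≤ p) (hp1 : p ≤ 1) {δ : ℕ}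
    (hδ : ∀ v, δ ≤ Γ.degree v) {S T : Finset V} (hS : 14 * S.card ≤ δ)
    (hT : T.card ≤ 6 * S.card) :
    bprob Γ.edgeFinset p (fun F => ∀ u ∈ S, ∀ v, v ∉ S → v ∉ T → s(u, v) ∉ F) ≤
      Real.exp (-(p * (δ / 4))) ^ S.card := by
  calc bprob Γ.edgeFinset p (fun F => ∀ u ∈ S, ∀ v, v ∉ S → v ∉ T → s(u, v) ∉ F)
      ≤ bprob Γ.edgeFinset p fun F => ∀ u ∈ S, ∀ v, v ∉ S ∪ T → s(u, v) ∉ F :=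
        bprob_mono hp0 hp1 fun F _ h u hu v hv => by
          rw [Finset.mem_union, not_or] at hv
          exact h u hu v hv.1 hv.2
    _ ≤ Real.exp (-(p * (S.card * (δ - 7 * S.card : ℕ) / 2))) :=
        bprob_forall_notMem_le hp0 hp1 le_rfl fun u _ => by
          have := hδ u
          have := Finset.card_union_le S T
          omega
    _ ≤ Real.exp (S.card * -(p * (δ / 4))) := by
        have h_half : (δ : ℝ) ≤ 2 * (δ - 7 * S.card : ℕ) := by
          exact_mod_cast (by omega : δ ≤ 2 * (δ - 7 * S.card))
        have := mul_le_mul_of_nonneg_left h_half (mul_nonneg hp0 (Nat.cast_nonneg S.card))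
        refine Real.exp_le_exp.2 ?_
        linarith
    _ = Real.exp (-(p * (δ / 4))) ^ S.card := Real.exp_nat_mul _ _

lemma sum_pow_card_mul_pow_card_le (V : Type*) [Fintype V] {x y : ℝ} (hx : 0 ≤ x) (hy : 0 ≤ y) :
    ∑ k : Finset V × Finset V, x ^ k.1.card * y ^ k.2.card ≤
      Real.exp (Fintype.card V * (x + y)) :=
  calc ∑ k : Finset V × Finset V, x ^ k.1.card * y ^ k.2.card
      = (1 + x) ^ Fintype.card V * (1 + y) ^ Fintype.card V := by
        rw [← Finset.card_univ, ← sum_pow_card_powerset, ← sum_pow_card_powerset,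
          Finset.powerset_univ, Finset.sum_mul_sum, Fintype.sum_prod_type]
    _ ≤ Real.exp x ^ Fintype.card V * Real.exp y ^ Fintype.card V := by
        gcongr
        · exact (add_comm _ _).trans_le (Real.add_one_le_exp x)
        · exact (add_comm _ _).trans_le (Real.add_one_le_exp y)
    _ = Real.exp (Fintype.card V * (x + y)) := by
        rw [← Real.exp_nat_mul, ← Real.exp_nat_mul, ← Real.exp_add, mul_add]

-- The weights `exp (3 * (|S| - s))` and `μ ^ (|T| - 6 * |S|)`, both at least `1`, turn the union
-- bound over the pairs `(S, T)` into a product of two binomial sums.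
lemma bprob_hasTrappedSet_le (hp0 : 0 ≤ p) (hp1 : p ≤ 1) {δ : ℕ} (hδ : ∀ v, δ ≤ Γ.degree v)
    (s : ℕ) {m : ℕ} (hm : 14 * m ≤ δ) {μ : ℝ} (hμ0 : 0 < μ) (hμ1 : μ ≤ 1) :
    bprob Γ.edgeFinset p (fun F => HasTrappedSet F s m) ≤
      Real.exp (Fintype.card V * μ +
        Fintype.card V * (Real.exp (-(p * (δ / 4))) * μ⁻¹ ^ 6 * Real.exp 3) - 3 * s) := by
  set x := Real.exp (-(p * (δ / 4)))
  set y := x * μ⁻¹ ^ 6 * Real.exp 3 with hy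
  have : 0 ≤ y := by positivity
  set I := (Finset.univ : Finset (Finset V × Finset V)).filter fun k =>
    s < k.1.card ∧ k.1.card ≤ m ∧ k.2.card ≤ 6 * k.1.card with hI
  have h_term : ∀ k ∈ I, x ^ k.1.card ≤ Real.exp (-(3 * s)) * (y ^ k.1.card * μ ^ k.2.card) := by
    intro k hk
    obtain ⟨hs, -, hT⟩ := (Finset.mem_filter.1 hk).2
    have h_exp : 1 ≤ Real.exp (-(3 * s)) * Real.exp 3 ^ k.1.card := by
      rw [← Real.exp_nat_mul, ← Real.exp_add, Real.one_le_exp_iff]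
      have : (s : ℝ) ≤ k.1.card := by exact_mod_cast hs.le
      linarith
    calc x ^ k.1.card ≤ x ^ k.1.card * ((Real.exp (-(3 * s)) * Real.exp 3 ^ k.1.card) *
          (μ⁻¹ ^ (6 * k.1.card) * μ ^ k.2.card)) :=
          le_mul_of_one_le_right (by positivity)
            (one_le_mul_of_one_le_of_one_le h_exp (one_le_inv_pow_mul_pow hμ0 hμ1 hT))
      _ = Real.exp (-(3 * s)) * (y ^ k.1.card * μ ^ k.2.card) := by
          rw [hy, mul_pow, mul_pow, pow_mul]
          ring
  calc bprob Γ.edgeFinset p (fun F => HasTrappedSet F s m)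
      ≤ bprob Γ.edgeFinset p fun F =>
          ∃ k ∈ I, ∀ u ∈ k.1, ∀ v, v ∉ k.1 → v ∉ k.2 → s(u, v) ∉ F :=
        bprob_mono hp0 hp1 fun F _ ⟨S, T, hST, h⟩ => ⟨(S, T), by simpa [hI] using hST, h⟩
    _ ≤ ∑ k ∈ I, x ^ k.1.card := by
        refine (bprob_exists_le hp0 hp1 I _).trans (Finset.sum_le_sum fun k hk => ?_)
        obtain ⟨-, hS, hT⟩ := (Finset.mem_filter.1 hk).2
        exact bprob_forall_notMem_union_le hp0 hp1 hδ (by omega) hT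
    _ ≤ ∑ k : Finset V × Finset V, Real.exp (-(3 * s)) * (y ^ k.1.card * μ ^ k.2.card) :=
        (Finset.sum_le_sum h_term).trans
          (Finset.sum_le_univ_sum_of_nonneg fun k => by positivity)
    _ ≤ Real.exp (-(3 * s)) * Real.exp (Fintype.card V * (y + μ)) := by
        rw [← Finset.mul_sum]
        gcongr
        exact sum_pow_card_mul_pow_card_le V ‹_› hμ0.le
    _ = Real.exp (Fintype.card V * μ + Fintype.card V * y - 3 * s) := by
        rw [← Real.exp_add]
        ring_nf

end LeavingEdges

section SmallVertices

variable [Fintype V] {Γ : SimpleGraph V} [DecidableRel Γ.Adj] {p q lam : ℝ} {δ : ℕ}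

lemma card_filter_mem_edgeFinset (Γ : SimpleGraph V) [DecidableRel Γ.Adj] (v : V) :
    (Γ.edgeFinset.filter (v ∈ ·)).card = Γ.degree v := by
  rw [← Γ.card_incidenceFinset_eq_degree, Γ.incidenceFinset_eq_filter]

lemma two_mul_sub_one_le_card_filter_union (hδ : ∀ v, δ ≤ Γ.degree v) {u v : V} (huv : u ≠ v) :
    2 * δ - 1 ≤ (Γ.edgeFinset.filter (u ∈ ·) ∪ Γ.edgeFinset.filter (v ∈ ·)).card := by
  have h_union := Finset.card_union_add_card_inter (Γ.edgeFinset.filter (u ∈ ·))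
    (Γ.edgeFinset.filter (v ∈ ·))
  have h_inter : (Γ.edgeFinset.filter (u ∈ ·) ∩ Γ.edgeFinset.filter (v ∈ ·)).card ≤ 1 := by
    refine (Finset.card_le_card (t := {s(u, v)}) fun e he => ?_).trans_eq (Finset.card_singleton _)
    simp only [Finset.mem_inter, Finset.mem_filter] at he
    exact Finset.mem_singleton.2 ((Sym2.mem_and_mem_iff huv).1 ⟨he.1.2, he.2.2⟩)
  rw [card_filter_mem_edgeFinset, card_filter_mem_edgeFinset] at h_union
  have := hδ u
  have := hδ v
  omega

lemma bprob_isSmall_le (hp0 : 0 ≤ p) (hp1 : p ≤ 1) (hlam0 : 0 < lam) (hlam1 : lam ≤ 1)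
    (hδ : ∀ v, δ ≤ Γ.degree v) (v : V) :
    bprob Γ.edgeFinset p (fun R => IsSmall R v) ≤ lam⁻¹ ^ 28 * (1 - p + p * lam) ^ δ := by
  calc bprob Γ.edgeFinset p (fun R => IsSmall R v)
      ≤ bprob Γ.edgeFinset p fun R => (R ∩ Γ.edgeFinset.filter (v ∈ ·)).card ≤ 28 :=
        bprob_mono hp0 hp1 fun R hR h => by
          rw [Finset.inter_filter, Finset.inter_eq_left.2 hR]
          exact le_of_lt h
    _ ≤ lam⁻¹ ^ 28 * (1 - p + p * lam) ^ Γ.degree v := by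
        rw [← card_filter_mem_edgeFinset]
        exact bprob_card_inter_le (Finset.filter_subset _ _) hp0 hp1 hlam0 hlam1 28
    _ ≤ lam⁻¹ ^ 28 * (1 - p + p * lam) ^ δ := by
        refine mul_le_mul_of_nonneg_left ?_ (by positivity)
        exact pow_le_pow_of_le_one (by nlinarith) (by nlinarith) (hδ v)

lemma bprob₂_subset_union_and_isSmall_le (hp0 : 0 ≤ p) (hp1 : p ≤ 1) (hq0 : 0 ≤ q) (hq1 : q ≤ 1)
    (hlam0 : 0 < lam) (hlam1 : lam ≤ 1) (hδ : ∀ v, δ ≤ Γ.degree v) {u v : V} (huv : u ≠ v)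
    (A : Finset (Sym2 V)) :
    bprob₂ Γ.edgeFinset p q (fun R T => A ⊆ R ∪ T ∧ IsSmall R u ∧ IsSmall R v) ≤
      (p + q - p * q) ^ A.card * (lam⁻¹ ^ 56 * (1 - p + p * lam) ^ (2 * δ - 1 - A.card)) := by
  have h_base : 0 ≤ 1 - p + p * lam := by nlinarith
  have h_union : 0 ≤ p + q - p * q := by nlinarith
  by_cases hA : A ⊆ Γ.edgeFinset
  swap
  · rw [bprob₂_eq_zero fun R hR T hT h => hA (h.1.trans (Finset.union_subset hR hT))]
    positivity
  set I := Γ.edgeFinset.filter (u ∈ ·) ∪ Γ.edgeFinset.filter (v ∈ ·)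
  have hI : I \ A ⊆ Γ.edgeFinset := Finset.sdiff_subset.trans
    (Finset.union_subset (Finset.filter_subset _ _) (Finset.filter_subset _ _))
  have hI_card : 2 * δ - 1 - A.card ≤ (I \ A).card :=
    (Nat.sub_le_sub_right (two_mul_sub_one_le_card_filter_union hδ huv) _).trans
      (Finset.le_card_sdiff A I)
  have h_small (R : Finset (Sym2 V)) (hu : IsSmall R u) (hv : IsSmall R v) :
      (R ∩ (I \ A)).card ≤ 56 := by
    have h_sub : R ∩ (I \ A) ⊆ R.filter (u ∈ ·) ∪ R.filter (v ∈ ·) := by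
      intro e he
      simp only [I, Finset.mem_inter, Finset.mem_sdiff, Finset.mem_union, Finset.mem_filter] at he ⊢
      tauto
    have := (Finset.card_le_card h_sub).trans (Finset.card_union_le _ _)
    unfold IsSmall at hu hv
    omega
  calc bprob₂ Γ.edgeFinset p q (fun R T => A ⊆ R ∪ T ∧ IsSmall R u ∧ IsSmall R v)
      ≤ bprob₂ Γ.edgeFinset p q fun R T => A ⊆ R ∪ T ∧ (R ∩ (I \ A)).card ≤ 56 :=
        bprob₂_mono hp0 hp1 hq0 hq1 fun R _ T _ h => ⟨h.1, h_small R h.2.1 h.2.2⟩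
    _ ≤ (p + q - p * q) ^ A.card * (lam⁻¹ ^ 56 * (1 - p + p * lam) ^ (I \ A).card) :=
        bprob₂_subset_union_and_card_inter_le hA hI Finset.disjoint_sdiff hp0 hp1 hq0 hlam0 hlam1 56
    _ ≤ _ := by
        have h_pow := pow_le_pow_of_le_one h_base (by nlinarith) hI_card
        gcongr

lemma bprob₂_pathEdges_isSmall_le (hp0 : 0 ≤ p) (hp1 : p ≤ 1) (hq0 : 0 ≤ q) (hq1 : q ≤ 1)
    (hlam0 : 0 < lam) (hlam1 : lam ≤ 1) (hδ : ∀ v, δ ≤ Γ.degree v) {j : ℕ} (hj : 1 ≤ j) :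
    bprob₂ Γ.edgeFinset p q (fun R T => ∃ f : Fin (j + 1) → V, f.Injective ∧
      pathEdges f ⊆ R ∪ T ∧ IsSmall R (f 0) ∧ IsSmall R (f (Fin.last j))) ≤
      Fintype.card V ^ (j + 1) * ((p + q - p * q) ^ j *
        (lam⁻¹ ^ 56 * (1 - p + p * lam) ^ (2 * δ - 1 - j))) := by
  have : 0 ≤ 1 - p + p * lam := by nlinarith
  have : 0 ≤ p + q - p * q := by nlinarith
  set s := (Finset.univ : Finset (Fin (j + 1) → V)).filter Function.Injective with hs
  have hs_card : s.card ≤ Fintype.card V ^ (j + 1) := s.card_le_univ.trans_eq (by simp)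
  calc _ ≤ bprob₂ Γ.edgeFinset p q fun R T => ∃ f ∈ s,
          pathEdges f ⊆ R ∪ T ∧ IsSmall R (f 0) ∧ IsSmall R (f (Fin.last j)) :=
        bprob₂_mono hp0 hp1 hq0 hq1 fun R _ T _ ⟨f, hf, h⟩ => ⟨f, by simpa [hs] using hf, h⟩
    _ ≤ ∑ f ∈ s, bprob₂ Γ.edgeFinset p q fun R T =>
          pathEdges f ⊆ R ∪ T ∧ IsSmall R (f 0) ∧ IsSmall R (f (Fin.last j)) :=
        bprob₂_exists_le hp0 hp1 hq0 hq1 s _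
    _ ≤ s.card • ((p + q - p * q) ^ j * (lam⁻¹ ^ 56 * (1 - p + p * lam) ^ (2 * δ - 1 - j))) := by
        refine Finset.sum_le_card_nsmul _ _ _ fun f hf => ?_
        have hf : f.Injective := (Finset.mem_filter.1 hf).2
        have h_ends : f 0 ≠ f (Fin.last j) := hf.ne (Fin.ne_of_val_ne (by simp; omega))
        simpa only [card_pathEdges hf] using
          bprob₂_subset_union_and_isSmall_le hp0 hp1 hq0 hq1 hlam0 hlam1 hδ h_ends (pathEdges f)
    _ ≤ _ := by
        rw [nsmul_eq_mul]
        gcongr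
        exact_mod_cast hs_card

lemma bprob₂_hasCloseSmallPair_le (hp0 : 0 ≤ p) (hp1 : p ≤ 1) (hq0 : 0 ≤ q) (hq1 : q ≤ 1)
    (hlam0 : 0 < lam) (hlam1 : lam ≤ 1) (hδ : ∀ v, δ ≤ Γ.degree v) (r : ℕ) :
    bprob₂ Γ.edgeFinset p q (fun R T => HasCloseSmallPair R T r) ≤
      ∑ j ∈ Finset.Icc 1 r, Fintype.card V ^ (j + 1) * ((p + q - p * q) ^ j *
        (lam⁻¹ ^ 56 * (1 - p + p * lam) ^ (2 * δ - 1 - j))) :=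
  (bprob₂_exists_le hp0 hp1 hq0 hq1 _ _).trans (Finset.sum_le_sum fun _ hj =>
    bprob₂_pathEdges_isSmall_le hp0 hp1 hq0 hq1 hlam0 hlam1 hδ (Finset.mem_Icc.1 hj).1)

open Classical in
lemma card_smallEdges_le (R T : Finset (Sym2 V)) :
    (smallEdges R T).card ≤ ∑ v with IsSmall R v, (T.filter (v ∈ ·)).card := by
  refine (Finset.card_le_card fun e he => ?_).trans Finset.card_biUnion_le
  obtain ⟨heT, v, hv, hsmall⟩ := mem_smallEdges.1 he
  exact Finset.mem_biUnion.2 ⟨v, by simpa using hsmall, Finset.mem_filter.2 ⟨heT, hv⟩⟩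

open Classical in
lemma bprob_card_lt_card_smallEdges_le [Nonempty V] (hq0 : 0 ≤ q) (hq1 : q ≤ 1)
    (Γ : SimpleGraph V) [DecidableRel Γ.Adj] (R : Finset (Sym2 V)) :
    bprob Γ.edgeFinset q (fun T => Fintype.card V < (smallEdges R T).card) ≤
      (∑ v, if IsSmall R v then 1 else 0) * q := by
  have hn : (0 : ℝ) < Fintype.card V := by exact_mod_cast Fintype.card_pos
  calc bprob Γ.edgeFinset q (fun T => Fintype.card V < (smallEdges R T).card)
      ≤ bprob Γ.edgeFinset q fun T => (Fintype.card V : ℝ) <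
          ∑ v with IsSmall R v, ((T.filter (v ∈ ·)).card : ℝ) :=
        bprob_mono hq0 hq1 fun T _ h => by exact_mod_cast h.trans_le (card_smallEdges_le R T)
    _ ≤ (Fintype.card V : ℝ)⁻¹ * bexp Γ.edgeFinset q fun T =>
          ∑ v with IsSmall R v, ((T.filter (v ∈ ·)).card : ℝ) :=
        bprob_lt_le hq0 hq1 (fun T _ => by positivity) hn
    _ = (Fintype.card V : ℝ)⁻¹ * ∑ v with IsSmall R v, Γ.degree v * q := by
        simp only [bexp_sum, bexp_card_filter, card_filter_mem_edgeFinset]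
    _ ≤ (Fintype.card V : ℝ)⁻¹ * ∑ v with IsSmall R v, Fintype.card V * q := by
        gcongr with v
        exact (Γ.degree_lt_card_verts v).le
    _ = (∑ v, if IsSmall R v then 1 else 0) * q := by
        rw [Finset.sum_const, Finset.sum_boole, nsmul_eq_mul]
        field_simp

lemma bprob₂_card_lt_card_smallEdges_le [Nonempty V] (hp0 : 0 ≤ p) (hp1 : p ≤ 1) (hq0 : 0 ≤ q)
    (hq1 : q ≤ 1) (hlam0 : 0 < lam) (hlam1 : lam ≤ 1) (hδ : ∀ v, δ ≤ Γ.degree v) :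
    bprob₂ Γ.edgeFinset p q (fun R T => Fintype.card V < (smallEdges R T).card) ≤
      Fintype.card V * q * (lam⁻¹ ^ 28 * (1 - p + p * lam) ^ δ) := by
  classical
  calc bprob₂ Γ.edgeFinset p q (fun R T => Fintype.card V < (smallEdges R T).card)
      ≤ bexp Γ.edgeFinset p fun R => (∑ v, if IsSmall R v then 1 else 0) * q :=
        bexp_mono hp0 hp1 fun R _ => bprob_card_lt_card_smallEdges_le hq0 hq1 Γ R
    _ = (∑ v, bprob Γ.edgeFinset p fun R => IsSmall R v) * q := by
        rw [bexp_mul_const, bexp_sum]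
        rfl
    _ ≤ (∑ _v : V, lam⁻¹ ^ 28 * (1 - p + p * lam) ^ δ) * q := by
        gcongr with v
        exact bprob_isSmall_le hp0 hp1 hlam0 hlam1 hδ v
    _ = Fintype.card V * q * (lam⁻¹ ^ 28 * (1 - p + p * lam) ^ δ) := by
        rw [Finset.sum_const, Finset.card_univ, nsmul_eq_mul]
        ring

end SmallVertices

end RareEvents

section Assembly

variable {V : Type*} [Fintype V] [DecidableEq V] {R T A B : Finset (Sym2 V)} {s m : ℕ}

/-- The failure of one of the properties that make `R` together with the edges of `T` at small
vertices an expander of linear scale `m`: the sets of at most `s` vertices expand since `R` is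
locally sparse, the sets of between `s` and `m` vertices since `R` traps no such set, and the small
vertices do not interfere since they are far apart. -/
def IsAtypical (R T : Finset (Sym2 V)) (s m : ℕ) : Prop :=
  HasCloseSmallPair R T 4 ∨ HasLargeCodegree (R ∪ T) ∨ HasDenseSet R (7 * s) ∨
    HasTrappedSet R s m ∨ HasEmptyCut R m ∨ Fintype.card V < (smallEdges R T).card

lemma connected_edgeGraph_union_of_not_hasEmptyCut [Nonempty V] {F : Finset (Sym2 V)}
    (hd : ∀ e ∈ R, ¬ e.IsDiag) (hcut : ¬ HasEmptyCut R m)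
    (hexp : ∀ S : Finset V, S.card ≤ m → 2 * S.card ≤ (extNbr (edgeGraph (R ∪ F)) S).card) :
    (edgeGraph (R ∪ F)).Connected := by
  refine connected_of_expansion hexp fun C hCm hC2 => ?_
  by_contra! h
  exact hcut ⟨C, ⟨hCm, hC2⟩, fun u hu v hv huv => h u hu v hv
    (edgeGraph_mono Finset.subset_union_left ((edgeGraph_adj hd).2 huv))⟩

lemma isAtypical_or_hasSparseNoBooster (h3 : 3 ≤ Fintype.card V)
    (hd : ∀ e ∈ R ∪ (A ∪ B), ¬ e.IsDiag)
    (hdeg : ∀ v, 2 ≤ ((R ∪ (A ∪ B)).filter (v ∈ ·)).card)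
    (hnot : ¬ (edgeGraph (R ∪ (A ∪ B))).IsHamiltonian) :
    IsAtypical R (A ∪ B) s m ∨ HasSparseNoBooster R A B (3 * Fintype.card V) m := by
  have : Nonempty V := Fintype.card_pos_iff.1 (by omega)
  refine or_iff_not_imp_left.2 fun htypical => ?_
  simp only [IsAtypical, not_or] at htypical
  obtain ⟨hclose, hcod, hdense, htrapped, hcut, hsmall⟩ := htypical
  have h_exp : ∀ S : Finset V, S.card ≤ m →
      2 * S.card ≤ (extNbr (edgeGraph (R ∪ smallEdges R (A ∪ B))) S).card := fun S hS =>
    two_mul_card_le_card_extNbr_union_smallEdges hd hdeg hclose hcod hdense htrapped hS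
  have h_conn := connected_edgeGraph_union_of_not_hasEmptyCut
    (fun e he => hd e (Finset.mem_union_left _ he)) hcut h_exp
  obtain ⟨F, hF, hFAB, hF_card, hF_no⟩ :=
    exists_noBooster h3 smallEdges_subset hd h_conn hnot
  have h_expF : ∀ S : Finset V, S.card ≤ m →
      2 * S.card ≤ (extNbr (edgeGraph (R ∪ F)) S).card := fun S hS =>
    (h_exp S hS).trans (Finset.card_le_card (extNbr_mono
      (edgeGraph_mono (Finset.union_subset_union_right hF)) S))
  refine ⟨F, hFAB, by omega, (lt_card_longestStarts h_expF).le, fun x hx => ?_, hF_no⟩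
  obtain ⟨l, hl, hx⟩ := mem_longestStarts.1 hx
  exact (lt_card_longestEnds h_expF hl hx).le

variable {Γ : SimpleGraph V} [DecidableRel Γ.Adj] {p q : ℝ}

lemma bprob_not_isHamiltonian_le (h3 : 3 ≤ Fintype.card V) {a b : ℝ} (hp0 : 0 ≤ p) (hp1 : p ≤ 1)
    (ha0 : 0 ≤ a) (ha1 : a ≤ 1) (hb0 : 0 ≤ b) (hb1 : b ≤ 1) (hq : q = a + b - a * b) (s m : ℕ) :
    bprob Γ.edgeFinset (p + q - p * q) (fun S => (∀ v, 2 ≤ (S.filter (v ∈ ·)).card) ∧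
      ¬ (edgeGraph S).IsHamiltonian) ≤
      bprob₂ Γ.edgeFinset p q (fun R T => IsAtypical R T s m) +
        bexp Γ.edgeFinset p fun R => bprob₂ Γ.edgeFinset a b fun A B =>
          HasSparseNoBooster R A B (3 * Fintype.card V) m := by
  set Q : Finset (Sym2 V) → Prop := fun S => (∀ v, 2 ≤ (S.filter (v ∈ ·)).card) ∧
    ¬ (edgeGraph S).IsHamiltonian
  have h_split : ∀ R ⊆ Γ.edgeFinset, ∀ A ⊆ Γ.edgeFinset, ∀ B ⊆ Γ.edgeFinset, Q (R ∪ (A ∪ B)) →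
      IsAtypical R (A ∪ B) s m ∨ HasSparseNoBooster R A B (3 * Fintype.card V) m := by
    intro R hR A hA B hB ⟨hdeg, hnot⟩
    refine isAtypical_or_hasSparseNoBooster h3 (fun e he => ?_) hdeg hnot
    exact Γ.not_isDiag_of_mem_edgeFinset
      (Finset.union_subset hR (Finset.union_subset hA hB) he)
  subst hq
  calc bprob Γ.edgeFinset (p + (a + b - a * b) - p * (a + b - a * b)) Q
      = bexp Γ.edgeFinset p fun R => bprob₂ Γ.edgeFinset a b fun A B => Q (R ∪ (A ∪ B)) := by
        rw [← bprob₂_union]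
        exact bexp_congr fun R _ => (bprob₂_union Γ.edgeFinset a b fun T => Q (R ∪ T)).symm
    _ ≤ bexp Γ.edgeFinset p fun R =>
          bprob₂ Γ.edgeFinset a b (fun A B => IsAtypical R (A ∪ B) s m) +
            bprob₂ Γ.edgeFinset a b fun A B =>
              HasSparseNoBooster R A B (3 * Fintype.card V) m :=
        bexp_mono hp0 hp1 fun R hR => (bprob₂_mono ha0 ha1 hb0 hb1 (h_split R hR)).trans
          (bprob₂_or_le ha0 ha1 hb0 hb1 _ _)
    _ = _ := by
        rw [bexp_add]
        congr 1
        exact bexp_congr fun R _ => bprob₂_union Γ.edgeFinset a b fun T => IsAtypical R T s m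

lemma bprob₂_isAtypical_le [Nonempty V] {lam μ r : ℝ} {δ θ : ℕ}
    (hp0 : 0 ≤ p) (hp1 : p ≤ 1) (hq0 : 0 ≤ q) (hq1 : q ≤ 1) (hP0 : 0 < p + q - p * q)
    (hδ : ∀ v, δ ≤ Γ.degree v) (hΓ : ∀ v, Fintype.card V + 2 * θ ≤ 2 * Γ.degree v)
    (hm : 14 * m ≤ δ) (hlam0 : 0 < lam) (hlam1 : lam ≤ 1) (hμ0 : 0 < μ) (hμ1 : μ ≤ 1)
    (hPs : (p + q - p * q) * (7 * s : ℕ) ≤ 1)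
    (hr : Real.exp 2 * Fintype.card V * (7 * s : ℕ) * (p + q - p * q) ^ 2 ≤ r) (hr1 : r ≤ 1 / 2) :
    bprob₂ Γ.edgeFinset p q (fun R T => IsAtypical R T s m) ≤
      (∑ j ∈ Finset.Icc 1 4, Fintype.card V ^ (j + 1) * ((p + q - p * q) ^ j *
        (lam⁻¹ ^ 56 * (1 - p + p * lam) ^ (2 * δ - 1 - j)))) +
      (Fintype.card V ^ 5 * (p + q - p * q) ^ 6 +
      (2 * r +
      (Real.exp (Fintype.card V * μ +
        Fintype.card V * (Real.exp (-(p * (δ / 4))) * μ⁻¹ ^ 6 * Real.exp 3) - 3 * s) +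
      (2 ^ Fintype.card V * Real.exp (-(p * (m * θ / 2))) +
      Fintype.card V * q * (lam⁻¹ ^ 28 * (1 - p + p * lam) ^ δ))))) := by
  refine (bprob₂_or_le hp0 hp1 hq0 hq1 _ _).trans (add_le_add
    (bprob₂_hasCloseSmallPair_le hp0 hp1 hq0 hq1 hlam0 hlam1 hδ 4) ?_)
  refine (bprob₂_or_le hp0 hp1 hq0 hq1 _ _).trans (add_le_add ?_ ?_)
  · rw [bprob₂_union]
    exact bprob_hasLargeCodegree_le hP0.le (by nlinarith) _
  refine (bprob₂_or_le hp0 hp1 hq0 hq1 _ _).trans (add_le_add ?_ ?_)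
  · rw [bprob₂_fst]
    exact bprob_hasDenseSet_le hp0 hp1 (by nlinarith) hP0 _ hPs hr hr1
  refine (bprob₂_or_le hp0 hp1 hq0 hq1 _ _).trans (add_le_add ?_ ?_)
  · rw [bprob₂_fst]
    exact bprob_hasTrappedSet_le hp0 hp1 hδ s hm hμ0 hμ1
  refine (bprob₂_or_le hp0 hp1 hq0 hq1 _ _).trans (add_le_add ?_ ?_)
  · rw [bprob₂_fst]
    exact bprob_hasEmptyCut_le hp0 hp1 hΓ m
  · exact bprob₂_card_lt_card_smallEdges_le hp0 hp1 hq0 hq1 hlam0 hlam1 hδ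

end Assembly

lemma tendsto_pow_mul_exp_neg_mul (k : ℕ) {b : ℝ} (hb : 0 < b) :
    Tendsto (fun L : ℝ => L ^ k * Real.exp (-(b * L))) atTop (𝓝 0) := by
  simpa [Real.rpow_natCast] using tendsto_rpow_mul_exp_neg_mul_atTop_nhds_zero (k : ℝ) b hb

/-- An upper bound, in terms of the logarithm `L` of the number of vertices, for the probability
that the random subgraph has minimum degree at least two without being Hamiltonian. -/
noncomputable def errorTerm (L : ℝ) : ℝ :=
  1024 * Real.exp 6 * (L ^ 60 * Real.exp (-(1 / 2 * L))) + 4096 * (L ^ 6 * Real.exp (-L)) +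
    448 * Real.exp 2 * L⁻¹ + L ^ 3 * Real.exp (-L) +
    4 * Real.exp 1 * (L ^ 29 * Real.exp (-(3 / 4 * L))) + 2 * Real.exp (-L)

lemma tendsto_errorTerm : Tendsto errorTerm atTop (𝓝 0) := by
  have h_half := tendsto_pow_mul_exp_neg_mul 60 (b := 1 / 2) (by norm_num)
  have h_three_quarters := tendsto_pow_mul_exp_neg_mul 29 (b := 3 / 4) (by norm_num)
  simpa +unfoldPartialApp [errorTerm] using (((((h_half.const_mul (1024 * Real.exp 6)).add
    ((Real.tendsto_pow_mul_exp_neg_atTop_nhds_zero 6).const_mul 4096)).add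
    (tendsto_inv_atTop_zero.const_mul (448 * Real.exp 2))).add
    (Real.tendsto_pow_mul_exp_neg_atTop_nhds_zero 3)).add
    (h_three_quarters.const_mul (4 * Real.exp 1))).add
    (Real.tendsto_exp_neg_atTop_nhds_zero.const_mul 2)

lemma exp_neg_le_inv {x : ℝ} (hx : 0 < x) : Real.exp (-x) ≤ x⁻¹ := by
  rw [Real.exp_neg]
  exact inv_anti₀ hx (by linarith [Real.add_one_le_exp x])

lemma two_pow_le_exp (n : ℕ) : (2 : ℝ) ^ n ≤ Real.exp n := by
  rw [← Real.exp_one_pow]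
  exact pow_le_pow_left₀ (by norm_num) (by linarith [Real.add_one_le_exp (1 : ℝ)]) n

lemma exists_add_sub_mul_eq {p P : ℝ} (hp0 : 0 ≤ p) (hp1 : p < 1) (hpP : p ≤ P) (hP1 : P ≤ 1) :
    ∃ q, P - p ≤ q ∧ q ≤ P ∧ p + q - p * q = P := by
  have h_pos : 0 < 1 - p := sub_pos.2 hp1
  refine ⟨(P - p) / (1 - p), ?_, ?_, ?_⟩
  · rw [le_div_iff₀ h_pos]
    nlinarith
  · rw [div_le_iff₀ h_pos]
    nlinarith
  · field_simp
    ring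

section ErrorTerms

variable {η P L : ℝ} {n δ : ℕ}

lemma one_sub_add_mul_inv_pow_le (hL : 1 ≤ L) (hP0 : 0 ≤ P) (hP1 : P ≤ 1) {N : ℕ} {x : ℝ}
    (hx : x ≤ P * N) :
    (1 - 3 * P / 4 + 3 * P / 4 * L⁻¹) ^ N ≤ Real.exp (-(3 / 4 * (1 - L⁻¹) * x)) := by
  have hlam0 : 0 ≤ L⁻¹ := by positivity
  have hlam1 : 0 ≤ 1 - L⁻¹ := sub_nonneg.2 (inv_le_one_of_one_le₀ hL)
  calc (1 - 3 * P / 4 + 3 * P / 4 * L⁻¹) ^ N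
      = (1 - 3 / 4 * (1 - L⁻¹) * P) ^ N := by ring
    _ ≤ Real.exp (-(3 / 4 * (1 - L⁻¹) * P * N)) :=
        one_sub_pow_le_exp (by positivity) (by nlinarith) le_rfl
    _ ≤ Real.exp (-(3 / 4 * (1 - L⁻¹) * x)) := by
        rw [mul_assoc _ P]
        gcongr

lemma closeSmallPair_term_le (hn : n = Real.exp L) (hL : 1 ≤ L) (hP0 : 0 ≤ P) (hP1 : P ≤ 1)
    (hPn : P * n ≤ 4 * L) (hPδ : L ≤ P * δ) {j : ℕ} (hj : j ≤ 4) :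
    (n : ℝ) ^ (j + 1) * (P ^ j *
      (L⁻¹⁻¹ ^ 56 * (1 - 3 * P / 4 + 3 * P / 4 * L⁻¹) ^ (2 * δ - 1 - j))) ≤
      256 * Real.exp 6 * (L ^ 60 * Real.exp (-(1 / 2 * L))) := by
  have hinv : L * L⁻¹ = 1 := mul_inv_cancel₀ (by positivity)
  have h_exponent : 2 * L - 5 ≤ P * (2 * δ - 1 - j : ℕ) := by
    have : (2 * δ : ℝ) ≤ (2 * δ - 1 - j : ℕ) + 5 := by
      exact_mod_cast (by omega : 2 * δ ≤ 2 * δ - 1 - j + 5)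
    nlinarith
  have h_decay : (1 - 3 * P / 4 + 3 * P / 4 * L⁻¹) ^ (2 * δ - 1 - j) ≤
      Real.exp (-(3 / 2 * L - 6)) := by
    refine (one_sub_add_mul_inv_pow_le hL hP0 hP1 h_exponent).trans (Real.exp_le_exp.2 ?_)
    have : 0 ≤ L⁻¹ := by positivity
    linear_combination 15 / 4 * this + 3 / 2 * hinv
  have : 0 ≤ 1 - 3 * P / 4 + 3 * P / 4 * L⁻¹ := by
    have : 0 ≤ 3 * P / 4 * L⁻¹ := by positivity
    linarith
  calc (n : ℝ) ^ (j + 1) * (P ^ j *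
      (L⁻¹⁻¹ ^ 56 * (1 - 3 * P / 4 + 3 * P / 4 * L⁻¹) ^ (2 * δ - 1 - j)))
      = n * (P * n) ^ j * L ^ 56 * (1 - 3 * P / 4 + 3 * P / 4 * L⁻¹) ^ (2 * δ - 1 - j) := by
        rw [inv_inv, mul_pow, pow_succ]
        ring
    _ ≤ n * (4 * L) ^ j * L ^ 56 * Real.exp (-(3 / 2 * L - 6)) := by gcongr
    _ ≤ n * (4 * L) ^ 4 * L ^ 56 * Real.exp (-(3 / 2 * L - 6)) := by
        gcongr
        linarith
    _ = 256 * Real.exp 6 * (L ^ 60 * (Real.exp L * Real.exp (-(3 / 2 * L)))) := by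
        rw [hn, neg_sub, sub_eq_add_neg, Real.exp_add]
        ring
    _ = 256 * Real.exp 6 * (L ^ 60 * Real.exp (-(1 / 2 * L))) := by
        rw [← Real.exp_add]
        ring_nf

lemma sum_closeSmallPair_term_le (hn : n = Real.exp L) (hL : 1 ≤ L) (hP0 : 0 ≤ P) (hP1 : P ≤ 1)
    (hPn : P * n ≤ 4 * L) (hPδ : L ≤ P * δ) :
    ∑ j ∈ Finset.Icc 1 4, (n : ℝ) ^ (j + 1) * (P ^ j *
      (L⁻¹⁻¹ ^ 56 * (1 - 3 * P / 4 + 3 * P / 4 * L⁻¹) ^ (2 * δ - 1 - j))) ≤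
      1024 * Real.exp 6 * (L ^ 60 * Real.exp (-(1 / 2 * L))) := by
  refine (Finset.sum_le_card_nsmul _ _ _ fun j hj =>
    closeSmallPair_term_le hn hL hP0 hP1 hPn hPδ (Finset.mem_Icc.1 hj).2).trans_eq ?_
  rw [Nat.card_Icc, nsmul_eq_mul]
  push_cast
  ring

lemma largeCodegree_term_le (hn : n = Real.exp L) (hP0 : 0 ≤ P) (hPn : P * n ≤ 4 * L) :
    (n : ℝ) ^ 5 * P ^ 6 ≤ 4096 * (L ^ 6 * Real.exp (-L)) := by
  have : (0 : ℝ) < n := hn ▸ Real.exp_pos L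
  calc (n : ℝ) ^ 5 * P ^ 6 = (P * n) ^ 6 * (n : ℝ)⁻¹ := by field_simp
    _ ≤ (4 * L) ^ 6 * (n : ℝ)⁻¹ := by gcongr
    _ = 4096 * (L ^ 6 * Real.exp (-L)) := by
        rw [hn, Real.exp_neg]
        ring

lemma trappedSet_term_le {s : ℕ} (hn : n = Real.exp L) (hL : 0 < L) (hPδ : L ≤ P * δ)
    (hL21 : L ^ 21 * Real.exp 3 ≤ Real.exp (3 / 16 * L)) (hs : n / L ^ 3 ≤ s) :
    Real.exp (n * (L ^ 3)⁻¹ + n * (Real.exp (-(3 * P / 4 * (δ / 4))) * (L ^ 3)⁻¹⁻¹ ^ 6 *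
      Real.exp 3) - 3 * s) ≤ L ^ 3 * Real.exp (-L) := by
  have hn0 : (0 : ℝ) < n := hn ▸ Real.exp_pos L
  have h_decay : Real.exp (-(3 * P / 4 * (δ / 4))) * (L ^ 3)⁻¹⁻¹ ^ 6 * Real.exp 3 ≤ (L ^ 3)⁻¹ := by
    rw [inv_inv, ← one_div, le_div_iff₀ (by positivity)]
    calc Real.exp (-(3 * P / 4 * (δ / 4))) * (L ^ 3) ^ 6 * Real.exp 3 * L ^ 3
        = Real.exp (-(3 / 16 * (P * δ))) * (L ^ 21 * Real.exp 3) := by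
          ring_nf
      _ ≤ Real.exp (-(3 / 16 * L)) * Real.exp (3 / 16 * L) := by gcongr
      _ = 1 := by rw [← Real.exp_add, neg_add_cancel, Real.exp_zero]
  have h_trap := mul_le_mul_of_nonneg_left h_decay hn0.le
  rw [div_eq_mul_inv] at hs
  calc _ ≤ Real.exp (-(n * (L ^ 3)⁻¹)) := Real.exp_le_exp.2 (by linarith)
    _ ≤ (n * (L ^ 3)⁻¹)⁻¹ := exp_neg_le_inv (by positivity)
    _ = L ^ 3 * Real.exp (-L) := by rw [hn, mul_inv_rev, inv_inv, Real.exp_neg]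

lemma exp_neg_natCast_le (hn : n = Real.exp L) : Real.exp (-(n : ℝ)) ≤ Real.exp (-L) := by
  rw [hn]
  gcongr
  linarith [Real.add_one_le_exp L]

lemma emptyCut_term_le {m θ : ℕ} (hn : n = Real.exp L) (hη : 0 < η) (hP0 : 0 ≤ P)
    (hPn : L ≤ P * n) (hηL : 320 ≤ η * L) (hmθ : η * n ^ 2 / 60 ≤ m * θ) :
    2 ^ n * Real.exp (-(3 * P / 4 * (m * θ / 2))) ≤ Real.exp (-L) := by
  have h_exponent : 2 * (n : ℝ) ≤ 3 * P / 4 * (m * θ / 2) := calc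
    2 * (n : ℝ) ≤ η * L * n / 160 := by nlinarith
    _ ≤ η * (P * n) * n / 160 := by gcongr
    _ = 3 * P / 4 * (η * n ^ 2 / 60 / 2) := by ring
    _ ≤ 3 * P / 4 * (m * θ / 2) := by gcongr
  calc 2 ^ n * Real.exp (-(3 * P / 4 * (m * θ / 2))) ≤ Real.exp n * Real.exp (-(2 * n)) := by
        gcongr
        exact two_pow_le_exp n
    _ = Real.exp (-(n : ℝ)) := by
        rw [← Real.exp_add]
        ring_nf
    _ ≤ Real.exp (-L) := exp_neg_natCast_le hn

lemma smallEdges_term_le {q : ℝ} (hL : 1 ≤ L) (hP0 : 0 ≤ P) (hP1 : P ≤ 1) (hPn : P * n ≤ 4 * L)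
    (hPδ : L ≤ P * δ) (hqP : q ≤ P) :
    n * q * (L⁻¹⁻¹ ^ 28 * (1 - 3 * P / 4 + 3 * P / 4 * L⁻¹) ^ δ) ≤
      4 * Real.exp 1 * (L ^ 29 * Real.exp (-(3 / 4 * L))) := by
  have hinv : L * L⁻¹ = 1 := mul_inv_cancel₀ (by positivity)
  have h_decay : (1 - 3 * P / 4 + 3 * P / 4 * L⁻¹) ^ δ ≤ Real.exp (1 + -(3 / 4 * L)) :=
    (one_sub_add_mul_inv_pow_le hL hP0 hP1 hPδ).trans (Real.exp_le_exp.2 (by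
      linear_combination 3 / 4 * hinv))
  have : 0 ≤ 1 - 3 * P / 4 + 3 * P / 4 * L⁻¹ := by
    have : 0 ≤ 3 * P / 4 * L⁻¹ := by positivity
    linarith
  have hqn : n * q ≤ 4 * L := by nlinarith [mul_le_mul_of_nonneg_left hqP n.cast_nonneg']
  calc n * q * (L⁻¹⁻¹ ^ 28 * (1 - 3 * P / 4 + 3 * P / 4 * L⁻¹) ^ δ)
      ≤ 4 * L * (L ^ 28 * Real.exp (1 + -(3 / 4 * L))) := by
        rw [inv_inv]
        gcongr
    _ = 4 * Real.exp 1 * (L ^ 29 * Real.exp (-(3 / 4 * L))) := by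
        rw [Real.exp_add]
        ring

lemma one_add_mul_pow_card_edgeFinset_le {V : Type*} [Fintype V] (Γ : SimpleGraph V)
    [DecidableRel Γ.Adj] {x c : ℝ} (hx : 0 ≤ x)
    (hxc : x * Fintype.card V ≤ c) :
    (1 + x) ^ Γ.edgeFinset.card ≤ Real.exp (c * Fintype.card V) := by
  have h_card : (Γ.edgeFinset.card : ℝ) ≤ Fintype.card V ^ 2 := by
    exact_mod_cast Γ.card_edgeFinset_le_card_choose_two.trans (Nat.choose_le_pow _ 2)
  calc (1 + x) ^ Γ.edgeFinset.card ≤ Real.exp x ^ Γ.edgeFinset.card := by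
        gcongr
        exact (add_comm _ _).trans_le (Real.add_one_le_exp x)
    _ = Real.exp (Γ.edgeFinset.card * x) := (Real.exp_nat_mul _ _).symm
    _ ≤ Real.exp (Fintype.card V ^ 2 * x) := by gcongr
    _ ≤ Real.exp (c * Fintype.card V) := by
        refine Real.exp_le_exp.2 ?_
        nlinarith [mul_le_mul_of_nonneg_right hxc (Nat.cast_nonneg (α := ℝ) (Fintype.card V))]

lemma mul_two_pow_mul_one_sub_pow_add_le {a b c x : ℝ} {k : ℕ} (hc0 : 0 ≤ c) (hc1 : c ≤ 1)
    (ha : c ≤ a) (ha1 : a ≤ 1) (hb : c ≤ b) (hb1 : b ≤ 1) (hx : x ≤ k) (n : ℕ) :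
    n * 2 ^ n * (1 - a) ^ k + (1 - b) ^ k ≤ Real.exp (2 * n) * Real.exp (-(c * x)) := by
  have h_pow : ∀ y, c ≤ y → y ≤ 1 → (1 - y) ^ k ≤ Real.exp (-(c * x)) := fun y hy hy1 =>
    (pow_le_pow_left₀ (by linarith) (by linarith) k).trans (one_sub_pow_le_exp hc0 hc1 hx)
  calc n * 2 ^ n * (1 - a) ^ k + (1 - b) ^ k
      ≤ n * 2 ^ n * Real.exp (-(c * x)) + 2 ^ n * Real.exp (-(c * x)) := by
        gcongr
        · exact h_pow a ha ha1
        · exact (h_pow b hb hb1).trans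
            (le_mul_of_one_le_left (by positivity) (one_le_pow₀ (by norm_num)))
    _ = (n + 1) * 2 ^ n * Real.exp (-(c * x)) := by ring
    _ ≤ Real.exp n * Real.exp n * Real.exp (-(c * x)) := by
        gcongr
        · exact Real.add_one_le_exp _
        · exact two_pow_le_exp n
    _ = Real.exp (2 * n) * Real.exp (-(c * x)) := by rw [← Real.exp_add, two_mul]

lemma noBooster_term_le {V : Type*} [Fintype V] (Γ : SimpleGraph V)
    [DecidableRel Γ.Adj] {a b q : ℝ} {k : ℕ} (hn : Fintype.card V = Real.exp L) (hη : 0 < η)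
    (hL : 0 < L) (hP0 : 0 ≤ P) (hP1 : P ≤ 1) (hPn : P * Fintype.card V ≤ 4 * L)
    (hPn' : L ≤ P * Fintype.card V) (hlog : 1200 * (3 * Real.log L + 7) ≤ η * L)
    (hq0 : 0 ≤ q) (hqP : q ≤ P) (ha : P / 8 ≤ a) (ha1 : a ≤ 1) (hb : P / 8 ≤ b) (hb1 : b ≤ 1)
    (hk : η * Fintype.card V ^ 2 / 150 ≤ k) :
    L⁻¹⁻¹ ^ (3 * Fintype.card V) * (1 + L⁻¹ * q) ^ Γ.edgeFinset.card *
      (Fintype.card V * 2 ^ Fintype.card V * (1 - a) ^ k + (1 - b) ^ k) ≤ Real.exp (-L) := by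
  set n := Fintype.card V
  have h_weight : L⁻¹⁻¹ ^ (3 * n) = Real.exp (3 * n * Real.log L) := by
    rw [inv_inv, ← Real.exp_log (pow_pos hL _), Real.log_pow]
    push_cast
    rfl
  have h_choices : (1 + L⁻¹ * q) ^ Γ.edgeFinset.card ≤ Real.exp (4 * n) := by
    refine one_add_mul_pow_card_edgeFinset_le Γ (by positivity) ?_
    rw [mul_assoc, inv_mul_le_iff₀ hL, mul_comm L]
    exact (mul_le_mul_of_nonneg_right hqP (by positivity)).trans hPn
  have h_missing : n * 2 ^ n * (1 - a) ^ k + (1 - b) ^ k ≤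
      Real.exp (2 * n) * Real.exp (-(P / 8 * (η * n ^ 2 / 150))) :=
    mul_two_pow_mul_one_sub_pow_add_le (by positivity) (by linarith) ha ha1 hb hb1 hk n
  have h_exponent : (3 * Real.log L + 7) * n ≤ P / 8 * (η * n ^ 2 / 150) := calc
    (3 * Real.log L + 7) * n ≤ η * L / 1200 * n := by gcongr; linarith
    _ ≤ η * (P * n) / 1200 * n := by gcongr
    _ = P / 8 * (η * n ^ 2 / 150) := by ring
  calc L⁻¹⁻¹ ^ (3 * n) * (1 + L⁻¹ * q) ^ Γ.edgeFinset.card *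
        (n * 2 ^ n * (1 - a) ^ k + (1 - b) ^ k)
      ≤ Real.exp (3 * n * Real.log L) * Real.exp (4 * n) *
        (Real.exp (2 * n) * Real.exp (-(P / 8 * (η * n ^ 2 / 150)))) := by
        rw [h_weight]
        gcongr
    _ ≤ Real.exp (-(n : ℝ)) := by
        rw [← Real.exp_add, ← Real.exp_add, ← Real.exp_add]
        refine Real.exp_le_exp.2 ?_
        linarith
    _ ≤ Real.exp (-L) := exp_neg_natCast_le hn

end ErrorTerms

lemma exists_size_params {η : ℝ} {n : ℕ} (hn : 420 ≤ n) (hηn : 2400 ≤ η * n) :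
    ∃ m θ k : ℕ, 28 * m ≤ n ∧ (θ : ℝ) ≤ η * n ∧ η * n ^ 2 / 60 ≤ m * θ ∧
      2 * (k + 3 * n) ≤ m * θ ∧ η * n ^ 2 / 150 ≤ k := by
  have hm : (n : ℝ) / 30 ≤ (n / 28 : ℕ) := by
    have : (n : ℝ) < 28 * ((n / 28 : ℕ) + 1) := by
      exact_mod_cast (by omega : n < 28 * (n / 28 + 1))
    have : (420 : ℝ) ≤ n := by exact_mod_cast hn
    linarith
  have hθ : η * n / 2 ≤ ⌊η * n⌋₊ := by linarith [Nat.lt_floor_add_one (η * n)]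
  have hmθ : η * n ^ 2 / 60 ≤ (n / 28 : ℕ) * ⌊η * n⌋₊ := calc
    η * n ^ 2 / 60 = n / 30 * (η * n / 2) := by ring
    _ ≤ _ := by gcongr
  have h_large : 2400 * (n : ℝ) ≤ η * n ^ 2 := by nlinarith
  have h_edges : 6 * n ≤ n / 28 * ⌊η * n⌋₊ := by
    have : (6 * n : ℝ) ≤ (n / 28 : ℕ) * ⌊η * n⌋₊ := by linarith
    exact_mod_cast this
  refine ⟨n / 28, ⌊η * n⌋₊, n / 28 * ⌊η * n⌋₊ / 2 - 3 * n, by omega,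
    Nat.floor_le (by linarith), hmθ, by omega, ?_⟩
  have : (n / 28 : ℕ) * (⌊η * n⌋₊ : ℝ) <
      2 * ((n / 28 * ⌊η * n⌋₊ / 2 - 3 * n : ℕ) + 3 * n + 1) := by
    exact_mod_cast (by omega : n / 28 * ⌊η * n⌋₊ <
      2 * (n / 28 * ⌊η * n⌋₊ / 2 - 3 * n + 3 * n + 1))
  have : (420 : ℝ) ≤ n := by exact_mod_cast hn
  linarith

lemma mul_seven_mul_le {P L : ℝ} {n s : ℕ} (hP0 : 0 ≤ P) (hL : 0 < L) (hPn : P * n ≤ 4 * L)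
    (hs : s ≤ 2 * (n / L ^ 3)) : P * (7 * s : ℕ) ≤ 56 / L ^ 2 := by
  push_cast
  calc P * (7 * (s : ℝ)) ≤ P * (7 * (2 * (n / L ^ 3))) := by gcongr
    _ = P * n * (14 / L ^ 3) := by ring
    _ ≤ 4 * L * (14 / L ^ 3) := by gcongr
    _ = 56 / L ^ 2 := by field_simp; norm_num

lemma exists_sprinkling_params {P : ℝ} (hP0 : 0 ≤ P) (hP1 : P ≤ 1) :
    ∃ b q, 0 ≤ q ∧ q ≤ P ∧ 3 * P / 4 + q - 3 * P / 4 * q = P ∧ P / 8 ≤ b ∧ b ≤ 1 ∧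
      P / 8 + b - P / 8 * b = q := by
  obtain ⟨q, hq, hqP, hPq⟩ := exists_add_sub_mul_eq (p := 3 * P / 4) (P := P)
    (by positivity) (by linarith) (by linarith) hP1
  obtain ⟨b, hb, hbq, hab⟩ := exists_add_sub_mul_eq (p := P / 8) (P := q)
    (by positivity) (by linarith) (by linarith) (by linarith)
  exact ⟨b, q, by linarith, hqP, hPq, by linarith, by linarith, hab⟩

lemma pow_three_le_exp {L : ℝ} (hL : 1 ≤ L) (hL21 : L ^ 21 * Real.exp 3 ≤ Real.exp (3 / 16 * L)) :
    L ^ 3 ≤ Real.exp L := calc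
  L ^ 3 ≤ L ^ 21 * Real.exp 3 := (pow_le_pow_right₀ hL (by norm_num)).trans
    (le_mul_of_one_le_right (by positivity) (Real.one_le_exp (by norm_num)))
  _ ≤ Real.exp (3 / 16 * L) := hL21
  _ ≤ Real.exp L := by gcongr; linarith

lemma cast_le_card_of_le_degree {V : Type*} [Fintype V] [Nonempty V] {Γ : SimpleGraph V}
    [DecidableRel Γ.Adj] {δ : ℕ} (hδ : ∀ v, δ ≤ Γ.degree v) : (δ : ℝ) ≤ Fintype.card V := by
  obtain ⟨v⟩ := ‹Nonempty V›
  exact_mod_cast (hδ v).trans (Γ.degree_lt_card_verts v).le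

section RandomSubgraph

variable {V : Type*} [Fintype V] [DecidableEq V] {Γ : SimpleGraph V} [DecidableRel Γ.Adj]
  {η P L q : ℝ} {δ m θ s : ℕ}

lemma bprob₂_isAtypical_le_errorTerm (hn : Fintype.card V = Real.exp L) (hη : 0 < η)
    (hδ : ∀ v, δ ≤ Γ.degree v) (hδη : (1 / 2 + η) * Fintype.card V ≤ δ) (hP0 : 0 < P) (hP1 : P ≤ 1)
    (hPn : P * Fintype.card V ≤ 4 * L) (hPδ : L ≤ P * δ) (hL : 448 * Real.exp 2 ≤ L)
    (hL21 : L ^ 21 * Real.exp 3 ≤ Real.exp (3 / 16 * L)) (hηL : 320 ≤ η * L) (hq0 : 0 ≤ q)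
    (hqP : q ≤ P) (hPq : 3 * P / 4 + q - 3 * P / 4 * q = P) (hm : 28 * m ≤ Fintype.card V)
    (hθ : θ ≤ η * Fintype.card V) (hmθ : η * Fintype.card V ^ 2 / 60 ≤ m * θ)
    (hs : Fintype.card V / L ^ 3 ≤ s) (hs' : s ≤ 2 * (Fintype.card V / L ^ 3)) :
    bprob₂ Γ.edgeFinset (3 * P / 4) q (fun R T => IsAtypical R T s m) ≤
      errorTerm L - Real.exp (-L) := by
  set n := Fintype.card V
  have hL448 : 448 ≤ L := by nlinarith [Real.add_one_le_exp (2 : ℝ)]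
  have hn0 : (0 : ℝ) < n := hn ▸ Real.exp_pos L
  have : Nonempty V := Fintype.card_pos_iff.1 (by exact_mod_cast hn0)
  have hPn' : L ≤ P * n := hPδ.trans
    (mul_le_mul_of_nonneg_left (cast_le_card_of_le_degree hδ) hP0.le)
  have hΓ : n + 2 * θ ≤ 2 * δ := by
    have : (n : ℝ) + 2 * θ ≤ 2 * δ := by linarith
    exact_mod_cast this
  have hPs : P * (7 * s : ℕ) ≤ 56 / L ^ 2 := mul_seven_mul_le hP0.le (by linarith) hPn hs'
  have h_dense : Real.exp 2 * n * (7 * s : ℕ) * P ^ 2 ≤ 224 * Real.exp 2 * L⁻¹ := calc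
    Real.exp 2 * n * (7 * s : ℕ) * P ^ 2 = Real.exp 2 * (P * n) * (P * (7 * s : ℕ)) := by ring
    _ ≤ Real.exp 2 * (4 * L) * (56 / L ^ 2) := by gcongr
    _ = 224 * Real.exp 2 * L⁻¹ := by field_simp; norm_num
  have h_bound := bprob₂_isAtypical_le (p := 3 * P / 4) (s := s) (lam := L⁻¹) (μ := (L ^ 3)⁻¹)
    (r := 224 * Real.exp 2 * L⁻¹) (by positivity) (by linarith) hq0 (hqP.trans hP1)
    (hP0.trans_eq hPq.symm) hδ (fun v => hΓ.trans (by have := hδ v; omega)) (by omega : 14 * m ≤ δ)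
    (by positivity) (inv_le_one_of_one_le₀ (by linarith)) (by positivity)
    (inv_le_one_of_one_le₀ (one_le_pow₀ (by linarith)))
    (by rw [hPq]; exact hPs.trans (div_le_one_of_le₀ (by nlinarith) (by positivity)))
    (by rwa [hPq]) (by rw [← div_eq_mul_inv, div_le_iff₀ (by positivity)]; linarith)
  rw [hPq] at h_bound
  have h_pairs := sum_closeSmallPair_term_le hn (by linarith) hP0.le hP1 hPn hPδ
  have h_codegree := largeCodegree_term_le hn hP0.le hPn
  have h_trapped := trappedSet_term_le hn (by linarith) hPδ hL21 hs
  have h_cut := emptyCut_term_le hn hη hP0.le hPn' hηL hmθ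
  have h_small := smallEdges_term_le (n := n) (by linarith) hP0.le hP1 hPn hPδ hqP
  unfold errorTerm
  linarith

lemma bexp_hasSparseNoBooster_le {a b : ℝ} {k : ℕ} (hn : Fintype.card V = Real.exp L)
    (hη : 0 < η) (hL : 1 ≤ L) (hP0 : 0 ≤ P) (hP1 : P ≤ 1) (hPn : P * Fintype.card V ≤ 4 * L)
    (hPn' : L ≤ P * Fintype.card V) (hlog : 1200 * (3 * Real.log L + 7) ≤ η * L)
    (hq0 : 0 ≤ q) (hqP : q ≤ P) (ha : P / 8 ≤ a) (ha1 : a ≤ 1) (hb : P / 8 ≤ b) (hb1 : b ≤ 1)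
    (hq : a + b - a * b = q) (hΓ : ∀ v, Fintype.card V + 2 * θ ≤ 2 * Γ.degree v)
    (hk : 2 * (k + 3 * Fintype.card V) ≤ m * θ) (hk' : η * Fintype.card V ^ 2 / 150 ≤ k) :
    (bexp Γ.edgeFinset (3 * P / 4) fun R => bprob₂ Γ.edgeFinset a b fun A B =>
      HasSparseNoBooster R A B (3 * Fintype.card V) m) ≤ Real.exp (-L) := by
  calc _ ≤ bexp Γ.edgeFinset (3 * P / 4) fun _ => Real.exp (-L) := by
        refine bexp_mono (by positivity) (by linarith) fun R _ => ?_
        refine (bprob₂_hasSparseNoBooster_le Γ (by linarith) ha1 (by linarith) hb1 hΓ R hk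
          (lam := L⁻¹) (by positivity) (inv_le_one_of_one_le₀ hL)).trans ?_
        rw [hq]
        exact noBooster_term_le Γ hn hη (by linarith) hP0 hP1 hPn hPn' hlog hq0 hqP ha ha1 hb
          hb1 hk'
    _ = Real.exp (-L) := bexp_const _ _ _

lemma bprob_not_isHamiltonian_le_errorTerm (hn : Fintype.card V = Real.exp L) (hη : 0 < η)
    (hδ : ∀ v, δ ≤ Γ.degree v) (hδη : (1 / 2 + η) * Fintype.card V ≤ δ)
    (hPn : P * Fintype.card V ≤ 4 * L) (hPδ : L ≤ P * δ) (hL : 448 * Real.exp 2 ≤ L)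
    (hL21 : L ^ 21 * Real.exp 3 ≤ Real.exp (3 / 16 * L))
    (hlog : 1200 * (3 * Real.log L + 7) ≤ η * L) :
    bprob Γ.edgeFinset P (fun S => (∀ v, 2 ≤ (S.filter (v ∈ ·)).card) ∧
      ¬ (edgeGraph S).IsHamiltonian) ≤ errorTerm L := by
  have hL448 : 448 ≤ L := by nlinarith [Real.add_one_le_exp (2 : ℝ)]
  have hLn : L ^ 3 ≤ Fintype.card V := (pow_three_le_exp (by linarith) hL21).trans_eq hn.symm
  have hL420 : 420 * L ≤ L ^ 3 := by nlinarith [sq_nonneg L]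
  have hn420 : 420 ≤ Fintype.card V := by
    have : (420 : ℝ) ≤ Fintype.card V := by linarith
    exact_mod_cast this
  have : Nonempty V := Fintype.card_pos_iff.1 (by omega)
  have hP0 : 0 < P := pos_of_mul_pos_left (by linarith : 0 < P * δ) δ.cast_nonneg
  have hP1 : P ≤ 1 := by nlinarith
  have hηL : 8400 ≤ η * L := by linarith [Real.log_nonneg (by linarith : 1 ≤ L)]
  obtain ⟨m, θ, k, hm, hθ, hmθ, hk, hk'⟩ :=
    exists_size_params (η := η) hn420 (by nlinarith)
  obtain ⟨b, q, hq0, hqP, hPq, hb, hb1, hab⟩ := exists_sprinkling_params hP0.le hP1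
  have hΓ : ∀ v, Fintype.card V + 2 * θ ≤ 2 * Γ.degree v := fun v => by
    have : (Fintype.card V : ℝ) + 2 * θ ≤ 2 * Γ.degree v := by
      have : (δ : ℝ) ≤ Γ.degree v := by exact_mod_cast hδ v
      linarith
    exact_mod_cast this
  have h_atypical := bprob₂_isAtypical_le_errorTerm hn hη hδ hδη hP0 hP1 hPn hPδ hL hL21
    (by linarith) hq0 hqP hPq hm hθ hmθ (Nat.le_ceil (Fintype.card V / L ^ 3))
    (Nat.ceil_le_two_mul ((le_div_iff₀ (by positivity)).2 (by linarith)))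
  have h_noBooster := bexp_hasSparseNoBooster_le hn hη (by linarith) hP0.le hP1 hPn
    (hPδ.trans (mul_le_mul_of_nonneg_left (cast_le_card_of_le_degree hδ) hP0.le)) hlog hq0 hqP
    le_rfl (by linarith) hb hb1 hab hΓ hk hk'
  have h_split := bprob_not_isHamiltonian_le (Γ := Γ) (p := 3 * P / 4) (by omega) (by positivity)
    (by linarith) (by positivity) (by linarith) (by linarith) hb1 hab.symm
    ⌈Fintype.card V / L ^ 3⌉₊ m
  rw [hPq] at h_split
  linarith

end RandomSubgraph

lemma eventually_pow_mul_exp_three_le :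
    ∀ᶠ L : ℝ in atTop, L ^ 21 * Real.exp 3 ≤ Real.exp (3 / 16 * L) := by
  filter_upwards [(tendsto_pow_mul_exp_neg_mul 21 (b := 3 / 16) (by norm_num)).eventually_le_const
    (Real.exp_pos (-3))] with L hL
  rw [Real.exp_neg, Real.exp_neg, ← div_eq_mul_inv, div_le_iff₀ (Real.exp_pos _),
    inv_mul_eq_div, le_div_iff₀ (Real.exp_pos _)] at hL
  exact hL

lemma eventually_log_le_mul {η : ℝ} (hη : 0 < η) :
    ∀ᶠ L : ℝ in atTop, 1200 * (3 * Real.log L + 7) ≤ η * L := by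
  filter_upwards [Real.isLittleO_log_id_atTop.def (c := η / 7200) (by positivity),
    (tendsto_id.const_mul_atTop hη).eventually_ge_atTop 16800, eventually_ge_atTop 0]
    with L h_log hL hL0
  rw [id] at h_log hL
  rw [Real.norm_of_nonneg hL0] at h_log
  linarith [Real.le_norm_self (Real.log L)]

lemma eventually_bprob_not_isHamiltonian_le {η : ℝ} (hη : 0 < η) {κ : ℝ} (hκ : 0 < κ) :
    ∀ᶠ n : ℕ in atTop, ∀ (V : Type*) [Fintype V] [DecidableEq V] (Γ : SimpleGraph V)
      [DecidableRel Γ.Adj] (δ : ℕ) (P : ℝ), Fintype.card V = n → (∀ v, δ ≤ Γ.degree v) →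
      (1 / 2 + η) * n ≤ δ → P ≤ 4 * Real.log n / n → Real.log n ≤ P * δ →
      bprob Γ.edgeFinset P (fun S => (∀ v, 2 ≤ (S.filter (v ∈ ·)).card) ∧
        ¬ (edgeGraph S).IsHamiltonian) ≤ κ := by
  have h_log : Tendsto (fun n : ℕ => Real.log n) atTop atTop :=
    Real.tendsto_log_atTop.comp tendsto_natCast_atTop_atTop
  filter_upwards [h_log.eventually eventually_pow_mul_exp_three_le,
    h_log.eventually (eventually_log_le_mul hη), h_log.eventually_ge_atTop (448 * Real.exp 2),
    h_log.eventually (tendsto_errorTerm.eventually_le_const hκ), eventually_gt_atTop 0]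
    with n hL21 hlog hL hκ hn V _ _ Γ _ δ P hV hδ hδη hP hPδ
  subst hV
  have hn0 : (0 : ℝ) < Fintype.card V := by exact_mod_cast hn
  exact (bprob_not_isHamiltonian_le_errorTerm (Real.exp_log hn0).symm hη hδ hδη
    ((le_div_iff₀ hn0).1 hP) hPδ hL hL21 hlog).trans hκ

section Bonferroni

lemma sum_range_two_mul_neg_one_pow_mul_choose_le (X m : ℕ) :
    ∑ k ∈ Finset.range (2 * m), (-1 : ℝ) ^ k * X.choose k ≤ if X = 0 then 1 else 0 := by
  rcases m with _ | m
  · simp only [mul_zero, Finset.range_zero, Finset.sum_empty]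
    split_ifs <;> norm_num
  rcases X with _ | X
  · rw [Finset.sum_eq_single 0 (fun k _ hk => by simp [Nat.choose_eq_zero_of_lt
      (Nat.pos_of_ne_zero hk)]) (by simp)]
    simp
  · have h_sum : ∑ k ∈ Finset.range (2 * (m + 1)), (-1 : ℝ) ^ k * (X + 1).choose k =
        (-1) ^ (2 * m + 1) * X.choose (2 * m + 1) := by
      exact_mod_cast Int.alternating_sum_range_choose_eq_choose (n := X) (m := 2 * m + 1)
    rw [h_sum, pow_succ, pow_mul]
    simp

lemma le_sum_range_two_mul_add_one_neg_one_pow_mul_choose (X m : ℕ) :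
    (if X = 0 then 1 else 0) ≤ ∑ k ∈ Finset.range (2 * m + 1), (-1 : ℝ) ^ k * X.choose k := by
  rcases X with _ | X
  · rw [Finset.sum_eq_single 0 (fun k _ hk => by simp [Nat.choose_eq_zero_of_lt
      (Nat.pos_of_ne_zero hk)]) (by simp)]
    simp
  · have h_sum : ∑ k ∈ Finset.range (2 * m + 1), (-1 : ℝ) ^ k * (X + 1).choose k =
        (-1) ^ (2 * m) * X.choose (2 * m) := by
      exact_mod_cast Int.alternating_sum_range_choose_eq_choose (n := X) (m := 2 * m)
    rw [h_sum, pow_mul]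
    simp

lemma tendsto_exp_neg_of_bonferroni {P : ℕ → ℝ} {e : ℕ → ℕ → ℝ} {lam : ℝ}
    (hlow : ∀ i m, ∑ k ∈ Finset.range (2 * m), (-1 : ℝ) ^ k * e k i ≤ P i)
    (hup : ∀ i m, P i ≤ ∑ k ∈ Finset.range (2 * m + 1), (-1 : ℝ) ^ k * e k i)
    (he : ∀ k, Tendsto (e k) atTop (𝓝 (lam ^ k / k.factorial))) :
    Tendsto P atTop (𝓝 (Real.exp (-lam))) := by
  have h_series : Tendsto (fun N => ∑ k ∈ Finset.range N, (-1 : ℝ) ^ k * (lam ^ k / k.factorial))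
      atTop (𝓝 (Real.exp (-lam))) := by
    have h_exp := (NormedSpace.expSeries_div_hasSum_exp (-lam)).tendsto_sum_nat
    rw [← Real.exp_eq_exp_ℝ] at h_exp
    refine h_exp.congr fun N => Finset.sum_congr rfl fun k _ => ?_
    rw [neg_pow, mul_div_assoc]
  have h_partial : ∀ N, Tendsto (fun i => ∑ k ∈ Finset.range N, (-1 : ℝ) ^ k * e k i) atTop
      (𝓝 (∑ k ∈ Finset.range N, (-1 : ℝ) ^ k * (lam ^ k / k.factorial))) :=
    fun N => tendsto_finsetSum _ fun k _ => (he k).const_mul _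
  have h_even : Tendsto (fun m : ℕ => 2 * m) atTop atTop :=
    tendsto_atTop_mono (fun m => by simp only [id]; omega) tendsto_id
  have h_odd : Tendsto (fun m : ℕ => 2 * m + 1) atTop atTop :=
    tendsto_atTop_mono (fun m => by omega) h_even
  refine tendsto_order.2 ⟨fun x hx => ?_, fun x hx => ?_⟩
  · obtain ⟨m, hm⟩ := ((h_series.comp h_even).eventually (lt_mem_nhds hx)).exists
    filter_upwards [(h_partial (2 * m)).eventually (lt_mem_nhds hm)] with i hi
    exact hi.trans_le (hlow i m)
  · obtain ⟨m, hm⟩ := ((h_series.comp h_odd).eventually (gt_mem_nhds hx)).exists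
    filter_upwards [(h_partial (2 * m + 1)).eventually (gt_mem_nhds hm)] with i hi
    exact (hup i m).trans_lt hi

end Bonferroni

section LowDegree

variable {V : Type*} [Fintype V] [DecidableEq V] (Γ : SimpleGraph V) [DecidableRel Γ.Adj]

/-- The edges of `Γ` with both ends in the vertex set `K`. -/
def innerEdges (K : Finset V) : Finset (Sym2 V) := Γ.edgeFinset.filter (· ∈ K.sym2)

/-- The edges of `Γ` at the vertex `v`, other than those with both ends in `K`. For distinct
`v ∈ K` these sets are disjoint, so that the numbers of retained edges in them are independent. -/
def outerEdges (K : Finset V) (v : V) : Finset (Sym2 V) :=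
  Γ.edgeFinset.filter (v ∈ ·) \ innerEdges Γ K

lemma innerEdges_subset (K : Finset V) : innerEdges Γ K ⊆ Γ.edgeFinset :=
  Finset.filter_subset _ _

lemma outerEdges_subset_sdiff (K : Finset V) (v : V) :
    outerEdges Γ K v ⊆ Γ.edgeFinset \ innerEdges Γ K :=
  Finset.sdiff_subset_sdiff (Finset.filter_subset _ _) subset_rfl

lemma card_innerEdges_le (K : Finset V) : (innerEdges Γ K).card ≤ K.card ^ 2 := by
  have h_pairs : innerEdges Γ K ⊆ (K ×ˢ K).image fun x => s(x.1, x.2) := by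
    intro e he
    have he := (Finset.mem_filter.1 he).2
    induction e with | _ a b =>
    rw [Finset.mk_mem_sym2_iff] at he
    exact Finset.mem_image.2 ⟨(a, b), Finset.mem_product.2 he, rfl⟩
  calc (innerEdges Γ K).card ≤ (K ×ˢ K).card :=
        (Finset.card_le_card h_pairs).trans Finset.card_image_le
    _ = K.card ^ 2 := by rw [Finset.card_product, sq]

lemma card_outerEdges_le (K : Finset V) (v : V) : (outerEdges Γ K v).card ≤ Γ.degree v := by
  rw [← card_filter_mem_edgeFinset]
  exact Finset.card_le_card Finset.sdiff_subset

lemma degree_le_card_outerEdges_add (K : Finset V) (v : V) :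
    Γ.degree v ≤ (outerEdges Γ K v).card + K.card := by
  have h_cover : Γ.edgeFinset.filter (v ∈ ·) ⊆ outerEdges Γ K v ∪ K.image fun w => s(v, w) := by
    intro e he
    by_cases h_inner : e ∈ innerEdges Γ K
    · have h_mem := (Finset.mem_filter.1 h_inner).2
      obtain ⟨w, rfl⟩ := (Finset.mem_filter.1 he).2
      rw [Finset.mk_mem_sym2_iff] at h_mem
      exact Finset.mem_union_right _ (Finset.mem_image.2 ⟨w, h_mem.2, rfl⟩)
    · exact Finset.mem_union_left _ (Finset.mem_sdiff.2 ⟨he, h_inner⟩)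
  rw [← card_filter_mem_edgeFinset]
  exact (Finset.card_le_card h_cover).trans
    ((Finset.card_union_le _ _).trans (Nat.add_le_add_left Finset.card_image_le _))

lemma pairwiseDisjoint_outerEdges (K : Finset V) :
    (K : Set V).PairwiseDisjoint (outerEdges Γ K) := by
  intro v hv w hw hvw
  refine Finset.disjoint_left.2 fun e hev hew => ?_
  obtain ⟨hev, h_outer⟩ := Finset.mem_sdiff.1 hev
  have hwe := (Finset.mem_filter.1 (Finset.mem_sdiff.1 hew).1).2
  obtain ⟨heΓ, hve⟩ := Finset.mem_filter.1 hev
  obtain rfl := (Sym2.mem_and_mem_iff hvw).1 ⟨hve, hwe⟩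
  exact h_outer (Finset.mem_filter.2 ⟨heΓ, Finset.mk_mem_sym2_iff.2 ⟨hv, hw⟩⟩)

lemma inter_outerEdges_subset_filter (K : Finset V) (v : V) (S : Finset (Sym2 V)) :
    S ∩ outerEdges Γ K v ⊆ S.filter (v ∈ ·) := fun e he => by
  rw [Finset.mem_inter, outerEdges, Finset.mem_sdiff, Finset.mem_filter] at he
  exact Finset.mem_filter.2 ⟨he.1, he.2.1.2⟩

variable {Γ}

lemma filter_subset_inter_outerEdges {K : Finset V} {S : Finset (Sym2 V)} (hS : S ⊆ Γ.edgeFinset)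
    (h : Disjoint (innerEdges Γ K) (S ∩ innerEdges Γ K)) (v : V) :
    S.filter (v ∈ ·) ⊆ S ∩ (Γ.edgeFinset \ innerEdges Γ K) ∩ outerEdges Γ K v := by
  intro e he
  obtain ⟨heS, hve⟩ := Finset.mem_filter.1 he
  have h_inner : e ∉ innerEdges Γ K := fun h_mem =>
    Finset.disjoint_left.1 h h_mem (Finset.mem_inter.2 ⟨heS, h_mem⟩)
  have h_outer : e ∈ outerEdges Γ K v :=
    Finset.mem_sdiff.2 ⟨Finset.mem_filter.2 ⟨hS heS, hve⟩, h_inner⟩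
  exact Finset.mem_inter.2
    ⟨Finset.mem_inter.2 ⟨heS, outerEdges_subset_sdiff Γ K v h_outer⟩, h_outer⟩

variable {p : ℝ} {d : ℕ} {K M : Finset V}

lemma bprob_forall_card_le_one_le (hp0 : 0 ≤ p) (hp1 : p ≤ 1) (hd : ∀ v ∈ K, Γ.degree v = d) :
    bprob Γ.edgeFinset p (fun S => ∀ v ∈ K, (S.filter (v ∈ ·)).card ≤ 1) ≤
      ((1 - p) ^ (d - K.card - 1) * (1 + d * p)) ^ K.card := by
  calc bprob Γ.edgeFinset p (fun S => ∀ v ∈ K, (S.filter (v ∈ ·)).card ≤ 1)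
      ≤ bprob Γ.edgeFinset p (fun S => ∀ v ∈ K, (S ∩ outerEdges Γ K v).card ≤ 1) :=
        bprob_mono hp0 hp1 fun S _ h v hv =>
          (Finset.card_le_card (inter_outerEdges_subset_filter Γ K v S)).trans (h v hv)
    _ = ∏ v ∈ K, bprob (outerEdges Γ K v) p (fun S => S.card ≤ 1) :=
        bprob_forall_inter K (outerEdges Γ K)
          (fun v _ => (outerEdges_subset_sdiff Γ K v).trans Finset.sdiff_subset)
          (pairwiseDisjoint_outerEdges Γ K) p (fun S => S.card ≤ 1)
    _ ≤ ∏ v ∈ K, ((1 - p) ^ (d - K.card - 1) * (1 + d * p)) := by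
        refine Finset.prod_le_prod (fun v _ => bprob_nonneg hp0 hp1 _) fun v hv => ?_
        have h_ge := degree_le_card_outerEdges_add Γ K v
        have h_le := card_outerEdges_le Γ K v
        rw [hd v hv] at h_ge h_le
        exact bprob_card_le_one_le hp0 hp1 (by omega) h_le
    _ = _ := Finset.prod_const _

lemma prod_bprob_outerEdges_le (hp0 : 0 ≤ p) (hp1 : p ≤ 1) (K : Finset V) :
    (1 - p) ^ (innerEdges Γ K).card *
        ∏ v ∈ K, bprob (outerEdges Γ K v) p (fun S => S.card ≤ 1) ≤
      bprob Γ.edgeFinset p (fun S => ∀ v ∈ K, (S.filter (v ∈ ·)).card ≤ 1) := by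
  calc (1 - p) ^ (innerEdges Γ K).card *
        ∏ v ∈ K, bprob (outerEdges Γ K v) p (fun S => S.card ≤ 1)
      = bprob (innerEdges Γ K) p (fun S => Disjoint (innerEdges Γ K) S) *
        bprob (Γ.edgeFinset \ innerEdges Γ K) p
          (fun S => ∀ v ∈ K, (S ∩ outerEdges Γ K v).card ≤ 1) := by
        rw [bprob_disjoint subset_rfl, bprob_forall_inter K (outerEdges Γ K)
          (fun v _ => outerEdges_subset_sdiff Γ K v) (pairwiseDisjoint_outerEdges Γ K) p
          (fun S => S.card ≤ 1)]
    _ = bprob Γ.edgeFinset p (fun S => Disjoint (innerEdges Γ K) (S ∩ innerEdges Γ K) ∧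
          ∀ v ∈ K, (S ∩ (Γ.edgeFinset \ innerEdges Γ K) ∩ outerEdges Γ K v).card ≤ 1) :=
        (bprob_inter_and_inter (innerEdges_subset Γ K) Finset.sdiff_subset
          Finset.disjoint_sdiff p (fun S => Disjoint (innerEdges Γ K) S)
          (fun S => ∀ v ∈ K, (S ∩ outerEdges Γ K v).card ≤ 1)).symm
    _ ≤ _ := bprob_mono hp0 hp1 fun S hS ⟨h_disj, h_outer⟩ v hv =>
        (Finset.card_le_card (filter_subset_inter_outerEdges hS h_disj v)).trans (h_outer v hv)

lemma le_bprob_forall_card_le_one (hp0 : 0 ≤ p) (hp1 : p ≤ 1) (hd : ∀ v ∈ K, Γ.degree v = d) :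
    (1 - p) ^ (K.card ^ 2) * ((1 - p) ^ d * (1 + (d - K.card : ℕ) * p)) ^ K.card ≤
      bprob Γ.edgeFinset p (fun S => ∀ v ∈ K, (S.filter (v ∈ ·)).card ≤ 1) := by
  have h0 : 0 ≤ 1 - p := sub_nonneg.2 hp1
  refine le_trans ?_ (prod_bprob_outerEdges_le hp0 hp1 K)
  refine mul_le_mul (pow_le_pow_of_le_one h0 (by linarith) (card_innerEdges_le Γ K)) ?_
    (by positivity) (by positivity)
  rw [← Finset.prod_const]
  refine Finset.prod_le_prod (fun v _ => by positivity) fun v hv => ?_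
  have h_ge := degree_le_card_outerEdges_add Γ K v
  have h_le := card_outerEdges_le Γ K v
  rw [hd v hv] at h_ge h_le
  exact le_bprob_card_le_one hp0 hp1 (by omega) h_le

/-- The vertices in `M` that are incident to at most one edge of `S`. -/
def lowVertices (M : Finset V) (S : Finset (Sym2 V)) : Finset V :=
  M.filter fun v => (S.filter (v ∈ ·)).card ≤ 1

variable (Γ) in
/-- The `k`-th binomial moment of the number of vertices in `M` whose degree in the random subgraph
is at most one. -/
noncomputable def lowMoment (M : Finset V) (p : ℝ) (k : ℕ) : ℝ :=
  bexp Γ.edgeFinset p fun S => (lowVertices M S).card.choose k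

lemma lowMoment_eq_sum (M : Finset V) (p : ℝ) (k : ℕ) :
    lowMoment Γ M p k = ∑ K ∈ M.powersetCard k,
      bprob Γ.edgeFinset p (fun S => ∀ v ∈ K, (S.filter (v ∈ ·)).card ≤ 1) := by
  classical
  unfold lowMoment bprob
  rw [← bexp_sum]
  refine bexp_congr fun S _ => ?_
  have h_powerset : (lowVertices M S).powersetCard k =
      (M.powersetCard k).filter fun K => ∀ v ∈ K, (S.filter (v ∈ ·)).card ≤ 1 := by
    ext K
    simp only [lowVertices, Finset.mem_powersetCard, Finset.mem_filter, Finset.subset_iff]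
    exact ⟨fun ⟨h, hk⟩ => ⟨⟨fun v hv => (h hv).1, hk⟩, fun v hv => (h hv).2⟩,
      fun ⟨⟨hM, hk⟩, h⟩ => ⟨fun v hv => ⟨hM hv, h v hv⟩, hk⟩⟩
  rw [← Finset.card_powersetCard, h_powerset, ← Finset.sum_boole]
  exact Finset.sum_congr rfl fun K _ => by congr

lemma lowMoment_le (hp0 : 0 ≤ p) (hp1 : p ≤ 1) (hd : ∀ v ∈ M, Γ.degree v = d) (k : ℕ) :
    lowMoment Γ M p k ≤ M.card.choose k * ((1 - p) ^ (d - k - 1) * (1 + d * p)) ^ k := by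
  rw [lowMoment_eq_sum, ← Finset.card_powersetCard, ← nsmul_eq_mul]
  refine Finset.sum_le_card_nsmul _ _ _ fun K hK => ?_
  obtain ⟨hKM, rfl⟩ := Finset.mem_powersetCard.1 hK
  exact bprob_forall_card_le_one_le hp0 hp1 fun v hv => hd v (hKM hv)

lemma le_lowMoment (hp0 : 0 ≤ p) (hp1 : p ≤ 1) (hd : ∀ v ∈ M, Γ.degree v = d) (k : ℕ) :
    M.card.choose k * ((1 - p) ^ (k ^ 2) * ((1 - p) ^ d * (1 + (d - k : ℕ) * p)) ^ k) ≤
      lowMoment Γ M p k := by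
  rw [lowMoment_eq_sum, ← Finset.card_powersetCard, ← nsmul_eq_mul]
  refine Finset.card_nsmul_le_sum _ _ _ fun K hK => ?_
  obtain ⟨hKM, rfl⟩ := Finset.mem_powersetCard.1 hK
  exact le_bprob_forall_card_le_one hp0 hp1 fun v hv => hd v (hKM hv)

lemma sum_lowMoment_eq (M : Finset V) (p : ℝ) (N : ℕ) :
    ∑ k ∈ Finset.range N, (-1 : ℝ) ^ k * lowMoment Γ M p k = bexp Γ.edgeFinset p fun S =>
      ∑ k ∈ Finset.range N, (-1 : ℝ) ^ k * (lowVertices M S).card.choose k := by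
  rw [bexp_sum]
  exact Finset.sum_congr rfl fun k _ => (bexp_const_mul _ _ _ _).symm

lemma bprob_forall_two_le_card_eq (M : Finset V) (p : ℝ) :
    bprob Γ.edgeFinset p (fun S => ∀ v ∈ M, 2 ≤ (S.filter (v ∈ ·)).card) =
      bexp Γ.edgeFinset p fun S => if (lowVertices M S).card = 0 then 1 else 0 := by
  classical
  refine bexp_congr fun S _ => ?_
  have h_iff : (lowVertices M S).card = 0 ↔ ∀ v ∈ M, 2 ≤ (S.filter (v ∈ ·)).card := by
    rw [lowVertices, Finset.card_eq_zero, Finset.filter_eq_empty_iff]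
    simp only [not_le, Nat.lt_iff_add_one_le]
  simp only [h_iff]
  congr

lemma sum_lowMoment_le (hp0 : 0 ≤ p) (hp1 : p ≤ 1) (M : Finset V) (m : ℕ) :
    ∑ k ∈ Finset.range (2 * m), (-1 : ℝ) ^ k * lowMoment Γ M p k ≤
      bprob Γ.edgeFinset p (fun S => ∀ v ∈ M, 2 ≤ (S.filter (v ∈ ·)).card) := by
  rw [sum_lowMoment_eq, bprob_forall_two_le_card_eq]
  exact bexp_mono hp0 hp1 fun S _ => sum_range_two_mul_neg_one_pow_mul_choose_le _ _

lemma le_sum_lowMoment (hp0 : 0 ≤ p) (hp1 : p ≤ 1) (M : Finset V) (m : ℕ) :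
    bprob Γ.edgeFinset p (fun S => ∀ v ∈ M, 2 ≤ (S.filter (v ∈ ·)).card) ≤
      ∑ k ∈ Finset.range (2 * m + 1), (-1 : ℝ) ^ k * lowMoment Γ M p k := by
  rw [sum_lowMoment_eq, bprob_forall_two_le_card_eq]
  exact bexp_mono hp0 hp1 fun S _ => le_sum_range_two_mul_add_one_neg_one_pow_mul_choose _ _

lemma bprob_card_filter_mem_le_one_le (hp0 : 0 ≤ p) (hp1 : p ≤ 1) {v : V} (hd : d ≤ Γ.degree v) :
    bprob Γ.edgeFinset p (fun S => (S.filter (v ∈ ·)).card ≤ 1) ≤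
      (1 - p) ^ (d - 1) * (1 + d * p) := by
  obtain ⟨A, hA, hAd⟩ := Finset.exists_subset_card_eq
    (hd.trans_eq (card_filter_mem_edgeFinset Γ v).symm)
  calc bprob Γ.edgeFinset p (fun S => (S.filter (v ∈ ·)).card ≤ 1)
      ≤ bprob Γ.edgeFinset p (fun S => (S ∩ A).card ≤ 1) := by
        refine bprob_mono hp0 hp1 fun S _ h => (Finset.card_le_card fun e he => ?_).trans h
        rw [Finset.mem_inter] at he
        exact Finset.mem_filter.2 ⟨he.1, (Finset.mem_filter.1 (hA he.2)).2⟩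
    _ = bprob A p (fun S => S.card ≤ 1) :=
        bprob_inter (hA.trans (Finset.filter_subset _ _)) p fun S => S.card ≤ 1
    _ ≤ (1 - p) ^ (d - 1) * (1 + d * p) := bprob_card_le_one_le hp0 hp1 hAd.ge hAd.le

lemma bprob_not_forall_two_le_card_le (hp0 : 0 ≤ p) (hp1 : p ≤ 1) (hd : ∀ v, d ≤ Γ.degree v) :
    bprob Γ.edgeFinset p (fun S => ¬ ∀ v, 2 ≤ (S.filter (v ∈ ·)).card) ≤
      Fintype.card V * ((1 - p) ^ (d - 1) * (1 + d * p)) := by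
  calc bprob Γ.edgeFinset p (fun S => ¬ ∀ v, 2 ≤ (S.filter (v ∈ ·)).card)
      = bprob Γ.edgeFinset p (fun S => ∃ v ∈ Finset.univ, (S.filter (v ∈ ·)).card ≤ 1) :=
        bprob_congr fun S _ => by
          simp only [not_forall, not_le, Nat.lt_succ_iff, Finset.mem_univ, true_and]
    _ ≤ ∑ v, bprob Γ.edgeFinset p (fun S => (S.filter (v ∈ ·)).card ≤ 1) :=
        bprob_exists_le hp0 hp1 _ _
    _ ≤ ∑ _v : V, (1 - p) ^ (d - 1) * (1 + d * p) :=
        Finset.sum_le_sum fun v _ => bprob_card_filter_mem_le_one_le hp0 hp1 (hd v)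
    _ = _ := by rw [Finset.sum_const, nsmul_eq_mul, Finset.card_univ]

end LowDegree

section Threshold

/-- The expected degree around which random subgraphs with `n` vertices become Hamiltonian. -/
noncomputable def thresholdDegree (n : ℕ) : ℝ := Real.log n + Real.log (Real.log n)

/-- A sequence of retention probabilities `p i` for which a vertex of degree `d i` in a graph with
`n i` vertices has expected degree `thresholdDegree (n i) + c₀ + o(1)` in the random subgraph.
The growth condition on `d` makes `(1 - p i) ^ d i` asymptotic to `exp (-(p i * d i))`. -/
structure ThresholdWindow (n d : ℕ → ℕ) (p : ℕ → ℝ) (c₀ : ℝ) : Prop where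
  nonneg : ∀ i, 0 ≤ p i
  le_one : ∀ i, p i ≤ 1
  tendsto_card : Tendsto n atTop atTop
  tendsto_log_sq_div : Tendsto (fun i => Real.log (n i) ^ 2 / d i) atTop (𝓝 0)
  tendsto_sub : Tendsto (fun i => p i * d i - thresholdDegree (n i)) atTop (𝓝 c₀)

variable {n d : ℕ → ℕ} {p : ℕ → ℝ} {c₀ : ℝ}

lemma tendsto_log_natCast (hn : Tendsto n atTop atTop) :
    Tendsto (fun i => Real.log (n i)) atTop atTop :=
  Real.tendsto_log_atTop.comp (tendsto_natCast_atTop_atTop.comp hn)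

lemma tendsto_log_log_natCast (hn : Tendsto n atTop atTop) :
    Tendsto (fun i => Real.log (Real.log (n i))) atTop atTop :=
  Real.tendsto_log_atTop.comp (tendsto_log_natCast hn)

lemma tendsto_log_sq_div_of_mul_le (hn : Tendsto n atTop atTop) {κ : ℝ} (hκ : 0 < κ) {x : ℕ → ℝ}
    (hx : ∀ᶠ i in atTop, κ * n i ≤ x i) :
    Tendsto (fun i => Real.log (n i) ^ 2 / x i) atTop (𝓝 0) := by
  have h_log : Tendsto (fun i => Real.log (n i) ^ 2 / (κ * n i)) atTop (𝓝 0) := by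
    simpa [Function.comp_def] using (Real.tendsto_pow_log_div_mul_add_atTop κ 0 2 hκ.ne').comp
      (tendsto_natCast_atTop_atTop.comp hn)
  refine squeeze_zero' ?_ ?_ h_log
  · filter_upwards [hx] with i hi
    have : 0 ≤ x i := le_trans (by positivity) hi
    positivity
  · filter_upwards [hx, hn.eventually_gt_atTop 0] with i hi hni
    gcongr

lemma tendsto_thresholdDegree_add_div_log (hn : Tendsto n atTop atTop) {c : ℕ → ℝ}
    (hc : Tendsto c atTop (𝓝 c₀)) :
    Tendsto (fun i => (thresholdDegree (n i) + c i) / Real.log (n i)) atTop (𝓝 1) := by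
  have h_log := tendsto_log_natCast hn
  have h_loglog : Tendsto (fun i => Real.log (Real.log (n i)) / Real.log (n i)) atTop (𝓝 0) :=
    Real.isLittleO_log_id_atTop.tendsto_div_nhds_zero.comp h_log
  have h_lim := (h_loglog.const_add 1).add (hc.div_atTop h_log)
  rw [add_zero, add_zero] at h_lim
  refine h_lim.congr' ?_
  filter_upwards [h_log.eventually_gt_atTop 0] with i hi
  rw [thresholdDegree]
  field_simp

lemma tendsto_thresholdDegree_add_div (hn : Tendsto n atTop atTop) {c x : ℕ → ℝ}
    (hc : Tendsto c atTop (𝓝 c₀)) (hx : Tendsto (fun i => Real.log (n i) ^ 2 / x i) atTop (𝓝 0)) :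
    Tendsto (fun i => (thresholdDegree (n i) + c i) / x i) atTop (𝓝 0) := by
  have h_log := tendsto_log_natCast hn
  have h_lim := ((tendsto_thresholdDegree_add_div_log hn hc).mul hx).div_atTop h_log
  refine h_lim.congr' ?_
  filter_upwards [h_log.eventually_gt_atTop 0] with i hi
  field_simp

lemma exists_thresholdWindow (hn : Tendsto n atTop atTop) (hd : Tendsto d atTop atTop)
    (hnd : Tendsto (fun i => Real.log (n i) ^ 2 / d i) atTop (𝓝 0)) (c₀ : ℝ) :
    ∃ p, ThresholdWindow n d p c₀ ∧
      ∀ᶠ i in atTop, p i * d i = thresholdDegree (n i) + c₀ := by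
  have h_mul : ∀ᶠ i in atTop,
      max 0 (min 1 ((thresholdDegree (n i) + c₀) / d i)) * d i = thresholdDegree (n i) + c₀ := by
    filter_upwards [(tendsto_thresholdDegree_add_div hn (tendsto_const_nhds (x := c₀))
      hnd).eventually_le_const one_pos, (tendsto_log_natCast hn).eventually_ge_atTop 0,
      (tendsto_log_log_natCast hn).eventually_ge_atTop (-c₀), hd.eventually_gt_atTop 0]
      with i h_le_one h_log h_loglog hdi
    have : 0 ≤ thresholdDegree (n i) + c₀ := by unfold thresholdDegree; linarith
    rw [min_eq_right h_le_one, max_eq_right (by positivity), div_mul_cancel₀]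
    exact_mod_cast hdi.ne'
  refine ⟨_, ⟨fun i => le_max_left _ _, fun i => max_le zero_le_one (min_le_left _ _), hn, hnd,
    tendsto_const_nhds.congr' ?_⟩, h_mul⟩
  filter_upwards [h_mul] with i hi
  rw [hi, add_sub_cancel_left]

namespace ThresholdWindow

lemma tendsto_log (h : ThresholdWindow n d p c₀) :
    Tendsto (fun i => Real.log (n i)) atTop atTop :=
  tendsto_log_natCast h.tendsto_card

lemma tendsto_mul_div_log (h : ThresholdWindow n d p c₀) :
    Tendsto (fun i => p i * d i / Real.log (n i)) atTop (𝓝 1) := by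
  simpa using tendsto_thresholdDegree_add_div_log h.tendsto_card h.tendsto_sub

lemma tendsto_degree (h : ThresholdWindow n d p c₀) : Tendsto d atTop atTop := by
  have h_mul := h.tendsto_mul_div_log.pos_mul_atTop one_pos h.tendsto_log
  refine tendsto_natCast_atTop_iff.1 (tendsto_atTop_mono' atTop ?_ h_mul)
  filter_upwards [h.tendsto_log.eventually_gt_atTop 0] with i hi
  rw [div_mul_cancel₀ _ hi.ne']
  exact mul_le_of_le_one_left (Nat.cast_nonneg _) (h.le_one i)

lemma tendsto_p (h : ThresholdWindow n d p c₀) : Tendsto p atTop (𝓝 0) := by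
  refine (tendsto_thresholdDegree_add_div h.tendsto_card h.tendsto_sub
    h.tendsto_log_sq_div).congr' ?_
  filter_upwards [h.tendsto_degree.eventually_gt_atTop 0] with i hi
  rw [add_sub_cancel, mul_div_cancel_right₀]
  exact_mod_cast hi.ne'

lemma tendsto_sq_mul_degree (h : ThresholdWindow n d p c₀) :
    Tendsto (fun i => p i ^ 2 * d i) atTop (𝓝 0) := by
  have h_lim := (h.tendsto_mul_div_log.pow 2).mul h.tendsto_log_sq_div
  rw [mul_zero] at h_lim
  refine h_lim.congr' ?_
  filter_upwards [h.tendsto_log.eventually_gt_atTop 0,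
    h.tendsto_degree.eventually_gt_atTop 0] with i hL hd
  field_simp

lemma tendsto_degree_mul_log_add (h : ThresholdWindow n d p c₀) :
    Tendsto (fun i => d i * (p i + Real.log (1 - p i))) atTop (𝓝 0) := by
  have h_lim := h.tendsto_sq_mul_degree.const_mul 2
  rw [mul_zero] at h_lim
  refine squeeze_zero_norm' ?_ h_lim
  filter_upwards [h.tendsto_p.eventually_le_const one_half_pos] with i hi
  have h_taylor : |p i + Real.log (1 - p i)| ≤ 2 * p i ^ 2 := by
    have h_abs := abs_of_nonneg (h.nonneg i)
    have h_bound := Real.abs_log_sub_add_sum_range_le (x := p i) (by rw [h_abs]; linarith) 1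
    rw [h_abs] at h_bound
    calc |p i + Real.log (1 - p i)| ≤ p i ^ 2 / (1 - p i) := by simpa using h_bound
      _ ≤ 2 * p i ^ 2 := by
        rw [div_le_iff₀ (by linarith)]
        nlinarith [sq_nonneg (p i)]
  rw [norm_mul, Real.norm_eq_abs, Real.norm_eq_abs, Nat.abs_cast]
  calc (d i : ℝ) * |p i + Real.log (1 - p i)| ≤ d i * (2 * p i ^ 2) := by gcongr
    _ = 2 * (p i ^ 2 * d i) := by ring

lemma tendsto_mul_pow_mul_log (h : ThresholdWindow n d p c₀) :
    Tendsto (fun i => n i * (1 - p i) ^ d i * Real.log (n i)) atTop (𝓝 (Real.exp (-c₀))) := by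
  have h_exponent := h.tendsto_sub.neg.add h.tendsto_degree_mul_log_add
  rw [add_zero] at h_exponent
  refine ((Real.continuous_exp.tendsto _).comp h_exponent).congr' ?_
  filter_upwards [h.tendsto_p.eventually_lt_const one_pos, h.tendsto_card.eventually_gt_atTop 0,
    h.tendsto_log.eventually_gt_atTop 0] with i hp hn hL
  have hn : (0 : ℝ) < n i := by exact_mod_cast hn
  have h_split : -(p i * d i - thresholdDegree (n i)) + d i * (p i + Real.log (1 - p i)) =
      Real.log (n i) + d i * Real.log (1 - p i) + Real.log (Real.log (n i)) := by
    rw [thresholdDegree]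
    ring
  rw [Function.comp, h_split, Real.exp_add, Real.exp_add, Real.exp_log hn, Real.exp_log hL,
    Real.exp_nat_mul, Real.exp_log (sub_pos.2 hp)]

lemma tendsto_mul_pow_mul (h : ThresholdWindow n d p c₀) :
    Tendsto (fun i => n i * ((1 - p i) ^ d i * (1 + d i * p i))) atTop (𝓝 (Real.exp (-c₀))) := by
  have h_lim := h.tendsto_mul_pow_mul_log.mul
    (h.tendsto_mul_div_log.add (h.tendsto_log.const_div_atTop 1))
  rw [add_zero, mul_one] at h_lim
  refine h_lim.congr' ?_
  filter_upwards [h.tendsto_log.eventually_gt_atTop 0] with i hi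
  field_simp
  ring

lemma tendsto_one_sub_pow (h : ThresholdWindow n d p c₀) (k : ℕ) :
    Tendsto (fun i => (1 - p i) ^ k) atTop (𝓝 1) := by
  simpa using (h.tendsto_p.const_sub 1).pow k

lemma tendsto_mul_pow_sub_mul (h : ThresholdWindow n d p c₀) (k : ℕ) :
    Tendsto (fun i => n i * ((1 - p i) ^ (d i - k) * (1 + d i * p i))) atTop
      (𝓝 (Real.exp (-c₀))) := by
  have h_lim := h.tendsto_mul_pow_mul.div (h.tendsto_one_sub_pow k) one_ne_zero
  rw [div_one] at h_lim
  refine h_lim.congr' ?_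
  filter_upwards [h.tendsto_p.eventually_lt_const one_pos,
    h.tendsto_degree.eventually_ge_atTop k] with i hp hk
  have : 1 - p i ≠ 0 := (sub_pos.2 hp).ne'
  rw [Pi.div_apply, ← Nat.sub_add_cancel hk, pow_add, Nat.add_sub_cancel]
  field_simp

lemma tendsto_mul_pow_mul_sub (h : ThresholdWindow n d p c₀) (k : ℕ) :
    Tendsto (fun i => n i * ((1 - p i) ^ d i * (1 + (d i - k : ℕ) * p i))) atTop
      (𝓝 (Real.exp (-c₀))) := by
  have h_pow := h.tendsto_mul_pow_mul_log.div_atTop h.tendsto_log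
  have h_lim := h.tendsto_mul_pow_mul.sub (h_pow.mul (h.tendsto_p.const_mul (k : ℝ)))
  rw [zero_mul, sub_zero] at h_lim
  refine h_lim.congr' ?_
  filter_upwards [h.tendsto_log.eventually_gt_atTop 0,
    h.tendsto_degree.eventually_ge_atTop k] with i hL hk
  rw [mul_div_cancel_right₀ _ hL.ne', Nat.cast_sub hk]
  ring

end ThresholdWindow

lemma tendsto_choose_div_pow {N : ℕ → ℕ} (hn : Tendsto n atTop atTop) {μ : ℝ} (hμ : 0 < μ)
    (hN : Tendsto (fun i => (N i : ℝ) / n i) atTop (𝓝 μ)) (k : ℕ) :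
    Tendsto (fun i => ((N i).choose k : ℝ) / (n i : ℝ) ^ k) atTop (𝓝 (μ ^ k / k.factorial)) := by
  have h_eq : ∀ᶠ i in atTop, (N i : ℝ) / n i * n i = N i := by
    filter_upwards [hn.eventually_gt_atTop 0] with i hi
    exact div_mul_cancel₀ _ (by exact_mod_cast hi.ne')
  have hN_top : Tendsto N atTop atTop := tendsto_natCast_atTop_iff.1 <|
    (hN.pos_mul_atTop hμ (tendsto_natCast_atTop_atTop.comp hn)).congr' h_eq
  have h_equiv := ((isEquivalent_choose k).comp_tendsto hN_top).div
    (Asymptotics.IsEquivalent.refl (u := fun i => (n i : ℝ) ^ k))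
  refine h_equiv.symm.tendsto_nhds (((hN.pow k).div_const _).congr fun i => ?_)
  simp only [Pi.div_apply, Function.comp]
  rw [div_pow, div_right_comm]

theorem ThresholdWindow.tendsto_bprob_forall_two_le_card (h : ThresholdWindow n d p c₀)
    {V : ℕ → Type*} [∀ i, Fintype (V i)] [∀ i, DecidableEq (V i)]
    (Γ : ∀ i, SimpleGraph (V i)) [∀ i, DecidableRel (Γ i).Adj] (M : ∀ i, Finset (V i))
    (hM : ∀ i, ∀ v ∈ M i, (Γ i).degree v = d i) {μ : ℝ} (hμ : 0 < μ)
    (hMμ : Tendsto (fun i => ((M i).card : ℝ) / n i) atTop (𝓝 μ)) :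
    Tendsto (fun i => bprob (Γ i).edgeFinset (p i)
      (fun S => ∀ v ∈ M i, 2 ≤ (S.filter (v ∈ ·)).card)) atTop
      (𝓝 (Real.exp (-(μ * Real.exp (-c₀))))) := by
  refine tendsto_exp_neg_of_bonferroni (e := fun k i => lowMoment (Γ i) (M i) (p i) k)
    (fun i m => sum_lowMoment_le (h.nonneg i) (h.le_one i) _ m)
    (fun i m => le_sum_lowMoment (h.nonneg i) (h.le_one i) _ m) fun k => ?_
  have h_choose := tendsto_choose_div_pow h.tendsto_card hμ hMμ k
  have h_up := h_choose.mul ((h.tendsto_mul_pow_sub_mul (k + 1)).pow k)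
  have h_low := h_choose.mul
    ((h.tendsto_one_sub_pow (k ^ 2)).mul ((h.tendsto_mul_pow_mul_sub k).pow k))
  rw [← mul_div_right_comm, ← mul_pow] at h_up
  rw [one_mul, ← mul_div_right_comm, ← mul_pow] at h_low
  refine tendsto_of_tendsto_of_tendsto_of_le_of_le' h_low h_up ?_ ?_
  · filter_upwards [h.tendsto_card.eventually_gt_atTop 0] with i hi
    refine le_trans (le_of_eq ?_) (le_lowMoment (h.nonneg i) (h.le_one i) (hM i) k)
    rw [mul_pow (n i : ℝ)]
    field_simp
  · filter_upwards [h.tendsto_card.eventually_gt_atTop 0] with i hi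
    refine (lowMoment_le (h.nonneg i) (h.le_one i) (hM i) k).trans (le_of_eq ?_)
    rw [mul_pow (n i : ℝ), Nat.sub_sub]
    field_simp

theorem ThresholdWindow.tendsto_bprob_forall_two_le_card_and_not_isHamiltonian
    (h : ThresholdWindow n d p c₀) {κ : ℝ} (hκ : 1 / 2 < κ) (hnd : ∀ᶠ i in atTop, κ * n i ≤ d i)
    {V : ℕ → Type*} [∀ i, Fintype (V i)] [∀ i, DecidableEq (V i)]
    (hn : ∀ i, Fintype.card (V i) = n i)
    (Γ : ∀ i, SimpleGraph (V i)) [∀ i, DecidableRel (Γ i).Adj]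
    (hd : ∀ i v, d i ≤ (Γ i).degree v) :
    Tendsto (fun i => bprob (Γ i).edgeFinset (p i) (fun S =>
      (∀ v, 2 ≤ (S.filter (v ∈ ·)).card) ∧ ¬ (edgeGraph S).IsHamiltonian)) atTop (𝓝 0) := by
  refine tendsto_order.2 ⟨fun x hx => Eventually.of_forall fun i => hx.trans_le
    (bprob_nonneg (h.nonneg i) (h.le_one i) _), fun x hx => ?_⟩
  filter_upwards [hnd, h.tendsto_card.eventually_gt_atTop 0, h.tendsto_log.eventually_gt_atTop 0,
    h.tendsto_card.eventually
      (eventually_bprob_not_isHamiltonian_le (sub_pos.2 hκ) (half_pos hx)),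
    h.tendsto_mul_div_log.eventually_lt_const one_lt_two,
    h.tendsto_sub.eventually_const_lt (sub_one_lt c₀),
    (tendsto_log_log_natCast h.tendsto_card).eventually_ge_atTop (1 - c₀)]
    with i hndi hni hL h_bound h_mul h_sub h_loglog
  have hni : (0 : ℝ) < n i := by exact_mod_cast hni
  have hp := h.nonneg i
  rw [div_lt_iff₀ hL] at h_mul
  refine (h_bound (V i) (Γ i) (d i) (p i) (hn i) (hd i) ?_ ?_ ?_).trans_lt (half_lt_self hx)
  · rwa [add_sub_cancel]
  · rw [le_div_iff₀ hni]
    nlinarith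
  · rw [thresholdDegree] at h_sub
    linarith

end Threshold

section Hamiltonian

variable {V : Type*} [Fintype V] [DecidableEq V] {Γ : SimpleGraph V} [DecidableRel Γ.Adj]
  {p : unitInterval} {q : ℝ}

lemma bprob_isHamiltonian_mono {p q : ℝ} (hp0 : 0 ≤ p) (hpq : p ≤ q) (hq1 : q ≤ 1) :
    bprob Γ.edgeFinset p (fun S => (edgeGraph S).IsHamiltonian) ≤
      bprob Γ.edgeFinset q (fun S => (edgeGraph S).IsHamiltonian) := by
  refine bexp_mono_param hp0 hpq hq1 fun S T hST _ => ?_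
  by_cases h : (edgeGraph S).IsHamiltonian
  · simp [h, h.mono (edgeGraph_mono hST)]
  · simp only [h, if_false]
    split_ifs <;> norm_num

lemma bprob_isHamiltonian_eq (h2 : 2 ≤ Fintype.card V) (q : ℝ) :
    bprob Γ.edgeFinset q (fun S => (edgeGraph S).IsHamiltonian) =
      bprob Γ.edgeFinset q (fun S => ∀ v, 2 ≤ (S.filter (v ∈ ·)).card) -
      bprob Γ.edgeFinset q (fun S => (∀ v, 2 ≤ (S.filter (v ∈ ·)).card) ∧
        ¬ (edgeGraph S).IsHamiltonian) := by
  rw [eq_sub_iff_add_eq, bprob, bprob, bprob, ← bexp_add]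
  refine bexp_congr fun S hS => ?_
  by_cases h : (edgeGraph S).IsHamiltonian
  · have h_deg := two_le_card_filter_of_isHamiltonian (fun _ he =>
      Γ.not_isDiag_of_mem_edgeSet (SimpleGraph.mem_edgeFinset.1 (hS he))) h2 h
    simp [h, h_deg]
  · by_cases h_deg : ∀ v, 2 ≤ (S.filter (v ∈ ·)).card <;> simp [h, h_deg]

lemma probHamiltonian_le_bprob (h2 : 2 ≤ Fintype.card V) (hpq : p ≤ q) (hq1 : q ≤ 1) :
    probHamiltonian Γ p ≤
      bprob Γ.edgeFinset q (fun S => ∀ v, 2 ≤ (S.filter (v ∈ ·)).card) := by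
  rw [probHamiltonian_eq_bprob]
  refine (bprob_isHamiltonian_mono p.2.1 hpq hq1).trans ?_
  rw [bprob_isHamiltonian_eq h2]
  exact sub_le_self _ (bprob_nonneg (p.2.1.trans hpq) hq1 _)

lemma one_sub_le_probHamiltonian {d : ℕ} (h2 : 2 ≤ Fintype.card V) (hq0 : 0 ≤ q) (hqp : q ≤ p)
    (hd : ∀ v, d ≤ Γ.degree v) :
    1 - Fintype.card V * ((1 - q) ^ (d - 1) * (1 + d * q)) -
      bprob Γ.edgeFinset q (fun S => (∀ v, 2 ≤ (S.filter (v ∈ ·)).card) ∧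
        ¬ (edgeGraph S).IsHamiltonian) ≤ probHamiltonian Γ p := by
  have h_low := bprob_not_forall_two_le_card_le hq0 (hqp.trans p.2.2) hd
  have h_mono := bprob_isHamiltonian_mono (Γ := Γ) hq0 hqp p.2.2
  rw [bprob_not] at h_low
  rw [bprob_isHamiltonian_eq h2] at h_mono
  rw [probHamiltonian_eq_bprob]
  linarith

end Hamiltonian

section Limits

lemma exists_subset_tendsto_card_div {V : ℕ → Type*} {n : ℕ → ℕ} (hn : Tendsto n atTop atTop)
    {ε : ℝ} (hε : 0 ≤ ε) {T : ∀ i, Finset (V i)} (hT : ∀ i, ε * n i ≤ (T i).card) :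
    ∃ M : ∀ i, Finset (V i), (∀ i, M i ⊆ T i) ∧
      Tendsto (fun i => ((M i).card : ℝ) / n i) atTop (𝓝 ε) := by
  choose M hMT hM using fun i => Finset.exists_subset_card_eq (Nat.ceil_le.2 (hT i))
  refine ⟨M, hMT, ?_⟩
  simp only [hM]
  exact (tendsto_nat_ceil_mul_div_atTop hε).comp (tendsto_natCast_atTop_atTop.comp hn)

lemma tendsto_atTop_of_mul_le {n d : ℕ → ℕ} (hn : Tendsto n atTop atTop) {κ : ℝ} (hκ : 0 < κ)
    (hnd : ∀ᶠ i in atTop, κ * n i ≤ d i) : Tendsto d atTop atTop :=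
  tendsto_natCast_atTop_iff.1 <| tendsto_atTop_mono' atTop hnd <|
    (tendsto_natCast_atTop_atTop.comp hn).const_mul_atTop hκ

lemma eventually_mul_le_of_abs_sub_le {n d : ℕ → ℕ} (hn : Tendsto n atTop atTop) {κ β : ℝ}
    (hκβ : κ < β) (hd : ∀ i, |(d i : ℝ) - β * n i| ≤ 1) : ∀ᶠ i in atTop, κ * n i ≤ d i := by
  filter_upwards [((tendsto_natCast_atTop_atTop.comp hn).const_mul_atTop
    (sub_pos.2 hκβ)).eventually_ge_atTop 1] with i hi
  rw [Function.comp] at hi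
  linarith [(abs_le.1 (hd i)).1]

lemma eventually_abs_sub_thresholdDegree_sub_le {n d : ℕ → ℕ} {p c : ℕ → ℝ} {β : ℝ}
    (hβ : 0 < β) (hn : Tendsto n atTop atTop) (hd : ∀ i, |(d i : ℝ) - β * n i| ≤ 1)
    (hp0 : ∀ i, 0 ≤ p i) (hp : ∀ᶠ i in atTop, p i = (thresholdDegree (n i) + c i) / (β * n i)) :
    ∀ᶠ i in atTop, |p i * d i - thresholdDegree (n i) - c i| ≤ p i := by
  filter_upwards [hp, hn.eventually_gt_atTop 0] with i hpi hni
  have : (0 : ℝ) < n i := by exact_mod_cast hni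
  have h_mul : p i * (β * n i) = thresholdDegree (n i) + c i := by
    rw [hpi, div_mul_cancel₀ _ (by positivity)]
  calc |p i * d i - thresholdDegree (n i) - c i| = |p i * (d i - β * n i)| := by
        congr 1
        linear_combination h_mul
    _ = p i * |d i - β * n i| := by rw [abs_mul, abs_of_nonneg (hp0 i)]
    _ ≤ p i := mul_le_of_le_one_right (hp0 i) (hd i)

lemma thresholdWindow_of_eventually_eq {n d : ℕ → ℕ} {p c : ℕ → ℝ} {β c₀ : ℝ} (hβ : 0 < β)
    (hn : Tendsto n atTop atTop) (hd : ∀ i, |(d i : ℝ) - β * n i| ≤ 1) (hp0 : ∀ i, 0 ≤ p i)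
    (hp1 : ∀ i, p i ≤ 1) (hp : ∀ᶠ i in atTop, p i = (thresholdDegree (n i) + c i) / (β * n i))
    (hc : Tendsto c atTop (𝓝 c₀)) : ThresholdWindow n d p c₀ where
  nonneg := hp0
  le_one := hp1
  tendsto_card := hn
  tendsto_log_sq_div := tendsto_log_sq_div_of_mul_le hn (half_pos hβ)
    (eventually_mul_le_of_abs_sub_le hn (half_lt_self hβ) hd)
  tendsto_sub := by
    have h_p : Tendsto p atTop (𝓝 0) := (tendsto_thresholdDegree_add_div hn hc
      (tendsto_log_sq_div_of_mul_le hn hβ (Eventually.of_forall fun _ => le_rfl))).congr'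
      (hp.mono fun _ => Eq.symm)
    simpa using (squeeze_zero_norm'
      (eventually_abs_sub_thresholdDegree_sub_le hβ hn hd hp0 hp) h_p).add hc

variable {V : ℕ → Type*} [∀ i, Fintype (V i)] [∀ i, DecidableEq (V i)] {n d : ℕ → ℕ}
  {Γ : ∀ i, SimpleGraph (V i)} [∀ i, DecidableRel (Γ i).Adj] {p : ℕ → unitInterval}

theorem tendsto_probHamiltonian_zero (hn : ∀ i, Fintype.card (V i) = n i)
    (hn_lim : Tendsto n atTop atTop) (hd : Tendsto d atTop atTop)
    (hnd : Tendsto (fun i => Real.log (n i) ^ 2 / d i) atTop (𝓝 0)) {ε : ℝ} (hε : 0 < ε)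
    (hmany : ∀ i, ε * n i ≤ (Finset.univ.filter fun v : V i => (Γ i).degree v = d i).card)
    (hp : Tendsto (fun i => (p i : ℝ) * d i - thresholdDegree (n i)) atTop atBot) :
    Tendsto (fun i => probHamiltonian (Γ i) (p i)) atTop (𝓝 0) := by
  refine tendsto_order.2 ⟨fun x hx => Eventually.of_forall fun i =>
    hx.trans_le measureReal_nonneg, fun x hx => ?_⟩
  obtain ⟨M, hMdeg, hMε⟩ := exists_subset_tendsto_card_div hn_lim hε.le hmany
  have h_lim : Tendsto (fun c₀ : ℝ => Real.exp (-(ε * Real.exp (-c₀)))) atBot (𝓝 0) :=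
    Real.tendsto_exp_neg_atTop_nhds_zero.comp
      ((Real.tendsto_exp_atTop.comp tendsto_neg_atBot_atTop).const_mul_atTop hε)
  obtain ⟨c₀, hc₀⟩ := (h_lim.eventually_lt_const hx).exists
  obtain ⟨q, hq, hqd⟩ := exists_thresholdWindow hn_lim hd hnd c₀
  have h_low := hq.tendsto_bprob_forall_two_le_card Γ M
    (fun i v hv => (Finset.mem_filter.1 (hMdeg i hv)).2) hε hMε
  filter_upwards [h_low.eventually_lt_const hc₀, hp.eventually_le_atBot c₀, hqd,
    hn_lim.eventually_ge_atTop 2, hd.eventually_gt_atTop 0] with i h_lt hpi hqi hni hdi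
  have hpq : (p i : ℝ) ≤ q i :=
    le_of_mul_le_mul_right (by linarith) (Nat.cast_pos.2 hdi : (0 : ℝ) < d i)
  calc probHamiltonian (Γ i) (p i)
      ≤ bprob (Γ i).edgeFinset (q i) (fun S => ∀ v, 2 ≤ (S.filter (v ∈ ·)).card) :=
        probHamiltonian_le_bprob ((hn i).symm ▸ hni) hpq (hq.le_one i)
    _ ≤ bprob (Γ i).edgeFinset (q i) (fun S => ∀ v ∈ M i, 2 ≤ (S.filter (v ∈ ·)).card) :=
        bprob_mono (hq.nonneg i) (hq.le_one i) fun S _ h v _ => h v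
    _ < x := h_lt

theorem tendsto_probHamiltonian_one (hn : ∀ i, Fintype.card (V i) = n i)
    (hn_lim : Tendsto n atTop atTop) {κ : ℝ} (hκ : 1 / 2 < κ)
    (hnd : ∀ᶠ i in atTop, κ * n i ≤ d i) (hd : ∀ i v, d i ≤ (Γ i).degree v)
    (hp : Tendsto (fun i => (p i : ℝ) * d i - thresholdDegree (n i)) atTop atTop) :
    Tendsto (fun i => probHamiltonian (Γ i) (p i)) atTop (𝓝 1) := by
  refine tendsto_order.2 ⟨fun x hx => ?_, fun x hx => Eventually.of_forall fun i =>
    probHamiltonian_eq_bprob (Γ i) (p i) ▸ (bprob_le_one (p i).2.1 (p i).2.2 _).trans_lt hx⟩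
  have hκ0 : 0 < κ := by linarith
  have hd_lim := tendsto_atTop_of_mul_le hn_lim hκ0 hnd
  have h_half : 0 < (1 - x) / 2 := by linarith
  obtain ⟨c₀, hc₀⟩ := (Real.tendsto_exp_neg_atTop_nhds_zero.eventually_lt_const h_half).exists
  obtain ⟨q, hq, hqd⟩ := exists_thresholdWindow hn_lim hd_lim
    (tendsto_log_sq_div_of_mul_le hn_lim hκ0 hnd) c₀
  filter_upwards [(hq.tendsto_mul_pow_sub_mul 1).eventually_lt_const hc₀,
    (hq.tendsto_bprob_forall_two_le_card_and_not_isHamiltonian hκ hnd hn Γ hd).eventually_lt_const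
      h_half, hp.eventually_ge_atTop c₀, hqd, hn_lim.eventually_ge_atTop 2,
    hd_lim.eventually_gt_atTop 0] with i h_low h_ham hpi hqi hni hdi
  have hqp : q i ≤ p i :=
    le_of_mul_le_mul_right (by linarith) (Nat.cast_pos.2 hdi : (0 : ℝ) < d i)
  have h_le := one_sub_le_probHamiltonian ((hn i).symm ▸ hni) (hq.nonneg i) hqp (hd i)
  rw [hn i] at h_le
  linarith

theorem tendsto_probHamiltonian_exp_neg_exp_neg (hn : ∀ i, Fintype.card (V i) = n i) {κ c₀ : ℝ}
    (hκ : 1 / 2 < κ) (hnd : ∀ᶠ i in atTop, κ * n i ≤ d i)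
    (hreg : ∀ i, (Γ i).IsRegularOfDegree (d i))
    (h : ThresholdWindow n d (fun i => p i) c₀) :
    Tendsto (fun i => probHamiltonian (Γ i) (p i)) atTop (𝓝 (Real.exp (-Real.exp (-c₀)))) := by
  have h_density : Tendsto (fun i => ((Finset.univ : Finset (V i)).card : ℝ) / n i) atTop
      (𝓝 1) := by
    refine tendsto_const_nhds.congr' ?_
    filter_upwards [h.tendsto_card.eventually_gt_atTop 0] with i hi
    rw [Finset.card_univ, hn i, div_self (by exact_mod_cast hi.ne')]
  have h_lim := (h.tendsto_bprob_forall_two_le_card Γ (fun _ => Finset.univ)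
    (fun i v _ => hreg i v) one_pos h_density).sub
    (h.tendsto_bprob_forall_two_le_card_and_not_isHamiltonian hκ hnd hn Γ
      fun i v => (hreg i v).ge)
  rw [sub_zero, one_mul] at h_lim
  refine h_lim.congr' ?_
  filter_upwards [h.tendsto_card.eventually_ge_atTop 2] with i hi
  rw [probHamiltonian_eq_bprob, bprob_isHamiltonian_eq ((hn i).symm ▸ hi)]
  simp only [Finset.mem_univ, true_imp_iff]

end Limits

theorem corollary3
    {ε β : ℝ} (hε : 0 < ε) (hβ : 1 / 2 < β)
    {V : ℕ → Type*} [∀ i, Fintype (V i)] [∀ i, DecidableEq (V i)]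
    (n : ℕ → ℕ) (hn : ∀ i, Fintype.card (V i) = n i) (hn_lim : Tendsto n atTop atTop)
    (Γ : ∀ i, SimpleGraph (V i)) [∀ i, DecidableRel (Γ i).Adj]
    -- `d i` is `β * n i` up to rounding
    (d : ℕ → ℕ) (hd : ∀ i, |(d i : ℝ) - β * n i| ≤ 1)
    (hmin : ∀ i, (Γ i).minDegree = d i)
    (hmany : ∀ i, ε * n i ≤ (Finset.univ.filter fun v : V i => (Γ i).degree v = d i).card)
    (c : ℕ → ℝ) (p : ℕ → unitInterval)
    (hp : ∀ᶠ i in atTop,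
      (p i : ℝ) = (Real.log (n i) + Real.log (Real.log (n i)) + c i) / (β * n i)) :
    (Tendsto c atTop atBot →
      Tendsto (fun i => probHamiltonian (Γ i) (p i)) atTop (𝓝 0)) ∧
    (Tendsto c atTop atTop →
      Tendsto (fun i => probHamiltonian (Γ i) (p i)) atTop (𝓝 1)) ∧
    ((∀ i, (Γ i).IsRegularOfDegree (d i)) →
      ∀ c₀ : ℝ, Tendsto c atTop (𝓝 c₀) →
        Tendsto (fun i => probHamiltonian (Γ i) (p i)) atTop
          (𝓝 (Real.exp (-Real.exp (-c₀))))) := by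
  obtain ⟨κ, hκ, hκβ⟩ := exists_between hβ
  have hκ0 : 0 < κ := one_half_pos.trans hκ
  have hβ0 : 0 < β := hκ0.trans hκβ
  have hp0 : ∀ i, (0 : ℝ) ≤ p i := fun i => (p i).2.1
  have hnd : ∀ᶠ i in atTop, κ * n i ≤ d i := eventually_mul_le_of_abs_sub_le hn_lim hκβ hd
  have h_shift : ∀ᶠ i in atTop, |(p i : ℝ) * d i - thresholdDegree (n i) - c i| ≤ 1 :=
    (eventually_abs_sub_thresholdDegree_sub_le hβ0 hn_lim hd hp0 hp).mono
      fun i hi => hi.trans (p i).2.2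
  refine ⟨fun hc => ?_, fun hc => ?_, fun hreg c₀ hc => ?_⟩
  · refine tendsto_probHamiltonian_zero hn hn_lim (tendsto_atTop_of_mul_le hn_lim hκ0 hnd)
      (tendsto_log_sq_div_of_mul_le hn_lim hκ0 hnd) hε hmany ?_
    exact tendsto_atBot_mono' atTop (h_shift.mono fun i hi => by linarith [(abs_le.1 hi).2])
      (tendsto_atBot_add_const_right atTop 1 hc)
  · refine tendsto_probHamiltonian_one hn hn_lim hκ hnd
      (fun i v => hmin i ▸ (Γ i).minDegree_le_degree v) ?_
    exact tendsto_atTop_mono' atTop (h_shift.mono fun i hi => by linarith [(abs_le.1 hi).1])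
      (tendsto_atTop_add_const_right atTop (-1) hc)
  · exact tendsto_probHamiltonian_exp_neg_exp_neg hn hκ hnd hreg <|
      thresholdWindow_of_eventually_eq hβ0 hn_lim hd hp0 (fun i => (p i).2.2) hp hc
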